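/- **Setting.** Let $\gamma\in\mathbb R$ and, for $\xi\in\mathbb R^2$, let $U(\xi)$ be the magnetic translation $(U(\xi)\psi)(x)=e^{-i\gamma\xi_2(x_1-\xi_1)}\psi(x-\xi)$ on $L^2(\mathbb R^2)$. Let $\Omega$ be a compact space on which $\mathbb R^2$ acts by homeomorphisms, $\mathbf P$ an invariant ergodic Borel probability measure on $\Omega$, and $\hat\Omega=\Omega\times(\mathbb R\cup\{\infty\})$ (neighbourhoods of $\infty$ being generated by the sets $(a,\infty]$) with the action $\xi\cdot(\omega,s)=(\xi\cdot\omega,s+\xi_2)$, $\infty+\xi_2=\infty$. Let $\mathcal A$ be the set of weakly continuous families $A=(A_{\hat\omega})_{\hat\omega\in\hat\Omega}$ of bounded integral operators $(A_{\hat\omega}\psi)(x)=\int\langle x|A_{\hat\omega}|y\rangle\psi(y)\,dy$ on $L^2(\mathbb R^2)$ such that $U(\xi)A_{\hat\omega}U(\xi)^*=A_{\xi\cdot\hat\omega}$ for all $\xi,\hat\omega$, and $\operatorname{ess\,sup}\|A_{\omega,s}\|<\infty$ with respect to $\mathbf P\otimes ds$ on $\Omega\times\mathbb R$. Let $\nabla_1A=i[X_1,A]$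 ($X_1$ the first position operator), and let $|\nabla_1|A$ have the kernels $|x_1-y_1|\langle x|A_{\hat\omega}|y\rangle$. Fix a bounded measurable $\chi\ge0$ on $\mathbb R$ with compact support and $\int\chi=1$, and let $\chi_1$ be multiplication by $\chi(x_1)$. A family $A$ is $\hat{\mathcal T}$-traceclass if $\int d\mathbf P(\omega)\,\|\chi_1A_{\omega,s}\|_1<\infty$ for every $s\in\mathbb R$ ($\|\cdot\|_1$ the trace norm), and then $\hat{\mathcal T}(A)=\int d\mathbf P(\omega)\,\mathrm{Tr}(\chi_1A_{\omega,s})$. Let $\Pi_1$ be the orthogonal projection of $L^2(\mathbb R^2)$ onto $L^2(\mathbb R_+\times\mathbb R)$. **Theorem.** Let $\mathcal U=(\mathcal U_{\hat\omega})$ be a family of unitaries such that $\mathcal U-1\in\mathcal A$ is $\hat{\mathcal T}$-traceclass and each $\mathcal U_{\hat\omega}-1$ has an integral kernel that is continuous in $(x,y)$. Suppose that $\nabla_1\mathcal U\in\mathcal A$ and $|\nabla_1|\,\mathcal U:=|\nabla_1|(\mathcal U-1)\in\mathcal A$. 1. For every $s\in\mathbb R$, the operator $\Pi_1\mathcal U_{\omega,s}\Pi_1$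 on $L^2(\mathbb R_+\times\mathbb R)$ is Fredholm for $\mathbf P$-almost every $\omega$. Moreover it is Fredholm for each $s\in\mathbb R$ and $\omega\in\Omega$ for which $\chi_1(\mathcal U_{\xi\cdot\omega,s}-1)$ is traceclass for all $\xi\in\mathbb R^2$; in particular it is Fredholm for every $\omega\in\Omega$ and $s\in\mathbb R$ if all $\chi_1(\mathcal U_{\omega,s}-1)$ are traceclass. 2. The family $(\mathcal U^*-1)\nabla_1\mathcal U$ is $\hat{\mathcal T}$-traceclass, and $\omega\mapsto\mathrm{Tr}\big(\chi_1(\mathcal U_{\omega,s}^*-1)(\nabla_1\mathcal U)_{\omega,s}\big)$ is $\mathbf P$-integrable for every $s\in\mathbb R$. 3. Suppose moreover that $\xi\in\mathbb R^2\mapsto\mathcal U_{\xi\cdot\omega,s}$ is norm-continuous for all $\omega\in\Omega$, $s\in\mathbb R$. Then the index $\mathrm{Ind}(\Pi_1\mathcal U_{\omega,s}\Pi_1)=\dim\ker-\dim\mathrm{coker}$ is independent of $s$ for each $\omega$ for which $\chi_1(\mathcal U_{\xi\cdot\omega,s}-1)$ is traceclass for all $\xi\in\mathbb R^2$ and $s\in\mathbb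 R$. Furthermore there is an integer $\mathrm{Ind}$ such that, for $\mathbf P$-almost every $\omega$ and all $s\in\mathbb R$, the operator $\Pi_1\mathcal U_{\omega,s}\Pi_1$ is Fredholm with index $\mathrm{Ind}$, and $$\mathrm{Ind}\;=\;\xi(\mathcal U^*-1,\mathcal U)\;=\;i\,\hat{\mathcal T}\big((\mathcal U^*-1)\nabla_1\mathcal U\big),\qquad \xi(A,B):=i\,\hat{\mathcal T}(A\nabla_1B),$$ where $\hat{\mathcal T}$ may be computed with any $s\in\mathbb R$. -/

import Mathlib

open MeasureTheory Filter
open scoped ENNReal InnerProductSpace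

noncomputable section

/-- The plane `ℝ²`; coordinates are numbered `0, 1`, so `x 0` is the first one. -/
abbrev Plane : Type := EuclideanSpace ℝ (Fin 2)

/-- The Hilbert space `L²(ℝ²)`. -/
abbrev L2Plane : Type := Lp ℂ 2 (volume : Measure Plane)

/-- The half-plane `ℝ₊ × ℝ` of points with positive first coordinate. -/
def halfPlane : Set Plane := {x | 0 < x 0}

/-- The Hilbert space `L²(ℝ₊ × ℝ)`. -/
abbrev L2Half : Type := Lp ℂ 2 ((volume : Measure Plane).restrict halfPlane)

/-- Multiplication by an essentially bounded function `f`, as a bounded operator on `L²(ℝ²)`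
(the value `0` for other `f` is never used). -/
def mulOp (f : Plane → ℂ) : L2Plane →L[ℂ] L2Plane :=
  open Classical in
  if hf : MemLp f ∞ (volume : Measure Plane) then
    (ContinuousLinearMap.mul ℂ ℂ).holderL volume ∞ 2 2 (hf.toLp f)
  else 0

theorem mulOp_coeFn {f : Plane → ℂ} (hf : MemLp f ∞ (volume : Measure Plane)) (ψ : L2Plane) :
    (mulOp f ψ : Plane → ℂ) =ᵐ[volume] fun x => f x * ψ x := by
  have h : mulOp f ψ =
      (ContinuousLinearMap.mul ℂ ℂ).holder 2 (hf.toLp f) ψ := by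
    simp [mulOp, hf]
  rw [h]
  filter_upwards [(ContinuousLinearMap.mul ℂ ℂ).coeFn_holder (r := 2) (hf.toLp f) ψ,
    hf.coeFn_toLp] with x h1 h2
  rw [h1, h2]
  rfl

/-- The magnetic translation
`(U(ξ)ψ)(x) = exp(-i γ ξ₂ (x₁ - ξ₁)) ψ(x - ξ)` on `L²(ℝ²)`, for the magnetic field `γ`. -/
def magTranslation (γ : ℝ) (ξ : Plane) : L2Plane →L[ℂ] L2Plane :=
  (mulOp fun x => Complex.exp (((-(γ * ξ 1 * (x 0 - ξ 0)) : ℝ) : ℂ) * Complex.I)) ∘L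
    (Lp.compMeasurePreservingₗᵢ ℂ (fun x : Plane => x - ξ)
      (measurePreserving_sub_right volume ξ)).toContinuousLinearMap

theorem magTranslation_coeFn (γ : ℝ) (ξ : Plane) (ψ : L2Plane) :
    (magTranslation γ ξ ψ : Plane → ℂ) =ᵐ[volume] fun x =>
      Complex.exp (((-(γ * ξ 1 * (x 0 - ξ 0)) : ℝ) : ℂ) * Complex.I) * ψ (x - ξ) := by
  have hf : MemLp (fun x : Plane =>
      Complex.exp (((-(γ * ξ 1 * (x 0 - ξ 0)) : ℝ) : ℂ) * Complex.I)) ∞ volume := by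
    refine memLp_top_of_bound ?_ 1 (ae_of_all _ fun x => ?_)
    · exact (by fun_prop : Continuous _).aestronglyMeasurable
    · exact (Complex.norm_exp_ofReal_mul_I _).le
  filter_upwards [mulOp_coeFn hf (Lp.compMeasurePreservingₗᵢ ℂ (fun x : Plane => x - ξ)
      (measurePreserving_sub_right volume ξ) ψ),
    Lp.coeFn_compMeasurePreserving ψ (measurePreserving_sub_right volume ξ)] with x h1 h2
  exact h1.trans (congrArg _ h2)

/-- The bounded operator `T` on `L²(ℝ²)` is the integral operator with kernel `k`, that is,
`(T ψ)(x) = ∫ k(x, y) ψ(y) dy`, with `k(x, y)` for `⟨x|T|y⟩`. -/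
def HasKernel (T : L2Plane →L[ℂ] L2Plane) (k : Plane → Plane → ℂ) : Prop :=
  AEStronglyMeasurable (fun z : Plane × Plane => k z.1 z.2) (volume.prod volume) ∧
    ∀ ψ : L2Plane, ∀ᵐ x, Integrable (fun y => k x y * ψ y) ∧ T ψ x = ∫ y, k x y * ψ y

/-- The extended hull `Ω × (ℝ ∪ {∞})`; `WithTop ℝ` carries its order topology, in which the
sets `(a, ∞]` are the basic neighbourhoods of `∞ = ⊤`. -/
abbrev Hull (Ω : Type*) : Type _ := Ω × WithTop ℝ

/-- The action `ξ · (ω, s) = (ξ · ω, s + ξ₂)` on the extended hull, where `∞ + ξ₂ = ∞`. -/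
def hullShift {Ω : Type*} [VAdd Plane Ω] (ξ : Plane) (p : Hull Ω) : Hull Ω :=
  (ξ +ᵥ p.1, p.2 + ((ξ 1 : ℝ) : WithTop ℝ))

/-- The algebra of weakly continuous covariant families of bounded integral operators on
`L²(ℝ²)` that are indexed by the extended hull and essentially bounded. -/
structure IsCovariantFamily {Ω : Type*} [TopologicalSpace Ω] [MeasurableSpace Ω] [VAdd Plane Ω]
    (γ : ℝ) (P : Measure Ω) (A : Hull Ω → L2Plane →L[ℂ] L2Plane) : Prop where
  weaklyContinuous : ∀ φ ψ : L2Plane, Continuous fun p => ⟪φ, A p ψ⟫_ℂ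
  integralOperator : ∀ p, ∃ k, HasKernel (A p) k
  covariant : ∀ ξ p,
    magTranslation γ ξ * A p * star (magTranslation γ ξ) = A (hullShift ξ p)
  bounded : essSup (fun q : Ω × ℝ => ‖A (q.1, (q.2 : WithTop ℝ))‖ₑ) (P.prod volume) < ∞

/-- `D = ∇₁A`, that is, `D = i [X₁, A]` at every point of the hull: for every `ψ` in the domain of
the position operator `X₁` (`φ` being `X₁ψ`), the function `Aψ` is in this domain again and
`Dψ = i (X₁Aψ - AX₁ψ)`. -/
def IsNablaOne {Ω : Type*} (A D : Hull Ω → L2Plane →L[ℂ] L2Plane) : Prop :=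
  ∀ p, ∀ ψ φ : L2Plane, (∀ᵐ x, φ x = (x 0 : ℂ) * ψ x) →
    ∀ᵐ x, D p ψ x = Complex.I * ((x 0 : ℂ) * A p ψ x - A p φ x)

section Trace

variable {H : Type*} [NormedAddCommGroup H] [InnerProductSpace ℂ H] [CompleteSpace H]

/-- The index set of `someBasis`. -/
def someBasisIndex (H : Type*) [NormedAddCommGroup H] [InnerProductSpace ℂ H]
    [CompleteSpace H] : Set H :=
  (exists_hilbertBasis ℂ H).choose

/-- Some orthonormal basis of the Hilbert space `H`. -/
def someBasis (H : Type*) [NormedAddCommGroup H] [InnerProductSpace ℂ H]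
    [CompleteSpace H] : HilbertBasis (someBasisIndex H) ℂ H :=
  (exists_hilbertBasis ℂ H).choose_spec.choose

/-- The trace norm `‖T‖₁ = Tr |T|`, with `|T| = (T* T)^(1/2)`; `T` is traceclass if it is finite. -/
def traceNorm (T : H →L[ℂ] H) : ℝ≥0∞ :=
  ∑' i, ENNReal.ofReal (⟪someBasis H i, CFC.abs T (someBasis H i)⟫_ℂ).re

/-- The trace of a traceclass operator. -/
def opTrace (T : H →L[ℂ] H) : ℂ :=
  ∑' i, ⟪someBasis H i, T (someBasis H i)⟫_ℂ

end Trace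

/-- Multiplication by the function `x ↦ χ(x₁)`. -/
def cutoffOp (χ : ℝ → ℝ) : L2Plane →L[ℂ] L2Plane :=
  mulOp fun x => ((χ (x 0) : ℝ) : ℂ)

/-- `A` is `T̂`-traceclass: for finite `s`, the `P`-integral of `ω ↦ ‖χ₁ A_{ω,s}‖₁` is finite. -/
def IsTHatTraceClass {Ω : Type*} [MeasurableSpace Ω] (P : Measure Ω) (χ : ℝ → ℝ)
    (A : Hull Ω → L2Plane →L[ℂ] L2Plane) : Prop :=
  ∀ s : ℝ, ∫⁻ ω, traceNorm (cutoffOp χ * A (ω, (s : WithTop ℝ))) ∂P < ∞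

/-- `T̂(A) = ∫ dP(ω) Tr(χ₁ A_{ω,s})`, computed at the boundary parameter `s`. -/
def tHat {Ω : Type*} [MeasurableSpace Ω] (P : Measure Ω) (χ : ℝ → ℝ)
    (A : Hull Ω → L2Plane →L[ℂ] L2Plane) (s : ℝ) : ℂ :=
  ∫ ω, opTrace (cutoffOp χ * A (ω, (s : WithTop ℝ))) ∂P

/-- The compression `Π₁ T Π₁` as an operator on `L²(ℝ₊ × ℝ)`: extend by zero (the adjoint of the
restriction), apply `T`, restrict to the half-plane. -/
def halfCompression (T : L2Plane →L[ℂ] L2Plane) : L2Half →L[ℂ] L2Half :=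
  (LpToLpRestrictCLM Plane ℂ ℂ volume 2 halfPlane) ∘L T ∘L
    ContinuousLinearMap.adjoint (LpToLpRestrictCLM Plane ℂ ℂ volume 2 halfPlane)

/-- The index `dim ker T - dim coker T` of a Fredholm operator `T`. -/
def fredholmIndex {H : Type*} [NormedAddCommGroup H] [NormedSpace ℂ H] (T : H →L[ℂ] H) : ℤ :=
  (Module.finrank ℂ T.ker : ℤ) - (Module.finrank ℂ (H ⧸ T.range) : ℤ)

end

/-!
With `T = Π₁ U Π₁` and `V = U - 1`, the operators `1 - T* T` and `1 - T T*` are `X* X` and `Y Y*`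
for the parts `X = (1 - Π₁) V Π₁` and `Y = Π₁ V (1 - Π₁)` of `V` that lead out of the half-plane and
into it. So `T` is Fredholm if `X` and `Y` are compact, and Fedosov's formula
(`fredholmIndex_eq_hsSq_sub`, from the polar decomposition of `T`) says that its index is
`‖X‖² - ‖Y‖²`, in Hilbert–Schmidt norms, if these are finite.

*Compactness.* By covariance the trace class assumption bounds the Hilbert–Schmidt norms of the
products of `V` with translates of the cutoff, hence with the indicator of any strip `|x₁| ≤ R`
(`IsLocalKernel.hsSq_strip_lt_top`; when only almost all translates are available, this uses the
uniform integrability argument of `measure_Icc_lt_top_of_translates`). What is left of `X` and `Y`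
connects half-planes at distance `2 R`. Since `|∇₁| U` is bounded, its norm is at most a constant
times `1 / R`, by the Laplace transform `1 / (a + b) = ∫ exp (-t a) exp (-t b) dt`
(`norm_offDiagonal_le`).

*The index formula.* The operator `(|∇₁| U ∓ i ∇₁ U) / 2` has the kernel `(x₁ - y₁)_± k(x, y)`,
where `k` is the kernel of `V`. The trace of its product with `χ V*` is the integral of
`χ(y₁) (x₁ - y₁)_± |k(x, y)|²`, a convergent integral of a nonnegative function
(`opTrace_mulOp_star_mul`, `flowDensity_le`). Therefore `i Tr (χ V* ∇₁ U)` is the difference of the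
flow densities to the left and to the right. On the other hand, averaging `‖X‖²` and `‖Y‖²` over the
invariant measure `P` gives the averages of the same two densities (`lintegral_hsSq_halfOp`): the
pairs of points at horizontal displacement `t` that are separated by the boundary have measure
`|t|` per unit length.

*Constancy.* On an orbit of Fredholm operators the index is constant by norm continuity
(`fredholmIndex_eq_of_continuous`), and magnetic translations along the boundary, which preserve
the half-plane, turn a change of the boundary parameter `s` into a move along the orbit. The index
at `s = 0` is thus an invariant function of `ω`, measurable because it is a difference of
Hilbert–Schmidt norms, and constant almost everywhere by ergodicity.
-/

noncomputable section

/-! ### Hilbert–Schmidt operators -/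

section HilbertSchmidt

variable {H K L : Type*} [NormedAddCommGroup H] [InnerProductSpace ℂ H] [CompleteSpace H]
  [NormedAddCommGroup K] [InnerProductSpace ℂ K] [CompleteSpace K]
  [NormedAddCommGroup L] [InnerProductSpace ℂ L] [CompleteSpace L]

/-- The square `∑ᵢ ‖T eᵢ‖²` of the Hilbert–Schmidt norm, as an extended nonnegative number; `T` is
a Hilbert–Schmidt operator if it is finite. -/
def hsSq (T : H →L[ℂ] K) : ℝ≥0∞ := ∑' i, ‖T (someBasis H i)‖ₑ ^ 2

omit [CompleteSpace H] in
lemma HilbertBasis.tsum_enorm_inner_sq {ι : Type*} (b : HilbertBasis ι ℂ H) (x : H) :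
    ∑' i, ‖⟪b i, x⟫_ℂ‖ₑ ^ 2 = ‖x‖ₑ ^ 2 := by
  have h := b.hasSum_inner_mul_inner x x
  have h2 : HasSum (fun i => ‖⟪b i, x⟫_ℂ‖ ^ 2) (‖x‖ ^ 2) := by
    have h3 := Complex.hasSum_re h
    convert h3 using 1
    · ext i
      rw [← inner_conj_symm x (b i), ← Complex.normSq_eq_conj_mul_self, Complex.ofReal_re,
        Complex.normSq_eq_norm_sq]
    · rw [inner_self_eq_norm_sq_to_K]
      norm_cast
  have h4 : ∀ r : ℝ, 0 ≤ r → ENNReal.ofReal (r ^ 2) = ENNReal.ofReal r ^ 2 :=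
    fun r hr => ENNReal.ofReal_pow hr 2
  rw [← ofReal_norm, ← h4 _ (norm_nonneg _), ← h2.tsum_eq,
    ENNReal.ofReal_tsum_of_nonneg (fun _ => by positivity) h2.summable]
  simp_rw [h4 _ (norm_nonneg _), ofReal_norm]

lemma HilbertBasis.tsum_enorm_sq_adjoint {ι κ : Type*} (b : HilbertBasis ι ℂ H)
    (c : HilbertBasis κ ℂ K) (T : H →L[ℂ] K) :
    ∑' i, ‖T (b i)‖ₑ ^ 2 = ∑' j, ‖T.adjoint (c j)‖ₑ ^ 2 := by
  simp_rw [← c.tsum_enorm_inner_sq (T _), ← b.tsum_enorm_inner_sq (T.adjoint _)]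
  rw [ENNReal.tsum_comm]
  refine tsum_congr fun j => tsum_congr fun i => ?_
  rw [ContinuousLinearMap.adjoint_inner_right, ← inner_conj_symm, ← ofReal_norm,
    ← ofReal_norm, RCLike.norm_conj]

lemma hsSq_adjoint (T : H →L[ℂ] K) : hsSq T.adjoint = hsSq T :=
  ((someBasis H).tsum_enorm_sq_adjoint (someBasis K) T).symm

lemma hsSq_star (T : H →L[ℂ] H) : hsSq (star T) = hsSq T := hsSq_adjoint T

/-- The Hilbert–Schmidt norm may be computed in any orthonormal basis. -/
lemma hsSq_eq_tsum {ι : Type*} (b : HilbertBasis ι ℂ H) (T : H →L[ℂ] K) :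
    hsSq T = ∑' i, ‖T (b i)‖ₑ ^ 2 := by
  rw [b.tsum_enorm_sq_adjoint (someBasis K), ← hsSq_adjoint]; rfl

omit [CompleteSpace K] [CompleteSpace L] in
lemma hsSq_le_of_enorm_le {T : H →L[ℂ] K} {S : H →L[ℂ] L} {c : ℝ≥0∞}
    (h : ∀ x, ‖T x‖ₑ ≤ c * ‖S x‖ₑ) : hsSq T ≤ c ^ 2 * hsSq S := by
  rw [hsSq, hsSq, ← ENNReal.tsum_mul_left]
  refine ENNReal.tsum_le_tsum fun i => ?_
  rw [← mul_pow]
  exact pow_le_pow_left' (h _) 2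

omit [CompleteSpace K] [CompleteSpace L] in
lemma hsSq_congr_norm {T : H →L[ℂ] K} {S : H →L[ℂ] L} (h : ∀ x, ‖T x‖ = ‖S x‖) :
    hsSq T = hsSq S := by
  refine tsum_congr fun i => ?_
  rw [← ofReal_norm, h, ofReal_norm]

omit [CompleteSpace K] [CompleteSpace L] in
lemma hsSq_comp_le_left (A : K →L[ℂ] L) (T : H →L[ℂ] K) :
    hsSq (A ∘L T) ≤ ‖A‖ₑ ^ 2 * hsSq T :=
  hsSq_le_of_enorm_le fun x => A.le_opENorm (T x)

lemma hsSq_comp_le_right (T : K →L[ℂ] L) (A : H →L[ℂ] K) :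
    hsSq (T ∘L A) ≤ ‖A‖ₑ ^ 2 * hsSq T := by
  rw [← hsSq_adjoint, ContinuousLinearMap.adjoint_comp]
  refine (hsSq_comp_le_left _ _).trans_eq ?_
  rw [hsSq_adjoint, ← ofReal_norm, LinearIsometryEquiv.norm_map, ofReal_norm]

omit [InnerProductSpace ℂ H] [CompleteSpace H] in
lemma enorm_add_sq_le (x y : H) :
    ‖x + y‖ₑ ^ 2 ≤ 2 * (‖x‖ₑ ^ 2 + ‖y‖ₑ ^ 2) := by
  refine (pow_le_pow_left' (enorm_add_le x y) 2).trans ?_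
  have h := add_sq_le (a := ‖x‖₊) (b := ‖y‖₊)
  simp only [enorm_eq_nnnorm]
  exact_mod_cast h

omit [CompleteSpace K] in
lemma hsSq_add_le (T S : H →L[ℂ] K) : hsSq (T + S) ≤ 2 * (hsSq T + hsSq S) := by
  rw [hsSq, hsSq, hsSq, ← ENNReal.tsum_add, ← ENNReal.tsum_mul_left]
  exact ENNReal.tsum_le_tsum fun i => enorm_add_sq_le _ _

omit [CompleteSpace K] in
lemma hsSq_smul (c : ℂ) (T : H →L[ℂ] K) : hsSq (c • T) = ‖c‖ₑ ^ 2 * hsSq T := by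
  rw [hsSq, hsSq, ← ENNReal.tsum_mul_left]
  refine tsum_congr fun i => ?_
  rw [smul_apply, enorm_smul, mul_pow]

/-- The Hilbert–Schmidt norm dominates the operator norm. -/
lemma enorm_apply_sq_le (T : H →L[ℂ] K) (x : H) : ‖T x‖ₑ ^ 2 ≤ hsSq T * ‖x‖ₑ ^ 2 := by
  rw [← (someBasis K).tsum_enorm_inner_sq (T x), ← hsSq_adjoint, hsSq, ← ENNReal.tsum_mul_right]
  refine ENNReal.tsum_le_tsum fun j => ?_
  rw [← ContinuousLinearMap.adjoint_inner_left, ← mul_pow]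
  refine pow_le_pow_left' ?_ 2
  rw [← ofReal_norm, ← ofReal_norm, ← ofReal_norm,
    ← ENNReal.ofReal_mul (norm_nonneg _)]
  exact ENNReal.ofReal_le_ofReal (norm_inner_le_norm _ _)

/-- A Hilbert–Schmidt operator is compact, being the norm limit of its restrictions to the spans
of finitely many basis vectors. -/
lemma isCompactOperator_of_hsSq_lt_top {T : H →L[ℂ] K} (hT : hsSq T < ∞) :
    IsCompactOperator T := by
  classical
  set b := someBasis H
  let F (s : Finset (someBasisIndex H)) : H →L[ℂ] K :=
    T ∘L ∑ i ∈ s, (innerSL ℂ (b i)).smulRight (b i)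
  have hF (s) : IsCompactOperator (F s) := by
    refine IsCompactOperator.clm_comp ?_ T
    refine Finset.sum_induction _ (fun A : H →L[ℂ] H => IsCompactOperator A)
      (fun A B hA hB => hA.add hB) isCompactOperator_zero fun i _ => ?_
    have : (⇑((innerSL ℂ (b i)).smulRight (b i)) : H → H) =
        (ContinuousLinearMap.toSpanSingleton ℂ (b i)) ∘ (innerSL ℂ (b i)) := by
      ext x; simp
    rw [this]
    exact (isCompactOperator_of_locallyCompactSpace_rng
      (ContinuousLinearMap.toSpanSingleton ℂ (b i))).comp_clm _
  have hval (s : Finset (someBasisIndex H)) (j) :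
      (T - F s) (b j) = if j ∈ s then 0 else T (b j) := by
    have hs : (∑ i ∈ s, (innerSL ℂ (b i)).smulRight (b i) : H →L[ℂ] H) (b j) =
        if j ∈ s then b j else 0 := by
      simp [orthonormal_iff_ite.mp b.orthonormal, ite_smul]
    by_cases h : j ∈ s <;> simp [F, hs, h]
  have hlim : Tendsto (fun s => hsSq (T - F s)) atTop (nhds 0) := by
    have := ENNReal.tendsto_tsum_compl_atTop_zero (f := fun i => ‖T (b i)‖ₑ ^ 2) hT.ne
    refine this.congr fun s => ?_
    refine (tsum_subtype {x | x ∉ s} (fun i => ‖T (b i)‖ₑ ^ 2)).trans ?_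
    refine tsum_congr fun j => ?_
    change _ = ‖(T - F s) (b j)‖ₑ ^ 2
    rw [hval]
    by_cases h : j ∈ s <;> simp [h]
  have hlim' : Tendsto F atTop (nhds T) := by
    rw [tendsto_iff_norm_sub_tendsto_zero]
    have h2 : Tendsto (fun s => √(hsSq (T - F s)).toReal) atTop (nhds 0) := by
      simpa using ((ENNReal.tendsto_toReal (by simp)).comp hlim).sqrt
    have hfin : ∀ᶠ s in atTop, hsSq (T - F s) < ∞ := hlim.eventually (gt_mem_nhds (by simp))
    refine squeeze_zero' (Eventually.of_forall fun s => norm_nonneg _) (hfin.mono fun s hs => ?_) h2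
    rw [norm_sub_rev]
    refine ContinuousLinearMap.opNorm_le_bound _ (by positivity) fun x => ?_
    have h3 := ENNReal.toReal_mono (ENNReal.mul_lt_top hs (by simp)).ne
      (enorm_apply_sq_le (T - F s) x)
    rw [ENNReal.toReal_mul, ENNReal.toReal_pow, ENNReal.toReal_pow, toReal_enorm,
      toReal_enorm] at h3
    refine le_of_sq_le_sq ?_ (by positivity)
    rwa [mul_pow, Real.sq_sqrt (by positivity)]
  exact isClosed_setOfPred_isCompactOperator.mem_of_tendsto hlim' (Eventually.of_forall hF)

end HilbertSchmidt

/-! ### Polar decomposition -/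

section Polar

variable {H K L : Type*} [NormedAddCommGroup H] [InnerProductSpace ℂ H] [CompleteSpace H]
  [NormedAddCommGroup K] [InnerProductSpace ℂ K] [CompleteSpace K]
  [NormedAddCommGroup L] [InnerProductSpace ℂ L] [CompleteSpace L]

open ContinuousLinearMap

omit [CompleteSpace H] in
lemma ContinuousLinearMap.ext_inner_self {S T : H →L[ℂ] H}
    (h : ∀ x, ⟪S x, x⟫_ℂ = ⟪T x, x⟫_ℂ) : S = T := by
  have := (ext_inner_map S.toLinearMap T.toLinearMap).mp h
  ext x
  exact congrArg (fun A : H →ₗ[ℂ] H => A x) this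

lemma norm_sq_eq_re_inner (A : H →L[ℂ] K) (x : H) :
    ‖A x‖ ^ 2 = (⟪x, (A.adjoint ∘L A) x⟫_ℂ).re := by
  rw [comp_apply, adjoint_inner_right, inner_self_eq_norm_sq_to_K]
  norm_cast

lemma norm_sq_add_norm_sq {A : H →L[ℂ] K} {B : H →L[ℂ] L}
    (h : A.adjoint ∘L A = 1 - B.adjoint ∘L B) (x : H) : ‖A x‖ ^ 2 + ‖B x‖ ^ 2 = ‖x‖ ^ 2 := by
  rw [norm_sq_eq_re_inner A, norm_sq_eq_re_inner B, h]
  change (⟪x, x - (B.adjoint ∘L B) x⟫_ℂ).re + _ = _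
  rw [inner_sub_right, Complex.sub_re, sub_add_cancel, inner_self_eq_norm_sq_to_K]
  norm_cast

lemma adjoint_comp_self_starProjection (N : Submodule ℂ H) [N.HasOrthogonalProjection] :
    N.starProjection.adjoint ∘L N.starProjection = N.starProjection := by
  rw [(isSelfAdjoint_starProjection N).adjoint_eq]
  ext x
  exact Submodule.starProjection_eq_self_iff.mpr (Submodule.starProjection_apply_mem N x)

/-- Polar decomposition: if `‖T x‖ = ‖S x‖` for all `x`, then `T = W S` for a partial isometry `W`
with initial space `closure (range S)` and final space `closure (range T)`; these spaces are the
orthogonal complements of the kernels of `S*` and `T*`. -/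
lemma exists_partialIsometry (T : H →L[ℂ] K) (S : H →L[ℂ] L) (h : ∀ x, ‖T x‖ = ‖S x‖) :
    ∃ W : L →L[ℂ] K, W ∘L S = T ∧ W.adjoint ∘L T = S ∧
      (∀ x, ‖W x‖ ^ 2 + ‖S.adjoint.ker.starProjection x‖ ^ 2 = ‖x‖ ^ 2) ∧
      (∀ y, ‖W.adjoint y‖ ^ 2 + ‖T.adjoint.ker.starProjection y‖ ^ 2 = ‖y‖ ^ 2) := by
  set M : Submodule ℂ L := S.range.topologicalClosure with hM
  have hmem (x) : S x ∈ M := S.range.le_topologicalClosure ⟨x, rfl⟩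
  have : CompleteSpace M := S.range.isClosed_topologicalClosure.completeSpace_coe
  set e : H →ₗ[ℂ] M := S.toLinearMap.codRestrict M hmem with he
  have hdense : DenseRange e := by
    rw [DenseRange, dense_iff_closure_eq, Set.eq_univ_iff_forall]
    rintro ⟨y, hy⟩
    rw [closure_subtype]
    have : (Subtype.val '' Set.range e : Set L) = (S.range : Set L) := by
      rw [← Set.range_comp]; rfl
    rw [this]
    exact hy
  have hnorm (x) : ‖T.toLinearMap x‖ ≤ 1 * ‖e x‖ := by
    rw [one_mul]; exact (h x).le
  set E : M →L[ℂ] K := T.toLinearMap.extendOfNorm e with hE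
  have hEe (x) : E (e x) = T x := LinearMap.extendOfNorm_eq hdense ⟨1, hnorm⟩ x
  have hEnorm (m) : ‖E m‖ = ‖m‖ := by
    refine hdense.induction_on (p := fun m => ‖E m‖ = ‖m‖) m
      (isClosed_eq (by fun_prop) (by fun_prop)) fun x => ?_
    rw [hEe]; exact h x
  set W : L →L[ℂ] K := E ∘L M.orthogonalProjectionOnto with hW
  have hker : S.adjoint.ker = Mᗮ := by
    rw [hM, Submodule.orthogonal_closure, ContinuousLinearMap.orthogonal_range]
  have hP : 1 - S.adjoint.ker.starProjection = M.starProjection := by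
    ext x
    simp_rw [hker]
    rw [Submodule.starProjection_orthogonal']
    simp
  have hWS : W ∘L S = T := by
    ext x
    have : M.orthogonalProjectionOnto (S x) = e x :=
      Submodule.orthogonalProjectionOnto_mem_subspace_eq_self (⟨S x, hmem x⟩ : M)
    simp [hW, this, hEe]
  have hWW : W.adjoint ∘L W = M.starProjection := by
    refine ext_inner_self fun x => ?_
    rw [comp_apply, adjoint_inner_left, inner_self_eq_norm_sq_to_K, hW, comp_apply, hEnorm]
    have h1 : M.starProjection x = M.starProjection (M.starProjection x) :=
      (Submodule.starProjection_eq_self_iff.mpr (Submodule.starProjection_apply_mem M x)).symm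
    rw [h1, Submodule.inner_starProjection_left_eq_right, inner_self_eq_norm_sq_to_K,
      Submodule.starProjection_apply, Submodule.coe_norm]
  have hPS : M.starProjection ∘L S = S := by
    ext x
    exact Submodule.starProjection_eq_self_iff.mpr (hmem x)
  have hWT : W.adjoint ∘L T = S := by
    rw [← hWS, ← comp_assoc, hWW, hPS]
  refine ⟨W, hWS, hWT, norm_sq_add_norm_sq (by rw [hWW, ← hP, adjoint_comp_self_starProjection]),
    norm_sq_add_norm_sq ?_⟩
  have hN (y) (hy : y ∈ T.adjoint.ker) : W.adjoint y = 0 := by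
    refine ext_inner_right ℂ fun x => ?_
    rw [adjoint_inner_left, inner_zero_left, hW, comp_apply]
    refine hdense.induction_on (p := fun m => ⟪y, E m⟫_ℂ = 0) _
      (isClosed_eq (by fun_prop) (by fun_prop)) fun z => ?_
    rw [hEe, ← adjoint_inner_left, show T.adjoint y = 0 from hy, inner_zero_left]
  have hT : T.adjoint = S.adjoint ∘L W.adjoint := by rw [← adjoint_comp, hWS]
  have hSP : S.adjoint ∘L M.starProjection = S.adjoint := by
    have := congrArg adjoint hPS
    rwa [adjoint_comp, (isSelfAdjoint_starProjection M).adjoint_eq] at this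
  have hTW : T.adjoint ∘L W ∘L W.adjoint = T.adjoint := by
    rw [hT, comp_assoc, ← comp_assoc W.adjoint, hWW, ← comp_assoc, hSP]
  have hfin (y) : T.adjoint.ker.starProjection y = y - W (W.adjoint y) := by
    refine Submodule.eq_starProjection_of_mem_orthogonal ?_ ?_
    · change T.adjoint (y - W (W.adjoint y)) = 0
      rw [map_sub, sub_eq_zero]
      exact (congrArg (fun A : K →L[ℂ] H => A y) hTW).symm
    · rw [Submodule.mem_orthogonal]
      intro n hn
      rw [sub_sub_cancel, ← adjoint_inner_left, hN n hn, inner_zero_left]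
  ext y
  rw [adjoint_comp_self_starProjection, adjoint_adjoint]
  change W (W.adjoint y) = y - T.adjoint.ker.starProjection y
  rw [hfin, sub_sub_cancel]

end Polar

/-! ### Trace class operators -/

section TraceClass

lemma mul_le_sq_add_sq (a b : ℝ) : a * b ≤ a ^ 2 + b ^ 2 := by
  nlinarith [sq_nonneg (a - b), sq_nonneg a, sq_nonneg b]

variable {H : Type*} [NormedAddCommGroup H] [InnerProductSpace ℂ H] [CompleteSpace H]

open ContinuousLinearMap

lemma norm_cfcAbs_apply (T : H →L[ℂ] H) (x : H) : ‖T x‖ = ‖CFC.abs T x‖ := by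
  have h1 : star (CFC.abs T) = CFC.abs T := (IsSelfAdjoint.of_nonneg (CFC.abs_nonneg T)).star_eq
  have h2 : star (CFC.abs T) * CFC.abs T = star T * T := by rw [h1, CFC.abs_mul_abs]
  have h3 (A : H →L[ℂ] H) : ‖A x‖ ^ 2 = (⟪x, (star A * A) x⟫_ℂ).re := by
    change _ = (⟪x, A.adjoint (A x)⟫_ℂ).re
    rw [adjoint_inner_right, inner_self_eq_norm_sq_to_K]
    norm_cast
  rw [← sq_eq_sq₀ (norm_nonneg _) (norm_nonneg _), h3, h3, h2]

lemma traceNorm_eq_hsSq_sqrt (T : H →L[ℂ] H) :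
    traceNorm T = hsSq (CFC.sqrt (CFC.abs T)) := by
  set S := CFC.sqrt (CFC.abs T) with hS
  have h1 : star S = S := (IsSelfAdjoint.of_nonneg (CFC.sqrt_nonneg _)).star_eq
  have h2 : CFC.abs T = star S * S := by
    rw [h1, CFC.sqrt_mul_sqrt_self _ (CFC.abs_nonneg T)]
  refine tsum_congr fun i => ?_
  set e := someBasis H i
  rw [h2]
  change ENNReal.ofReal (⟪e, S.adjoint (S e)⟫_ℂ).re = _
  rw [adjoint_inner_right, inner_self_eq_norm_sq_to_K,
    ← ofReal_norm, ← ENNReal.ofReal_pow (norm_nonneg _)]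
  norm_cast

/-- An operator `T = W |T|` is the product of the operators `W |T|^(1/2)` and `|T|^(1/2)`, the
squares of whose Hilbert–Schmidt norms are at most the trace norm of `T`. -/
lemma exists_hsSq_factorization (T : H →L[ℂ] H) :
    ∃ Q R : H →L[ℂ] H, T = Q * R ∧ hsSq Q ≤ traceNorm T ∧ hsSq R ≤ traceNorm T := by
  obtain ⟨W, hW, -, hWW, -⟩ := exists_partialIsometry T (CFC.abs T) (norm_cfcAbs_apply T)
  refine ⟨W * CFC.sqrt (CFC.abs T), CFC.sqrt (CFC.abs T), ?_, ?_,
    (traceNorm_eq_hsSq_sqrt T).ge⟩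
  · rw [mul_assoc, CFC.sqrt_mul_sqrt_self _ (CFC.abs_nonneg T)]; exact hW.symm
  · rw [traceNorm_eq_hsSq_sqrt]
    refine (hsSq_le_of_enorm_le (c := 1) (S := CFC.sqrt (CFC.abs T)) fun x => ?_).trans_eq
      (by simp)
    rw [one_mul, ← ofReal_norm, ← ofReal_norm]
    refine ENNReal.ofReal_le_ofReal (le_of_sq_le_sq ?_ (norm_nonneg _))
    exact le_of_add_le_of_nonneg_left (hWW _).le (sq_nonneg _)

lemma tsum_enorm_inner_mul_le (A Q R C : H →L[ℂ] H) :
    ∑' i, ‖⟪A (someBasis H i), Q (R (C (someBasis H i)))⟫_ℂ‖ₑ ≤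
      ‖A‖ₑ ^ 2 * hsSq Q + ‖C‖ₑ ^ 2 * hsSq R := by
  have h1 : hsSq (Q.adjoint ∘L A) ≤ ‖A‖ₑ ^ 2 * hsSq Q :=
    (hsSq_comp_le_right _ _).trans_eq (by rw [hsSq_adjoint])
  refine le_trans ?_ (add_le_add h1 (hsSq_comp_le_right R C))
  rw [hsSq, hsSq, ← ENNReal.tsum_add]
  refine ENNReal.tsum_le_tsum fun i => ?_
  rw [← adjoint_inner_left, ← ofReal_norm, ← ofReal_norm, ← ofReal_norm, comp_apply, comp_apply,
    ← ENNReal.ofReal_pow (norm_nonneg _), ← ENNReal.ofReal_pow (norm_nonneg _),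
    ← ENNReal.ofReal_add (by positivity) (by positivity)]
  refine ENNReal.ofReal_le_ofReal ((norm_inner_le_norm _ _).trans ?_)
  exact mul_le_sq_add_sq _ _

/-- The trace pairing is bounded by the trace norm; the constant is not the optimal one. -/
lemma tsum_enorm_inner_le (A T C : H →L[ℂ] H) :
    ∑' i, ‖⟪A (someBasis H i), T (C (someBasis H i))⟫_ℂ‖ₑ ≤
      (‖A‖ₑ ^ 2 + ‖C‖ₑ ^ 2) * traceNorm T := by
  obtain ⟨Q, R, rfl, hQ, hR⟩ := exists_hsSq_factorization T
  refine (tsum_enorm_inner_mul_le A Q R C).trans ?_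
  rw [add_mul]
  gcongr

/-- The trace class is a right ideal; the constant is not the optimal one. -/
lemma traceNorm_mul_le (T A : H →L[ℂ] H) :
    traceNorm (T * A) ≤ (1 + ‖A‖ₑ ^ 2) * traceNorm T := by
  obtain ⟨W, -, hW, hWW, -⟩ :=
    exists_partialIsometry (T * A) (CFC.abs (T * A)) (norm_cfcAbs_apply _)
  have hW1 : ‖W‖ₑ ≤ 1 := by
    rw [← ofReal_norm, ENNReal.ofReal_le_one]
    refine W.opNorm_le_bound zero_le_one fun x => ?_
    rw [one_mul]
    refine le_of_sq_le_sq ?_ (norm_nonneg _)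
    exact le_of_add_le_of_nonneg_left (hWW _).le (sq_nonneg _)
  calc traceNorm (T * A)
      ≤ ∑' i, ‖⟪W (someBasis H i), T (A (someBasis H i))⟫_ℂ‖ₑ := by
        refine ENNReal.tsum_le_tsum fun i => ?_
        rw [← hW, comp_apply, adjoint_inner_right, ← ofReal_norm]
        exact ENNReal.ofReal_le_ofReal (Complex.re_le_norm _)
    _ ≤ _ := tsum_enorm_inner_le W T A
    _ ≤ _ := by gcongr; exact pow_le_one' hW1 2

lemma hsSq_lt_top_of_traceNorm_lt_top {T : H →L[ℂ] H} (hT : traceNorm T < ∞) : hsSq T < ∞ := by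
  obtain ⟨Q, R, rfl, hQ, hR⟩ := exists_hsSq_factorization T
  exact (hsSq_comp_le_left Q R).trans_lt
    (ENNReal.mul_lt_top (by simp) (hR.trans_lt hT))

lemma HilbertBasis.tsum_inner_mul_comm {ι : Type*} (b : HilbertBasis ι ℂ H) {X Y : H →L[ℂ] H}
    (hX : hsSq X < ∞) (hY : hsSq Y < ∞) :
    ∑' i, ⟪b i, X (Y (b i))⟫_ℂ = ∑' i, ⟪b i, Y (X (b i))⟫_ℂ := by
  have h1 (X Y : H →L[ℂ] H) (i) : HasSum (fun j => ⟪b i, X (b j)⟫_ℂ * ⟪b j, Y (b i)⟫_ℂ)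
      ⟪b i, X (Y (b i))⟫_ℂ := by
    have := b.hasSum_inner_mul_inner (X.adjoint (b i)) (Y (b i))
    simpa only [adjoint_inner_left] using this
  have hs (Z : H →L[ℂ] H) (hZ : hsSq Z < ∞) :
      Summable fun p : ι × ι => ‖⟪b p.1, Z (b p.2)⟫_ℂ‖ ^ 2 := by
    have : ∑' p : ι × ι, ‖⟪b p.1, Z (b p.2)⟫_ℂ‖ₑ ^ 2 = hsSq Z := by
      rw [hsSq_eq_tsum b, ENNReal.tsum_prod (f := fun i j => ‖⟪b i, Z (b j)⟫_ℂ‖ₑ ^ 2),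
        ENNReal.tsum_comm]
      exact tsum_congr fun j => b.tsum_enorm_inner_sq (Z (b j))
    simpa using ENNReal.summable_toReal (this.trans_ne hZ.ne)
  have hsum : Summable (Function.uncurry fun i j => ⟪b i, X (b j)⟫_ℂ * ⟪b j, Y (b i)⟫_ℂ) := by
    have h3 : Summable fun p : ι × ι => ‖⟪b p.1, X (b p.2)⟫_ℂ‖ ^ 2 + ‖⟪b p.2, Y (b p.1)⟫_ℂ‖ ^ 2 :=
      (hs X hX).add (hs Y hY).prod_symm
    refine Summable.of_norm_bounded h3 ?_
    rintro ⟨i, j⟩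
    simp only [Function.uncurry_apply_pair, norm_mul]
    exact mul_le_sq_add_sq _ _
  calc ∑' i, ⟪b i, X (Y (b i))⟫_ℂ = ∑' i, ∑' j, ⟪b i, X (b j)⟫_ℂ * ⟪b j, Y (b i)⟫_ℂ :=
        tsum_congr fun i => (h1 X Y i).tsum_eq.symm
    _ = ∑' j, ∑' i, ⟪b i, X (b j)⟫_ℂ * ⟪b j, Y (b i)⟫_ℂ := hsum.tsum_comm.symm
    _ = ∑' j, ⟪b j, Y (X (b j))⟫_ℂ := by
        refine tsum_congr fun j => ?_
        rw [← (h1 Y X j).tsum_eq]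
        exact tsum_congr fun i => mul_comm _ _

/-- `Tr (X Y) = Tr (Y X)` for Hilbert–Schmidt operators. -/
lemma opTrace_mul_comm {X Y : H →L[ℂ] H} (hX : hsSq X < ∞) (hY : hsSq Y < ∞) :
    opTrace (X * Y) = opTrace (Y * X) :=
  (someBasis H).tsum_inner_mul_comm hX hY

/-- For a traceclass operator `T`, the trace of `P T P Z P` converges to that of `T Z` when the
contractions `P` converge strongly to the identity. -/
lemma tendsto_opTrace_compress {T Z : H →L[ℂ] H} (hT : traceNorm T < ∞) {P : ℕ → H →L[ℂ] H}
    (hP : ∀ n, ‖P n‖ ≤ 1) (hlim : ∀ x, Tendsto (fun n => P n x) atTop (nhds x)) :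
    Tendsto (fun n => opTrace (P n * T * P n * Z * P n)) atTop (nhds (opTrace (T * Z))) := by
  obtain ⟨Q, R, rfl, hQ, hR⟩ := exists_hsSq_factorization T
  replace hQ := hQ.trans_lt hT
  replace hR := hR.trans_lt hT
  have hl {A B : H →L[ℂ] H} (hB : hsSq B < ∞) : hsSq (A * B) < ∞ :=
    (hsSq_comp_le_left A B).trans_lt (ENNReal.mul_lt_top (by simp) hB)
  have hr {A B : H →L[ℂ] H} (hB : hsSq B < ∞) : hsSq (B * A) < ∞ :=
    (hsSq_comp_le_right B A).trans_lt (ENNReal.mul_lt_top (by simp) hB)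
  have e1 (n) : opTrace (P n * (Q * R) * P n * Z * P n) =
      opTrace (R * (P n * Z * P n * P n * Q)) := by
    have : P n * (Q * R) * P n * Z * P n = (P n * Q) * (R * (P n * Z * P n)) := by
      simp only [mul_assoc]
    rw [this, opTrace_mul_comm (hl hQ) (hr hR)]
    simp only [mul_assoc]
  have e2 : opTrace (Q * R * Z) = opTrace (R * (Z * Q)) := by
    rw [mul_assoc, opTrace_mul_comm hQ (hr hR), mul_assoc]
  simp_rw [e1, e2]
  set b := someBasis H
  have hconv (x) : Tendsto (fun n => (P n * Z * P n * P n) x) atTop (nhds (Z x)) := by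
    have key (u : ℕ → H) (y) (hu : Tendsto u atTop (nhds y)) :
        Tendsto (fun n => P n (u n)) atTop (nhds y) := by
      have h2 : Tendsto (fun n => P n (u n - y)) atTop (nhds 0) := by
        refine squeeze_zero_norm (fun n => ?_) (tendsto_iff_norm_sub_tendsto_zero.mp hu)
        exact ((P n).le_of_opNorm_le (hP n) _).trans_eq (one_mul _)
      simpa using h2.add (hlim y)
    exact key _ _ ((Z.continuous.tendsto _).comp (key _ _ (hlim x)))
  have hn (n) : ‖P n * Z * P n * P n‖ ≤ ‖Z‖ := by
    have h1 := norm_mul_le (P n * Z * P n) (P n)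
    have h2 := norm_mul_le (P n * Z) (P n)
    have h3 := norm_mul_le (P n) Z
    nlinarith [hP n, norm_nonneg (P n), norm_nonneg Z, norm_nonneg (P n * Z),
      norm_nonneg (P n * Z * P n)]
  refine tendsto_tsum_of_dominated_convergence
    (bound := fun i => ‖Z‖ * (‖R.adjoint (b i)‖ ^ 2 + ‖Q (b i)‖ ^ 2)) ?_ (fun i => ?_)
    (Eventually.of_forall fun n i => ?_)
  · refine Summable.mul_left _ (Summable.add ?_ ?_)
    · simpa using ENNReal.summable_toReal (((hsSq_adjoint R).trans_lt hR).ne)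
    · simpa using ENNReal.summable_toReal hQ.ne
  · change Tendsto (fun n => ⟪b i, R ((P n * Z * P n * P n) (Q (b i)))⟫_ℂ) atTop
      (nhds ⟪b i, R (Z (Q (b i)))⟫_ℂ)
    simp only [← adjoint_inner_left R]
    exact tendsto_const_nhds.inner (hconv (Q (b i)))
  · have : ⟪b i, (R * (P n * Z * P n * P n * Q)) (b i)⟫_ℂ =
        ⟪R.adjoint (b i), (P n * Z * P n * P n) (Q (b i))⟫_ℂ := by
      rw [adjoint_inner_left]; rfl
    rw [this]
    refine (norm_inner_le_norm _ _).trans ?_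
    have h1 := (P n * Z * P n * P n).le_of_opNorm_le (hn n) (Q (b i))
    have h2 : ‖R.adjoint (b i)‖ * ‖Q (b i)‖ ≤ ‖R.adjoint (b i)‖ ^ 2 + ‖Q (b i)‖ ^ 2 :=
      mul_le_sq_add_sq _ _
    nlinarith [norm_nonneg (R.adjoint (b i)), norm_nonneg Z,
      mul_le_mul_of_nonneg_left h1 (norm_nonneg (R.adjoint (b i))),
      mul_le_mul_of_nonneg_left h2 (norm_nonneg Z)]

end TraceClass

/-! ### Fredholm operators -/

section Fredholm

variable {H K L : Type*} [NormedAddCommGroup H] [InnerProductSpace ℂ H] [CompleteSpace H]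
  [NormedAddCommGroup K] [InnerProductSpace ℂ K] [CompleteSpace K]
  [NormedAddCommGroup L] [InnerProductSpace ℂ L] [CompleteSpace L]

open ContinuousLinearMap

omit [CompleteSpace H] [CompleteSpace K] in
/-- A compact operator into a Hilbert space is approximated in norm by operators of finite rank:
project onto the span of a finite net of the image of the unit ball. -/
lemma IsCompactOperator.exists_finiteRange_norm_sub_le {T : H →L[ℂ] K} (hT : IsCompactOperator T)
    {ε : ℝ} (hε : 0 < ε) :
    ∃ F : H →L[ℂ] K, F.toLinearMap.HasFiniteRange ∧ ‖T - F‖ ≤ ε := by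
  obtain ⟨C, hC, hsub⟩ := (isCompactOperator_iff_image_closedBall_subset_compact
    (T : H →ₗ[ℂ] K) one_pos).mp hT
  obtain ⟨t, -, htf, hcov⟩ := hC.finite_cover_balls hε
  set N := Submodule.span ℂ t with hN
  have : FiniteDimensional ℂ N := FiniteDimensional.span_of_finite ℂ htf
  refine ⟨N.starProjection ∘L T, ?_, ?_⟩
  · rw [LinearMap.hasFiniteRange_iff_range]
    refine (Submodule.fg_iff_finiteDimensional _).mpr
      (Submodule.finiteDimensional_of_le (S₂ := N) ?_)
    rintro _ ⟨x, rfl⟩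
    exact Submodule.starProjection_apply_mem N _
  · refine ContinuousLinearMap.opNorm_le_of_unit_norm hε.le fun x hx => ?_
    have hmem : T x ∈ C := hsub ⟨x, by simp [hx], rfl⟩
    obtain ⟨y, hy, hxy⟩ := Set.mem_iUnion₂.mp (hcov hmem)
    change ‖T x - N.starProjection (T x)‖ ≤ ε
    rw [Submodule.starProjection_minimal]
    refine (ciInf_le ⟨0, ?_⟩ (⟨y, Submodule.subset_span hy⟩ : N)).trans ?_
    · rintro _ ⟨z, rfl⟩
      exact norm_nonneg _
    · rw [← dist_eq_norm]
      exact (Metric.mem_ball.mp hxy).le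

open LinearMap.FiniteRangeSetoid in
/-- Atkinson's criterion in the form needed here: `T` is Fredholm if `1 - T* T` and `1 - T T*` are
compact. -/
lemma isFredholm_of_isCompactOperator {T : H →L[ℂ] K}
    (h1 : IsCompactOperator (1 - T.adjoint ∘L T : H →L[ℂ] H))
    (h2 : IsCompactOperator (1 - T ∘L T.adjoint : K →L[ℂ] K)) : T.IsFredholm := by
  obtain ⟨F, hF, hFn⟩ := h1.exists_finiteRange_norm_sub_le (ε := 1 / 2) (by norm_num)
  obtain ⟨G, hG, hGn⟩ := h2.exists_finiteRange_norm_sub_le (ε := 1 / 2) (by norm_num)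
  set a := Units.oneSub ((1 - T.adjoint ∘L T : H →L[ℂ] H) - F)
    (hFn.trans_lt (by norm_num)) with ha
  set b := Units.oneSub ((1 - T ∘L T.adjoint : K →L[ℂ] K) - G)
    (hGn.trans_lt (by norm_num)) with hb
  have ha' : T.adjoint ∘L T = (a : H →L[ℂ] H) - F := by
    rw [ha, Units.val_oneSub]; abel
  have hb' : T ∘L T.adjoint = (b : K →L[ℂ] K) - G := by
    rw [hb, Units.val_oneSub]; abel
  set A : H →L[ℂ] H := ↑a⁻¹
  set B : K →L[ℂ] K := ↑b⁻¹
  set l : K →L[ℂ] H := A ∘L T.adjoint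
  set r : K →L[ℂ] H := T.adjoint ∘L B
  have hl : l.toLinearMap ∘ₗ T.toLinearMap ≈ .id := by
    rw [LinearMap.FiniteRangeSetoid.equiv_iff_hasFiniteRange]
    have : l.toLinearMap ∘ₗ T.toLinearMap - LinearMap.id = -(A.toLinearMap ∘ₗ F.toLinearMap) := by
      have h3 : A ∘L (T.adjoint ∘L T) = 1 - A ∘L F := by
        rw [ha']; change A * (a - F) = 1 - A * F
        rw [mul_sub, Units.inv_mul]
      ext x
      have := congrArg (fun Z : H →L[ℂ] H => Z x) h3
      change A (T.adjoint (T x)) - x = -(A (F x))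
      change A (T.adjoint (T x)) = x - A (F x) at this
      rw [this]; abel
    rw [this]
    exact (hF.comp_left A.toLinearMap).neg
  have hr : T.toLinearMap ∘ₗ r.toLinearMap ≈ .id := by
    rw [LinearMap.FiniteRangeSetoid.equiv_iff_hasFiniteRange]
    have : T.toLinearMap ∘ₗ r.toLinearMap - LinearMap.id = -(G.toLinearMap ∘ₗ B.toLinearMap) := by
      have h3 : (T ∘L T.adjoint) ∘L B = 1 - G ∘L B := by
        rw [hb']; change (b - G) * B = 1 - G * B
        rw [sub_mul, Units.mul_inv]
      ext x
      have := congrArg (fun Z : K →L[ℂ] K => Z x) h3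
      change T (T.adjoint (B x)) - x = -(G (B x))
      change T (T.adjoint (B x)) = x - G (B x) at this
      rw [this]; abel
    rw [this]
    exact (hG.comp_right B.toLinearMap).neg
  have hlr : l.toLinearMap ≈ r.toLinearMap := by
    have e1 := LinearMap.FiniteRangeSetoid.equiv_comp_left (u' := l.toLinearMap) hr
    have e2 := LinearMap.FiniteRangeSetoid.equiv_comp_right (u := r.toLinearMap) hl
    rw [LinearMap.comp_id] at e1
    rw [LinearMap.id_comp, LinearMap.comp_assoc] at e2
    exact Setoid.trans (Setoid.symm e1) e2
  exact IsFredholm.of_isQuasiInverse (v := l)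
    ⟨hl, Setoid.trans (LinearMap.FiniteRangeSetoid.equiv_comp_left hlr) hr⟩

/-- The Fredholm index is locally constant in the operator norm. -/
lemma eventually_fredholmIndex_eq {T : H →L[ℂ] H} (hT : T.IsFredholm) :
    ∀ᶠ S in nhds T, S.IsFredholm → fredholmIndex S = fredholmIndex T := by
  obtain ⟨pkg⟩ := hT.nonempty_fredholmPackage
  set ι := pkg.decDom.X₁.subtypeL
  set p := pkg.decCodom.proj
  have hcont : Continuous fun S : H →L[ℂ] H => p ∘L S ∘L ι := by fun_prop
  have hT0 : p ∘L T ∘L ι = pkg.equiv := by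
    ext x
    simp [pkg.eq_equiv, p, ι]
  have : CompleteSpace pkg.decDom.X₁ :=
    pkg.decDom.isTopCompl.isClosed.completeSpace_coe
  have hnhds : ∀ᶠ S in nhds T, p ∘L S ∘L ι ∈
      Set.range ((↑) : (pkg.decDom.X₁ ≃L[ℂ] pkg.decCodom.X₁) → _) :=
    hcont.continuousAt.eventually_mem (by
      rw [hT0]; exact ContinuousLinearEquiv.nhds _)
  have key (S : H →L[ℂ] H) (hS : S.IsFredholm) (hmem : p ∘L S ∘L ι ∈
      Set.range ((↑) : (pkg.decDom.X₁ ≃L[ℂ] pkg.decCodom.X₁) → _)) :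
      fredholmIndex S = - p.toLinearMap.index - ι.toLinearMap.index := by
    obtain ⟨e, he⟩ := hmem
    have := hS.finite_ker
    have : FiniteDimensional ℂ (H ⧸ S.range) := hS.finite_coker
    have := pkg.decDom.finite_X₀
    have := pkg.decCodom.finite_X₀
    have i1 : FiniteDimensional ℂ ι.toLinearMap.ker := by
      rw [show ι.toLinearMap.ker = ⊥ from Submodule.ker_subtype _]; infer_instance
    have i2 : FiniteDimensional ℂ (H ⧸ ι.toLinearMap.range) := by
      rw [show ι.toLinearMap.range = pkg.decDom.X₁ from Submodule.range_subtype _]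
      exact (Submodule.quotientEquivOfIsCompl _ _
        pkg.decDom.isTopCompl.isCompl).symm.finiteDimensional
    have i3 : FiniteDimensional ℂ p.toLinearMap.ker := by
      rw [show p.toLinearMap.ker = pkg.decCodom.X₀ from
        Submodule.ker_projectionOntoL pkg.decCodom.isTopCompl]
      infer_instance
    have i4 : FiniteDimensional ℂ (pkg.decCodom.X₁ ⧸ p.toLinearMap.range) := by
      rw [show p.toLinearMap.range = ⊤ from
        Submodule.range_projectionOntoL pkg.decCodom.isTopCompl]
      infer_instance
    have i5 : FiniteDimensional ℂ (S.toLinearMap ∘ₗ ι.toLinearMap).ker := by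
      rw [LinearMap.ker_comp]; infer_instance
    have i6 : FiniteDimensional ℂ (H ⧸ (S.toLinearMap ∘ₗ ι.toLinearMap).range) := by
      rw [LinearMap.range_comp]; infer_instance
    have h1 : (p.toLinearMap ∘ₗ S.toLinearMap ∘ₗ ι.toLinearMap).index = 0 := by
      have : p.toLinearMap ∘ₗ S.toLinearMap ∘ₗ ι.toLinearMap = e.toLinearEquiv.toLinearMap :=
        congrArg ContinuousLinearMap.toLinearMap he.symm
      rw [this, LinearEquiv.index_eq_zero]
    rw [LinearMap.index_comp, LinearMap.index_comp] at h1
    change S.toLinearMap.index = _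
    linarith
  filter_upwards [hnhds] with S hS hSF
  rw [key S hSF hS, key T hT (by rw [hT0]; exact ⟨_, rfl⟩)]

omit [CompleteSpace H] in
/-- Conjugation by an invertible operator preserves the Fredholm property and the index. -/
lemma isFredholm_conj {w v : H →L[ℂ] H} (h1 : w * v = 1) (h2 : v * w = 1) {T : H →L[ℂ] H}
    (hT : T.IsFredholm) :
    (w * T * v).IsFredholm ∧ fredholmIndex (w * T * v) = fredholmIndex T := by
  let e : H ≃ₗ[ℂ] H := LinearEquiv.ofLinearMap w.toLinearMap v.toLinearMap
    (congrArg ContinuousLinearMap.toLinearMap h1) (congrArg ContinuousLinearMap.toLinearMap h2)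
  constructor
  · obtain ⟨S, hS⟩ := hT.exists_isQuasiInverse
    refine IsFredholm.of_isQuasiInverse (v := w * S * v) ?_
    exact (e.symm.isQuasiInverse.comp hS).comp e.isQuasiInverse
  · have := hT.finite_ker
    have : FiniteDimensional ℂ (H ⧸ T.range) := hT.finite_coker
    have k0 (f : H ≃ₗ[ℂ] H) : FiniteDimensional ℂ f.toLinearMap.ker := by
      rw [LinearEquiv.ker]; infer_instance
    have r0 (f : H ≃ₗ[ℂ] H) : FiniteDimensional ℂ (H ⧸ f.toLinearMap.range) := by
      rw [LinearEquiv.range]; infer_instance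
    have := k0 e
    have := k0 e.symm
    have := r0 e
    have := r0 e.symm
    have i5 : FiniteDimensional ℂ (T.toLinearMap ∘ₗ e.symm.toLinearMap).ker := by
      rw [LinearMap.ker_comp]; infer_instance
    have i6 : FiniteDimensional ℂ (H ⧸ (T.toLinearMap ∘ₗ e.symm.toLinearMap).range) := by
      rw [LinearMap.range_comp]; infer_instance
    change (e.toLinearMap ∘ₗ T.toLinearMap ∘ₗ e.symm.toLinearMap).index = T.toLinearMap.index
    rw [LinearMap.index_comp, LinearMap.index_comp, LinearEquiv.index_eq_zero,
      LinearEquiv.index_eq_zero]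
    simp

omit [CompleteSpace K] [CompleteSpace L] in
lemma hsSq_eq_add {S : H →L[ℂ] K} {T : H →L[ℂ] L} {M : Type*} [NormedAddCommGroup M]
    [InnerProductSpace ℂ M] [CompleteSpace M] {R : H →L[ℂ] M}
    (h : ∀ x, ‖S x‖ ^ 2 = ‖T x‖ ^ 2 + ‖R x‖ ^ 2) : hsSq S = hsSq T + hsSq R := by
  rw [hsSq, hsSq, hsSq, ← ENNReal.tsum_add]
  refine tsum_congr fun i => ?_
  rw [← ofReal_norm, ← ofReal_norm, ← ofReal_norm, ← ENNReal.ofReal_pow (norm_nonneg _),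
    ← ENNReal.ofReal_pow (norm_nonneg _), ← ENNReal.ofReal_pow (norm_nonneg _), h,
    ENNReal.ofReal_add (by positivity) (by positivity)]

lemma hsSq_starProjection (N : Submodule ℂ H) [FiniteDimensional ℂ N] :
    hsSq N.starProjection = Module.finrank ℂ N := by
  have h1 : hsSq N.starProjection = hsSq N.orthogonalProjectionOnto :=
    hsSq_congr_norm fun x => by rw [Submodule.starProjection_apply, Submodule.coe_norm]
  rw [h1, ← N.adjoint_subtypeL, hsSq_adjoint,
    hsSq_eq_tsum (stdOrthonormalBasis ℂ N).toHilbertBasis, tsum_fintype]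
  have h2 (i : Fin (Module.finrank ℂ N)) :
      ‖N.subtypeL ((stdOrthonormalBasis ℂ N).toHilbertBasis i)‖ₑ = 1 := by
    rw [← ofReal_norm, OrthonormalBasis.coe_toHilbertBasis, Submodule.subtypeL_apply,
      ← Submodule.coe_norm, OrthonormalBasis.norm_eq_one, ENNReal.ofReal_one]
  simp only [h2]
  simp

/-- The Fedosov formula `Ind T = Tr (1 - T* T) - Tr (1 - T T*)`. With the partial isometry `W` of
the polar decomposition, `1 - T T*` is the sum of the projection onto `ker T*` and of
`W (1 - T* T) W*`, while `1 - T* T` is the sum of the projection onto `ker T` and of a part on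
which `W` is isometric. -/
lemma fredholmIndex_eq_hsSq_sub {T : H →L[ℂ] H} (hT : T.IsFredholm) {X : H →L[ℂ] K}
    {Z : H →L[ℂ] L} (hX : T.adjoint ∘L T = 1 - X.adjoint ∘L X)
    (hZ : T ∘L T.adjoint = 1 - Z.adjoint ∘L Z) (hXf : hsSq X < ∞) :
    (fredholmIndex T : ℝ) = (hsSq X).toReal - (hsSq Z).toReal := by
  obtain ⟨W, hW, hWT, hWN, hWN'⟩ :=
    exists_partialIsometry T (CFC.abs T) (norm_cfcAbs_apply T)
  have hsa : (CFC.abs T).adjoint = CFC.abs T :=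
    (IsSelfAdjoint.of_nonneg (CFC.abs_nonneg T)).adjoint_eq
  set N := (CFC.abs T).adjoint.ker with hN
  set N' := T.adjoint.ker with hN'
  have hNT : N = T.ker := by
    ext x
    rw [hN, hsa, LinearMap.mem_ker, LinearMap.mem_ker]
    simp only [coe_coe]
    rw [← norm_eq_zero, ← norm_cfcAbs_apply, norm_eq_zero]
  have e1 : N' ≃ₗ[ℂ] H ⧸ T.range := by
    have : CompleteSpace T.range := hT.isClosed_range.completeSpace_coe
    rw [hN', ← ContinuousLinearMap.orthogonal_range]
    exact (Submodule.quotientEquivOfIsCompl _ _ T.range.isCompl_orthogonal).symm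
  have := hT.finite_ker
  have : FiniteDimensional ℂ (H ⧸ T.range) := hT.finite_coker
  have f1 : FiniteDimensional ℂ N := by rw [hNT]; infer_instance
  have f2 : FiniteDimensional ℂ N' := e1.symm.finiteDimensional
  have hX' := norm_sq_add_norm_sq hX
  have hZ' (x) : ‖T.adjoint x‖ ^ 2 + ‖Z x‖ ^ 2 = ‖x‖ ^ 2 :=
    norm_sq_add_norm_sq (by rw [adjoint_adjoint, hZ]) x
  have hTW (y) : ‖T.adjoint y‖ = ‖T (W.adjoint y)‖ := by
    have : T.adjoint = CFC.abs T ∘L W.adjoint := by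
      conv_lhs => rw [← hW]
      rw [adjoint_comp, hsa]
    rw [this]
    exact (norm_cfcAbs_apply T _).symm
  have h1 : hsSq Z = hsSq N'.starProjection + hsSq (X ∘L W.adjoint) := by
    refine hsSq_eq_add fun y => ?_
    have a1 := hX' (W.adjoint y)
    have a2 := hZ' y
    have a3 := hWN' y
    rw [hTW] at a2
    rw [comp_apply]
    linarith
  have h2 : hsSq X = hsSq (X ∘L W.adjoint) + hsSq (X ∘L N.starProjection) := by
    rw [← hsSq_adjoint X, ← hsSq_adjoint (X ∘L W.adjoint), ← hsSq_adjoint (X ∘L N.starProjection)]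
    refine hsSq_eq_add fun y => ?_
    rw [adjoint_comp, adjoint_comp, adjoint_adjoint, comp_apply, comp_apply,
      (isSelfAdjoint_starProjection N).adjoint_eq, hWN]
  have h3 : hsSq (X ∘L N.starProjection) = hsSq N.starProjection := by
    refine hsSq_congr_norm fun y => ?_
    have hy : T (N.starProjection y) = 0 := hNT.le (Submodule.starProjection_apply_mem N y)
    have := hX' (N.starProjection y)
    rw [hy, norm_zero, zero_pow two_ne_zero, zero_add] at this
    exact (sq_eq_sq₀ (norm_nonneg _) (norm_nonneg _)).mp this
  rw [hsSq_starProjection] at h1 h3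
  rw [h3] at h2
  have hfin : hsSq (X ∘L W.adjoint) < ∞ := lt_of_le_of_lt (h2 ▸ le_self_add) hXf
  have hfr : Module.finrank ℂ N = Module.finrank ℂ T.ker := by rw [hNT]
  rw [h1, h2, ENNReal.toReal_add hfin.ne (by simp), ENNReal.toReal_add (by simp) hfin.ne,
    ENNReal.toReal_natCast, ENNReal.toReal_natCast, fredholmIndex, hfr, e1.finrank_eq]
  push_cast
  ring

end Fredholm

/-! ### Multiplication operators on `L²(ℝ²)` -/

section MulOp

lemma L2Plane.enorm_sq (ψ : L2Plane) : ‖ψ‖ₑ ^ 2 = ∫⁻ x, ‖ψ x‖ₑ ^ 2 := by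
  rw [Lp.enorm_def, eLpNorm_eq_lintegral_rpow_enorm_toReal (by norm_num) (by norm_num)]
  simp only [ENNReal.toReal_ofNat, ENNReal.rpow_ofNat, one_div]
  rw [← ENNReal.rpow_natCast, ← ENNReal.rpow_mul]
  norm_num

lemma L2Plane.norm_sq (ψ : L2Plane) : ‖ψ‖ ^ 2 = (∫⁻ x, ‖ψ x‖ₑ ^ 2).toReal := by
  rw [← L2Plane.enorm_sq, ENNReal.toReal_pow, toReal_enorm]

/-- Bounded Borel functions, the symbols of the multiplication operators below. -/
structure IsBddMeas (f : Plane → ℂ) : Prop where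
  meas : Measurable f
  bdd : ∃ C, ∀ x, ‖f x‖ ≤ C

namespace IsBddMeas

variable {f g : Plane → ℂ}

lemma memLp (hf : IsBddMeas f) : MemLp f ∞ (volume : Measure Plane) := by
  obtain ⟨C, hC⟩ := hf.bdd
  exact memLp_top_of_bound hf.meas.aestronglyMeasurable C (ae_of_all _ hC)

lemma mul (hf : IsBddMeas f) (hg : IsBddMeas g) : IsBddMeas fun x => f x * g x := by
  obtain ⟨C, hC⟩ := hf.bdd
  obtain ⟨D, hD⟩ := hg.bdd
  refine ⟨hf.meas.mul hg.meas, C * D, fun x => ?_⟩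
  rw [norm_mul]
  exact mul_le_mul (hC x) (hD x) (norm_nonneg _) ((norm_nonneg _).trans (hC x))

lemma add (hf : IsBddMeas f) (hg : IsBddMeas g) : IsBddMeas fun x => f x + g x := by
  obtain ⟨C, hC⟩ := hf.bdd
  obtain ⟨D, hD⟩ := hg.bdd
  exact ⟨hf.meas.add hg.meas, C + D, fun x => (norm_add_le _ _).trans (add_le_add (hC x) (hD x))⟩

lemma conj (hf : IsBddMeas f) : IsBddMeas fun x => starRingEnd ℂ (f x) := by
  obtain ⟨C, hC⟩ := hf.bdd
  exact ⟨Complex.continuous_conj.measurable.comp hf.meas, C, fun x => by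
    rw [RCLike.norm_conj]; exact hC x⟩

lemma const (c : ℂ) : IsBddMeas fun _ => c := ⟨measurable_const, ‖c‖, fun _ => le_rfl⟩

lemma indicator {s : Set Plane} (hs : MeasurableSet s) : IsBddMeas (s.indicator 1) := by
  refine ⟨measurable_one.indicator hs, 1, fun x => ?_⟩
  by_cases h : x ∈ s <;> simp [h]

lemma comp (hf : IsBddMeas f) {T : Plane → Plane} (hT : Measurable T) :
    IsBddMeas fun x => f (T x) :=
  ⟨hf.meas.comp hT, hf.bdd.imp fun _ hC x => hC (T x)⟩

lemma ofReal {a : ℝ → ℝ} (ha : Measurable a) {C : ℝ} (hC : ∀ t, |a t| ≤ C) :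
    IsBddMeas fun x => ((a (x 0) : ℝ) : ℂ) :=
  ⟨Complex.measurable_ofReal.comp (ha.comp (by fun_prop)), C, fun x => by
    rw [Complex.norm_real]; exact hC _⟩

lemma mulOp_ae (hf : IsBddMeas f) (ψ : L2Plane) : ∀ᵐ x, mulOp f ψ x = f x * ψ x :=
  mulOp_coeFn hf.memLp ψ

end IsBddMeas

open ContinuousLinearMap

variable {f g : Plane → ℂ}

lemma mulOp_mul (hf : IsBddMeas f) (hg : IsBddMeas g) :
    mulOp f * mulOp g = mulOp fun x => f x * g x := by
  ext1 ψ
  refine Lp.ext ?_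
  filter_upwards [hf.mulOp_ae (mulOp g ψ), hg.mulOp_ae ψ, (hf.mul hg).mulOp_ae ψ] with x h1 h2 h3
  change mulOp f (mulOp g ψ) x = _
  rw [h1, h2, h3, mul_assoc]

lemma mulOp_add (hf : IsBddMeas f) (hg : IsBddMeas g) :
    mulOp f + mulOp g = mulOp fun x => f x + g x := by
  ext1 ψ
  refine Lp.ext ?_
  filter_upwards [hf.mulOp_ae ψ, hg.mulOp_ae ψ, (hf.add hg).mulOp_ae ψ,
    Lp.coeFn_add (mulOp f ψ) (mulOp g ψ)] with x h1 h2 h3 h4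
  change (mulOp f ψ + mulOp g ψ : L2Plane) x = _
  rw [h4, Pi.add_apply, h1, h2, h3, add_mul]

lemma mulOp_one : mulOp (fun _ => 1) = 1 := by
  ext1 ψ
  refine Lp.ext ?_
  filter_upwards [(IsBddMeas.const 1).mulOp_ae ψ] with x h1
  rw [h1, one_mul]; rfl

lemma star_mulOp (hf : IsBddMeas f) : star (mulOp f) = mulOp fun x => starRingEnd ℂ (f x) := by
  symm
  rw [star_eq_adjoint, eq_adjoint_iff]
  intro φ ψ
  rw [L2.inner_def, L2.inner_def]
  refine integral_congr_ae ?_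
  filter_upwards [hf.conj.mulOp_ae φ, hf.mulOp_ae ψ] with x h1 h2
  rw [h1, h2]
  simp only [RCLike.inner_apply, map_mul, Complex.conj_conj]
  ring

lemma norm_mulOp_apply_le (hf : IsBddMeas f) {C : ℝ} (hC : ∀ x, ‖f x‖ ≤ C) (ψ : L2Plane) :
    ‖mulOp f ψ‖ ≤ C * ‖ψ‖ := by
  refine Lp.norm_le_mul_norm_of_ae_le_mul ?_
  filter_upwards [hf.mulOp_ae ψ] with x h1
  rw [h1, norm_mul]
  exact mul_le_mul_of_nonneg_right (hC x) (norm_nonneg _)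

lemma norm_mulOp_le (hf : IsBddMeas f) {C : ℝ} (hC : ∀ x, ‖f x‖ ≤ C) : ‖mulOp f‖ ≤ C :=
  opNorm_le_bound _ ((norm_nonneg _).trans (hC 0)) (norm_mulOp_apply_le hf hC)

/-- The projection of `L²(ℝ²)` onto the functions supported in the disk of radius `n`. -/
def diskOp (n : ℕ) : L2Plane →L[ℂ] L2Plane := mulOp ((Metric.closedBall 0 n).indicator 1)

lemma isBddMeas_disk (n : ℕ) : IsBddMeas ((Metric.closedBall (0 : Plane) n).indicator 1) :=
  IsBddMeas.indicator measurableSet_closedBall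

lemma norm_indicator_one_le (s : Set Plane) (x : Plane) : ‖(s.indicator 1 x : ℂ)‖ ≤ 1 := by
  by_cases h : x ∈ s <;> simp [h]

lemma norm_diskOp_le (n : ℕ) : ‖diskOp n‖ ≤ 1 :=
  norm_mulOp_le (isBddMeas_disk n) (norm_indicator_one_le _)

lemma star_mulOp_indicator {s : Set Plane} (hs : MeasurableSet s) :
    star (mulOp (s.indicator 1)) = mulOp (s.indicator 1) := by
  rw [star_mulOp (IsBddMeas.indicator hs)]
  congr 1
  ext x
  by_cases h : x ∈ s <;> simp [h]

lemma diskOp_apply_ae (n : ℕ) (ψ : L2Plane) :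
    ∀ᵐ x, x ∉ Metric.closedBall (0 : Plane) n → diskOp n ψ x = 0 := by
  filter_upwards [(isBddMeas_disk n).mulOp_ae ψ] with x h1 h2
  rw [diskOp, h1, Set.indicator_of_notMem h2, zero_mul]

lemma tendsto_diskOp (ψ : L2Plane) : Tendsto (fun n => diskOp n ψ) atTop (nhds ψ) := by
  have h1 : Tendsto (fun n : ℕ => ∫⁻ x, ‖(diskOp n ψ - ψ) x‖ₑ ^ 2) atTop
      (nhds (∫⁻ _ : Plane, 0)) := by
    refine tendsto_lintegral_of_dominated_convergence' (fun x => ‖ψ x‖ₑ ^ 2) ?_ ?_ ?_ ?_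
    · intro n
      exact ((Lp.aestronglyMeasurable _).enorm).pow_const 2
    · intro n
      filter_upwards [(isBddMeas_disk n).mulOp_ae ψ, Lp.coeFn_sub (diskOp n ψ) ψ] with x h1 h2
      rw [h2, Pi.sub_apply, diskOp, h1]
      by_cases h : x ∈ Metric.closedBall (0 : Plane) n <;> simp [h]
    · rw [← L2Plane.enorm_sq]
      exact (ENNReal.pow_lt_top (by simp)).ne
    · have h (n : ℕ) := (isBddMeas_disk n).mulOp_ae ψ
      have h' (n : ℕ) := Lp.coeFn_sub (diskOp n ψ) ψ
      filter_upwards [ae_all_iff.mpr h, ae_all_iff.mpr h'] with x h1 h2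
      refine tendsto_const_nhds.congr' ?_
      filter_upwards [eventually_ge_atTop ⌈‖x‖⌉₊] with n hn
      have hx : x ∈ Metric.closedBall (0 : Plane) n := by
        rw [mem_closedBall_zero_iff]
        exact (Nat.le_ceil _).trans (by exact_mod_cast hn)
      rw [h2, Pi.sub_apply, diskOp, h1, Set.indicator_of_mem hx]
      simp
  rw [tendsto_iff_norm_sub_tendsto_zero]
  have h2 : Tendsto (fun n : ℕ => √(‖diskOp n ψ - ψ‖ ^ 2)) atTop (nhds 0) := by
    simp_rw [L2Plane.norm_sq]
    have := ((ENNReal.tendsto_toReal (by simp)).comp h1).sqrt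
    simpa using this
  simpa [Real.sqrt_sq (norm_nonneg _)] using h2

end MulOp

/-! ### Integral kernels -/

section Kernel

open ContinuousLinearMap

lemma HilbertBasis.countable {ι : Type*} {H : Type*} [NormedAddCommGroup H]
    [InnerProductSpace ℂ H] [TopologicalSpace.SeparableSpace H]
    (b : HilbertBasis ι ℂ H) : Countable ι := by
  have hd : Pairwise (Function.onFun Disjoint fun i => Metric.ball (b i) (1 / 2)) := by
    intro i j hij
    refine Metric.ball_disjoint_ball ?_
    have h1 : ‖b i - b j‖ ^ 2 = 2 := by
      rw [@norm_sub_sq ℂ, b.orthonormal.1 i, b.orthonormal.1 j, b.orthonormal.2 hij]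
      norm_num
    rw [dist_eq_norm]
    nlinarith [norm_nonneg (b i - b j)]
  have := Set.PairwiseDisjoint.countable_of_isOpen (s := fun i => Metric.ball (b i) (1 / 2))
    (a := Set.univ) (fun i _ j _ hij => hd hij) (fun i _ => Metric.isOpen_ball)
    (fun i _ => ⟨b i, by simp⟩)
  exact Set.countable_univ_iff.mp this

instance : Countable (someBasisIndex L2Plane) :=
  have : Fact ((2 : ℝ≥0∞) ≠ ∞) := ⟨by norm_num⟩
  (someBasis L2Plane).countable

/-- `T` has the locally bounded kernel `κ`: the formula `(T ψ)(x) = ∫ κ(x, y) ψ(y) dy` holds for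
the functions `ψ` with bounded support. Sums, and products with multiplication operators on either
side, have such kernels again. -/
structure IsLocalKernel (T : L2Plane →L[ℂ] L2Plane) (κ : Plane → Plane → ℂ) : Prop where
  meas : Measurable fun z : Plane × Plane => κ z.1 z.2
  bdd : ∀ n : ℕ, ∃ C, ∀ x ∈ Metric.closedBall (0 : Plane) n, ∀ y ∈ Metric.closedBall (0 : Plane) n,
    ‖κ x y‖ ≤ C
  apply : ∀ (n : ℕ) (ψ : L2Plane), (∀ᵐ y, y ∉ Metric.closedBall (0 : Plane) n → ψ y = 0) →
    ∀ᵐ x, T ψ x = ∫ y, κ x y * ψ y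

namespace IsLocalKernel

variable {T S : L2Plane →L[ℂ] L2Plane} {κ l : Plane → Plane → ℂ}

lemma memLp (h : IsLocalKernel T κ) (n : ℕ) (x : Plane) :
    MemLp (fun y => (Metric.closedBall (0 : Plane) n).indicator 1 y * starRingEnd ℂ (κ x y)) 2 := by
  obtain ⟨m, hm⟩ := exists_nat_ge (max ‖x‖ n)
  obtain ⟨C, hC⟩ := h.bdd m
  have hmeas : Measurable fun y => κ x y := h.meas.comp measurable_prodMk_left
  have : MemLp ((Metric.closedBall (0 : Plane) n).indicator fun _ => max C 0) 2 :=
    memLp_indicator_const 2 measurableSet_closedBall _ (Or.inr measure_closedBall_lt_top.ne)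
  refine this.mono ((isBddMeas_disk n).meas.mul
    (Complex.continuous_conj.measurable.comp hmeas)).aestronglyMeasurable (ae_of_all _ fun y => ?_)
  by_cases hy : y ∈ Metric.closedBall (0 : Plane) n
  · have h1 : ‖κ x y‖ ≤ C := hC x (by simpa using (le_max_left _ _).trans hm) y
      (Metric.closedBall_subset_closedBall ((le_max_right _ _).trans hm) hy)
    simp only [hy, Set.indicator_of_mem, Pi.one_apply, one_mul, RCLike.norm_conj]
    exact (h1.trans (le_max_left _ _)).trans (le_abs_self _)
  · simp [hy]

lemma integral_eq_inner (h : IsLocalKernel T κ) (n : ℕ) (x : Plane) {ψ : L2Plane}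
    (hψ : ∀ᵐ y, y ∉ Metric.closedBall (0 : Plane) n → ψ y = 0) :
    Integrable (fun y => κ x y * ψ y) ∧
      ∫ y, κ x y * ψ y = ⟪(h.memLp n x).toLp _, ψ⟫_ℂ := by
  have heq : (fun y => ⟪(h.memLp n x).toLp _ y, ψ y⟫_ℂ) =ᵐ[volume] fun y => κ x y * ψ y := by
    filter_upwards [hψ, (h.memLp n x).coeFn_toLp] with y h1 h2
    rw [h2]
    by_cases hy : y ∈ Metric.closedBall (0 : Plane) n
    · simp [hy, mul_comm]
    · simp [h1 hy]
  exact ⟨(L2.integrable_inner (𝕜 := ℂ) _ _).congr heq, (integral_congr_ae heq).symm⟩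

lemma integrable (h : IsLocalKernel T κ) {n : ℕ} (x : Plane) {ψ : L2Plane}
    (hψ : ∀ᵐ y, y ∉ Metric.closedBall (0 : Plane) n → ψ y = 0) :
    Integrable (fun y => κ x y * ψ y) := (h.integral_eq_inner n x hψ).1

lemma add (hT : IsLocalKernel T κ) (hS : IsLocalKernel S l) :
    IsLocalKernel (T + S) fun x y => κ x y + l x y where
  meas := hT.meas.add hS.meas
  bdd n := by
    obtain ⟨C, hC⟩ := hT.bdd n
    obtain ⟨D, hD⟩ := hS.bdd n
    exact ⟨C + D, fun x hx y hy =>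
      (norm_add_le _ _).trans (add_le_add (hC x hx y hy) (hD x hx y hy))⟩
  apply n ψ hψ := by
    filter_upwards [hT.apply n ψ hψ, hS.apply n ψ hψ, Lp.coeFn_add (T ψ) (S ψ)] with x h1 h2 h3
    change (T ψ + S ψ : L2Plane) x = _
    rw [h3, Pi.add_apply, h1, h2, ← integral_add (hT.integrable x hψ) (hS.integrable x hψ)]
    simp only [add_mul]

lemma smul (hT : IsLocalKernel T κ) (c : ℂ) : IsLocalKernel (c • T) fun x y => c * κ x y where
  meas := hT.meas.const_mul c
  bdd n := by
    obtain ⟨C, hC⟩ := hT.bdd n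
    refine ⟨‖c‖ * C, fun x hx y hy => ?_⟩
    rw [norm_mul]
    exact mul_le_mul_of_nonneg_left (hC x hx y hy) (norm_nonneg _)
  apply n ψ hψ := by
    filter_upwards [hT.apply n ψ hψ, Lp.coeFn_smul c (T ψ)] with x h1 h3
    change (c • T ψ : L2Plane) x = _
    rw [h3, Pi.smul_apply, h1, smul_eq_mul, ← integral_const_mul]
    simp only [mul_assoc]

lemma mulOp_mul (hT : IsLocalKernel T κ) {a b : Plane → ℂ} (ha : IsBddMeas a) (hb : IsBddMeas b) :
    IsLocalKernel (mulOp a * T * mulOp b) fun x y => a x * κ x y * b y where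
  meas := ((ha.meas.comp measurable_fst).mul hT.meas).mul (hb.meas.comp measurable_snd)
  bdd n := by
    obtain ⟨C, hC⟩ := hT.bdd n
    obtain ⟨A, hA⟩ := ha.bdd
    obtain ⟨B, hB⟩ := hb.bdd
    refine ⟨A * C * B, fun x hx y hy => ?_⟩
    have hA0 : 0 ≤ A := (norm_nonneg _).trans (hA 0)
    have hC0 : 0 ≤ C := (norm_nonneg _).trans (hC x hx y hy)
    rw [norm_mul, norm_mul]
    gcongr
    exacts [hA x, hC x hx y hy, hB y]
  apply n ψ hψ := by
    have hbψ : ∀ᵐ y, y ∉ Metric.closedBall (0 : Plane) n → mulOp b ψ y = 0 := by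
      filter_upwards [hb.mulOp_ae ψ, hψ] with y h1 h2 h3
      rw [h1, h2 h3, mul_zero]
    filter_upwards [ha.mulOp_ae (T (mulOp b ψ)), hT.apply n _ hbψ] with x h1 h2
    change mulOp a (T (mulOp b ψ)) x = _
    rw [h1, h2, ← integral_const_mul]
    refine integral_congr_ae ?_
    filter_upwards [hb.mulOp_ae ψ] with y h3
    rw [h3]
    ring

/-- An integral operator with a continuous kernel, possibly multiplied by a continuous weight. -/
lemma of_hasKernel {k : Plane → Plane → ℂ} (h : HasKernel T k)
    (hk : Continuous fun z : Plane × Plane => k z.1 z.2) : IsLocalKernel T k where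
  meas := hk.measurable
  bdd n := by
    obtain ⟨C, hC⟩ := ((isCompact_closedBall (0 : Plane) n).prod
      (isCompact_closedBall (0 : Plane) n)).exists_bound_of_continuousOn hk.continuousOn
    exact ⟨C, fun x hx y hy => hC (x, y) ⟨hx, hy⟩⟩
  apply n ψ _ := (h.2 ψ).mono fun x hx => hx.2

/-- The Hilbert–Schmidt norm of an operator is the `L²` norm of its kernel. -/
lemma hsSq_eq (h : IsLocalKernel T κ) : hsSq T = ∫⁻ x, ∫⁻ y, ‖κ x y‖ₑ ^ 2 := by
  set b := someBasis L2Plane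
  have hmeas : Measurable fun z : Plane × Plane => ‖κ z.1 z.2‖ₑ ^ 2 := h.meas.enorm.pow_const 2
  -- the operators with truncated second argument
  have h1 (n : ℕ) : hsSq (T * diskOp n) =
      ∫⁻ x, ∫⁻ y in Metric.closedBall (0 : Plane) n, ‖κ x y‖ₑ ^ 2 := by
    have e1 : hsSq (T * diskOp n) = ∑' i, ∫⁻ x, ‖T (diskOp n (b i)) x‖ₑ ^ 2 :=
      tsum_congr fun i => L2Plane.enorm_sq _
    rw [e1, ← lintegral_tsum fun i => (Lp.aestronglyMeasurable _).enorm.pow_const 2]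
    refine lintegral_congr_ae ?_
    filter_upwards [ae_all_iff.mpr fun i => h.apply n _ (diskOp_apply_ae n (b i))] with x hx
    have e2 (i) : T (diskOp n (b i)) x = ⟪(h.memLp n x).toLp _, b i⟫_ℂ := by
      rw [hx, (h.integral_eq_inner n x (diskOp_apply_ae n (b i))).2, L2.inner_def, L2.inner_def]
      refine integral_congr_ae ?_
      filter_upwards [(h.memLp n x).coeFn_toLp, (isBddMeas_disk n).mulOp_ae (b i)] with y h2 h3
      rw [h2, diskOp, h3]
      by_cases hy : y ∈ Metric.closedBall (0 : Plane) n <;> simp [hy]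
    calc ∑' i, ‖T (diskOp n (b i)) x‖ₑ ^ 2 = ∑' i, ‖⟪b i, (h.memLp n x).toLp _⟫_ℂ‖ₑ ^ 2 := by
          refine tsum_congr fun i => ?_
          rw [e2, ← inner_conj_symm, ← ofReal_norm, RCLike.norm_conj, ofReal_norm]
      _ = ‖(h.memLp n x).toLp _‖ₑ ^ 2 := b.tsum_enorm_inner_sq _
      _ = _ := by
          rw [L2Plane.enorm_sq, ← lintegral_indicator measurableSet_closedBall]
          refine lintegral_congr_ae ?_
          filter_upwards [(h.memLp n x).coeFn_toLp] with y h2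
          rw [h2]
          by_cases hy : y ∈ Metric.closedBall (0 : Plane) n
          · simp [hy, ← ofReal_norm]
          · simp [hy]
  -- the same norms computed from the adjoint: truncation becomes restriction to the disk, so that
  -- they increase to the norm of `T`
  set F : Plane → ℝ≥0∞ := fun y => ∑' j, ‖T.adjoint (b j) y‖ₑ ^ 2
  have h2 (n : ℕ) : hsSq (T * diskOp n) = ∫⁻ y in Metric.closedBall (0 : Plane) n, F y := by
    rw [← hsSq_star, star_mul, diskOp, star_mulOp_indicator measurableSet_closedBall]
    have e1 : hsSq (mulOp ((Metric.closedBall (0 : Plane) n).indicator 1) * star T) =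
        ∑' j, ∫⁻ y in Metric.closedBall (0 : Plane) n, ‖T.adjoint (b j) y‖ₑ ^ 2 := by
      refine tsum_congr fun j => ?_
      rw [L2Plane.enorm_sq, ← lintegral_indicator measurableSet_closedBall]
      refine lintegral_congr_ae ?_
      filter_upwards [(isBddMeas_disk n).mulOp_ae (T.adjoint (b j))] with y h3
      change ‖mulOp _ (T.adjoint (b j)) y‖ₑ ^ 2 = _
      rw [h3]
      by_cases hy : y ∈ Metric.closedBall (0 : Plane) n <;> simp [hy]
    rw [e1, lintegral_tsum fun j => ((Lp.aestronglyMeasurable _).enorm.pow_const 2).restrict]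
  have h3 : hsSq T = ∫⁻ y, F y := by
    rw [← hsSq_star, lintegral_tsum fun j => (Lp.aestronglyMeasurable _).enorm.pow_const 2]
    exact tsum_congr fun j => L2Plane.enorm_sq _
  have hdir : Directed (· ⊆ ·) fun n : ℕ => Metric.closedBall (0 : Plane) n :=
    directed_of_isDirected_le fun m n hmn =>
      Metric.closedBall_subset_closedBall (by exact_mod_cast hmn)
  rw [h3, lintegral_lintegral_swap hmeas.aemeasurable, ← setLIntegral_univ,
    ← setLIntegral_univ (fun y => ∫⁻ x, _), ← Metric.iUnion_closedBall_nat (0 : Plane),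
    setLIntegral_iUnion_of_directed _ hdir, setLIntegral_iUnion_of_directed _ hdir]
  congr 1
  ext n
  rw [← h2, h1, lintegral_lintegral_swap hmeas.aemeasurable]

end IsLocalKernel

lemma integrable_of_ae_eq_zero {ψ : L2Plane} {n : ℕ}
    (hψ : ∀ᵐ y, y ∉ Metric.closedBall (0 : Plane) n → ψ y = 0) : Integrable (ψ : Plane → ℂ) := by
  have h1 : IntegrableOn (ψ : Plane → ℂ) (Metric.closedBall (0 : Plane) n) := by
    have : IsFiniteMeasure ((volume : Measure Plane).restrict (Metric.closedBall (0 : Plane) n)) :=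
      isFiniteMeasure_restrict.mpr measure_closedBall_lt_top.ne
    exact ((Lp.memLp ψ).restrict _).integrable (by norm_num)
  refine ((integrable_indicator_iff measurableSet_closedBall).mpr h1).congr ?_
  filter_upwards [hψ] with y hy
  by_cases h : y ∈ Metric.closedBall (0 : Plane) n
  · rw [Set.indicator_of_mem h]
  · rw [Set.indicator_of_notMem h, hy h]

namespace IsLocalKernel

variable {T S : L2Plane →L[ℂ] L2Plane} {κ l : Plane → Plane → ℂ}

lemma integrable_prod (h : IsLocalKernel T κ) {n : ℕ} {φ ψ : L2Plane}
    (hφ : ∀ᵐ y, y ∉ Metric.closedBall (0 : Plane) n → φ y = 0)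
    (hψ : ∀ᵐ y, y ∉ Metric.closedBall (0 : Plane) n → ψ y = 0) :
    Integrable (fun z : Plane × Plane => starRingEnd ℂ (φ z.1) * (κ z.1 z.2 * ψ z.2))
      (volume.prod volume) := by
  obtain ⟨C, hC⟩ := h.bdd n
  have h1 : Integrable (fun z : Plane × Plane => starRingEnd ℂ (φ z.1) * ψ z.2)
      (volume.prod volume) :=
    Integrable.mul_prod (f := fun x => starRingEnd ℂ (φ x))
      (Complex.conjCLE.toContinuousLinearMap.integrable_comp (integrable_of_ae_eq_zero hφ))
      (integrable_of_ae_eq_zero hψ)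
  refine (h1.norm.const_mul C).mono' ?_ ?_
  · have h2 : AEStronglyMeasurable (fun z : Plane × Plane => κ z.1 z.2) (volume.prod volume) :=
      h.meas.aestronglyMeasurable
    refine (h1.aestronglyMeasurable.mul h2).congr (ae_of_all _ fun z => ?_)
    simp only [Pi.mul_apply]
    ring
  · have hφ' := (Measure.quasiMeasurePreserving_fst (μ := (volume : Measure Plane))
      (ν := (volume : Measure Plane))).ae hφ
    have hψ' := (Measure.quasiMeasurePreserving_snd (μ := (volume : Measure Plane))
      (ν := (volume : Measure Plane))).ae hψ
    filter_upwards [hφ', hψ'] with z hz1 hz2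
    by_cases h1 : z.1 ∈ Metric.closedBall (0 : Plane) n
    · by_cases h2 : z.2 ∈ Metric.closedBall (0 : Plane) n
      · have := hC _ h1 _ h2
        simp only [norm_mul]
        calc _ = ‖κ z.1 z.2‖ * (‖starRingEnd ℂ (φ z.1)‖ * ‖ψ z.2‖) := by ring
          _ ≤ _ := by gcongr
      · simp [hz2 h2]
    · simp [hz1 h1]

/-- The sesquilinear form of an operator is the double integral of its kernel. -/
lemma inner_eq (h : IsLocalKernel T κ) {n : ℕ} {φ ψ : L2Plane}
    (hφ : ∀ᵐ y, y ∉ Metric.closedBall (0 : Plane) n → φ y = 0)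
    (hψ : ∀ᵐ y, y ∉ Metric.closedBall (0 : Plane) n → ψ y = 0) :
    ⟪φ, T ψ⟫_ℂ = ∫ z : Plane × Plane, starRingEnd ℂ (φ z.1) * (κ z.1 z.2 * ψ z.2)
      ∂(volume.prod volume) := by
  rw [integral_prod _ (h.integrable_prod hφ hψ), L2.inner_def]
  refine integral_congr_ae ?_
  filter_upwards [h.apply n ψ hψ] with x hx
  rw [hx, RCLike.inner_apply, mul_comm, ← integral_const_mul]

end IsLocalKernel

/-- If `V` has the kernel `k(x, y)` and `G` the kernel `|x₁ - y₁| k(x, y)`, then the part of `V`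
that connects two half-planes at distance `2 R` has norm at most `‖G‖ / (2 R)`. On these half-planes
`|x₁ - y₁| = |x₁| + |y₁|`, and `1 / (a + b) = ∫ exp (-t a) exp (-t b) dt` writes this part of `V` as
an integral over `t` of products `exp (-t |X₁|) G exp (-t |X₁|)`. The sign `σ` selects the
half-plane on the left. -/
lemma norm_offDiagonal_le {V G : L2Plane →L[ℂ] L2Plane} {k : Plane → Plane → ℂ}
    (hV : IsLocalKernel V k)
    (hG : IsLocalKernel G fun x y => ((|x 0 - y 0| : ℝ) : ℂ) * k x y) {σ : ℝ} (hσ : |σ| = 1)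
    {R : ℝ} (hR : 0 < R) :
    ‖mulOp ({x : Plane | R < σ * x 0}.indicator 1) * V *
      mulOp ({x : Plane | σ * x 0 < -R}.indicator 1)‖ ≤ ‖G‖ / (2 * R) := by
  set E := {x : Plane | R < σ * x 0} with hE
  set F := {x : Plane | σ * x 0 < -R} with hF
  have hEm : MeasurableSet E := measurableSet_lt (by fun_prop) (by fun_prop)
  have hFm : MeasurableSet F := measurableSet_lt (by fun_prop) (by fun_prop)
  have hEb := IsBddMeas.indicator hEm
  have hFb := IsBddMeas.indicator hFm
  have hS := hV.mulOp_mul hEb hFb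
  -- the exponential weights
  set a : ℝ → Plane → ℂ := fun t x => E.indicator 1 x * (Real.exp (-(t * (σ * x 0))) : ℂ) with ha
  set b : ℝ → Plane → ℂ := fun t x => F.indicator 1 x * (Real.exp (t * (σ * x 0)) : ℂ) with hb
  have ha1 (t : ℝ) (ht : 0 < t) (x) : ‖a t x‖ ≤ Real.exp (-(t * R)) := by
    by_cases hx : x ∈ E
    · simp only [ha, hx, Set.indicator_of_mem, Pi.one_apply, one_mul, Complex.norm_real,
        Real.norm_eq_abs, Real.abs_exp, Real.exp_le_exp]
      have : R < σ * x 0 := hx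
      nlinarith
    · simp [ha, hx, Real.exp_nonneg]
  have hb1 (t : ℝ) (ht : 0 < t) (x) : ‖b t x‖ ≤ Real.exp (-(t * R)) := by
    by_cases hx : x ∈ F
    · simp only [hb, hx, Set.indicator_of_mem, Pi.one_apply, one_mul, Complex.norm_real,
        Real.norm_eq_abs, Real.abs_exp, Real.exp_le_exp]
      have : σ * x 0 < -R := hx
      nlinarith
    · simp [hb, hx, Real.exp_nonneg]
  have ham (t : ℝ) (ht : 0 < t) : IsBddMeas (a t) := by
    refine ⟨hEb.meas.mul (by fun_prop), _, ha1 t ht⟩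
  have hbm (t : ℝ) (ht : 0 < t) : IsBddMeas (b t) := by
    refine ⟨hFb.meas.mul (by fun_prop), _, hb1 t ht⟩
  have key (n : ℕ) (φ ψ : L2Plane) : ‖⟪diskOp n φ, (mulOp (E.indicator 1) * V *
      mulOp (F.indicator 1)) (diskOp n ψ)⟫_ℂ‖ ≤ ‖G‖ / (2 * R) * (‖φ‖ * ‖ψ‖) := by
    set φ' := diskOp n φ
    set ψ' := diskOp n ψ
    have hφ' := diskOp_apply_ae n φ
    have hψ' := diskOp_apply_ae n ψ
    have hnφ : ‖φ'‖ ≤ ‖φ‖ := by simpa using (diskOp n).le_of_opNorm_le (norm_diskOp_le n) φ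
    have hnψ : ‖ψ'‖ ≤ ‖ψ‖ := by simpa using (diskOp n).le_of_opNorm_le (norm_diskOp_le n) ψ
    rw [hS.inner_eq hφ' hψ']
    have hGS := hG.mulOp_mul hEb hFb
    set g : Plane × Plane → ℂ := fun z => starRingEnd ℂ (φ' z.1) *
      (E.indicator 1 z.1 * (((|z.1 0 - z.2 0| : ℝ) : ℂ) * k z.1 z.2) * F.indicator 1 z.2 * ψ' z.2)
      with hg
    have hgi : Integrable g (volume.prod volume) := hGS.integrable_prod hφ' hψ'
    -- the weight `exp (-t |x₁ - y₁|)` in product form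
    set w : Plane × Plane → ℝ := fun z => σ * z.1 0 - σ * z.2 0 with hw
    have hw1 (z) (hz : g z ≠ 0) : 2 * R ≤ w z ∧ w z = |z.1 0 - z.2 0| := by
      have hz1 : z.1 ∈ E := by
        by_contra h; exact hz (by simp [hg, h])
      have hz2 : z.2 ∈ F := by
        by_contra h; exact hz (by simp [hg, h])
      have h1 : R < σ * z.1 0 := hz1
      have h2 : σ * z.2 0 < -R := hz2
      refine ⟨by simp only [hw]; linarith, ?_⟩
      have : |w z| = |z.1 0 - z.2 0| := by
        rw [hw]; simp only; rw [← mul_sub, abs_mul, hσ, one_mul]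
      rw [← this, abs_of_pos]
      simp only [hw]; linarith
    have hfub : Integrable (Function.uncurry fun (t : ℝ) (z : Plane × Plane) =>
        (Real.exp (-(w z * t)) : ℂ) * g z) ((volume.restrict (Set.Ioi 0)).prod
          (volume.prod volume)) := by
      have h1 : Integrable (fun t : ℝ => Real.exp (-(2 * R) * t)) (volume.restrict (Set.Ioi 0)) :=
        exp_neg_integrableOn_Ioi 0 (by positivity)
      have h2 := h1.mul_prod hgi.norm
      refine h2.mono' ?_ ?_
      · refine AEStronglyMeasurable.mul ?_ ?_
        · exact (by fun_prop : Measurable _).aestronglyMeasurable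
        · exact hgi.aestronglyMeasurable.comp_snd
      · have h3 : ∀ᵐ t ∂((volume : Measure ℝ).restrict (Set.Ioi (0 : ℝ))), 0 < t :=
          ae_restrict_mem measurableSet_Ioi
        have h4 := (Measure.quasiMeasurePreserving_fst
          (μ := (volume : Measure ℝ).restrict (Set.Ioi (0 : ℝ)))
          (ν := (volume : Measure Plane).prod (volume : Measure Plane))).ae h3
        filter_upwards [h4] with p hp
        by_cases hz : g p.2 = 0
        · simp [Function.uncurry, hz]
        · simp only [Function.uncurry, norm_mul, Complex.norm_real, Real.norm_eq_abs, Real.abs_exp]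
          have := (hw1 p.2 hz).1
          gcongr
          nlinarith
    have e1 : ∫ z : Plane × Plane, starRingEnd ℂ (φ' z.1) *
        (E.indicator 1 z.1 * k z.1 z.2 * F.indicator 1 z.2 * ψ' z.2) ∂(volume.prod volume) =
        ∫ z : Plane × Plane, (∫ t : ℝ in Set.Ioi 0, (Real.exp (-(w z * t)) : ℂ) * g z)
          ∂(volume.prod volume) := by
      refine integral_congr_ae (ae_of_all _ fun z => ?_)
      simp only
      rw [integral_mul_const]
      by_cases hz : g z = 0
      · rw [hz, mul_zero]
        by_cases hz1 : z.1 ∈ E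
        · by_cases hz2 : z.2 ∈ F
          · have h1 : R < σ * z.1 0 := hz1
            have h2 : σ * z.2 0 < -R := hz2
            have h3 : z.1 0 - z.2 0 ≠ 0 := fun h => by
              have : z.1 0 = z.2 0 := by linarith
              rw [this] at h1
              linarith
            have h4 : ((|z.1 0 - z.2 0| : ℝ) : ℂ) ≠ 0 := by
              exact Complex.ofReal_ne_zero.mpr (abs_ne_zero.mpr h3)
            refine (mul_eq_zero.mp ((?_ : _ = g z).trans hz)).resolve_left h4
            simp only [hg]
            ring
          · simp [hz2]
        · simp [hz1]
      · obtain ⟨h1, h2⟩ := hw1 z hz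
        have h3 : 0 < w z := by linarith
        have h4 : ∫ t in Set.Ioi (0 : ℝ), (Real.exp (-(w z * t)) : ℂ) = ((1 / w z : ℝ) : ℂ) := by
          rw [integral_complex_ofReal]
          congr 1
          have := integral_exp_mul_Ioi (a := -w z) (by linarith) 0
          simpa [neg_mul, neg_div_neg_eq] using this
        have h5 : (w z : ℂ) ≠ 0 := by exact_mod_cast h3.ne'
        rw [h4]
        simp only [hg, ← h2]
        push_cast
        field_simp
    rw [e1, ← integral_integral_swap (f := fun (t : ℝ) (z : Plane × Plane) =>
      (Real.exp (-(w z * t)) : ℂ) * g z) hfub]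
    have e2 (t : ℝ) (ht : 0 < t) :
        ∫ z : Plane × Plane, (Real.exp (-(w z * t)) : ℂ) * g z ∂(volume.prod volume) =
        ⟪φ', (mulOp (a t) * G * mulOp (b t)) ψ'⟫_ℂ := by
      rw [(hG.mulOp_mul (ham t ht) (hbm t ht)).inner_eq hφ' hψ']
      refine integral_congr_ae (ae_of_all _ fun z => ?_)
      have : Real.exp (-(w z * t)) =
          Real.exp (-(t * (σ * z.1 0))) * Real.exp (t * (σ * z.2 0)) := by
        rw [← Real.exp_add]; congr 1; simp only [hw]; ring
      simp only [this, hg, ha, hb]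
      push_cast
      ring
    have e3 (t : ℝ) (ht : 0 < t) :
        ‖∫ z : Plane × Plane, (Real.exp (-(w z * t)) : ℂ) * g z ∂(volume.prod volume)‖ ≤
        Real.exp (-(2 * R) * t) * (‖G‖ * (‖φ‖ * ‖ψ‖)) := by
      rw [e2 t ht]
      have n1 : ‖(mulOp (a t) * G * mulOp (b t)) ψ'‖ ≤
          Real.exp (-(t * R)) * (‖G‖ * (Real.exp (-(t * R)) * ‖ψ'‖)) := by
        refine (norm_mulOp_apply_le (ham t ht) (ha1 t ht) _).trans ?_
        gcongr
        refine (G.le_opNorm _).trans ?_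
        gcongr
        exact norm_mulOp_apply_le (hbm t ht) (hb1 t ht) _
      calc _ ≤ ‖φ'‖ * (Real.exp (-(t * R)) * (‖G‖ * (Real.exp (-(t * R)) * ‖ψ'‖))) :=
            (norm_inner_le_norm _ _).trans (mul_le_mul_of_nonneg_left n1 (norm_nonneg _))
        _ = Real.exp (-(t * R)) * Real.exp (-(t * R)) * (‖G‖ * (‖φ'‖ * ‖ψ'‖)) := by ring
        _ = Real.exp (-(2 * R) * t) * (‖G‖ * (‖φ'‖ * ‖ψ'‖)) := by
            rw [← Real.exp_add]; congr 2; ring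
        _ ≤ _ := by gcongr
    calc _ ≤ ∫ t in Set.Ioi (0 : ℝ), Real.exp (-(2 * R) * t) * (‖G‖ * (‖φ‖ * ‖ψ‖)) := by
          refine norm_integral_le_of_norm_le ?_ ?_
          · exact (exp_neg_integrableOn_Ioi 0 (by positivity)).mul_const _
          · exact (ae_restrict_mem measurableSet_Ioi).mono fun t ht => e3 t ht
      _ = _ := by
          rw [integral_mul_const, integral_exp_mul_Ioi (by linarith)]
          simp
          ring
  refine opNorm_le_bound _ (by positivity) fun ψ => ?_
  set S := mulOp (E.indicator 1) * V * mulOp (F.indicator 1)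
  have hlim : Tendsto (fun n => ‖⟪diskOp n (S ψ), S (diskOp n ψ)⟫_ℂ‖) atTop
      (nhds ‖⟪S ψ, S ψ⟫_ℂ‖) :=
    ((tendsto_diskOp (S ψ)).inner ((S.continuous.tendsto _).comp (tendsto_diskOp ψ))).norm
  have h1 := le_of_tendsto' hlim fun n => key n (S ψ) ψ
  rw [inner_self_eq_norm_sq_to_K, norm_pow, RCLike.norm_ofReal, abs_norm] at h1
  rcases (norm_nonneg (S ψ)).eq_or_lt with h2 | h2
  · rw [← h2]; positivity
  · refine le_of_mul_le_mul_right ?_ h2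
    calc _ = ‖S ψ‖ ^ 2 := by ring
      _ ≤ _ := h1
      _ = _ := by ring

end Kernel

/-! ### Magnetic translations and covariance -/

section Covariance

open ContinuousLinearMap

lemma isBddMeas_phase (γ : ℝ) (ξ : Plane) : IsBddMeas fun x : Plane =>
    Complex.exp (((-(γ * ξ 1 * (x 0 - ξ 0)) : ℝ) : ℂ) * Complex.I) :=
  ⟨by fun_prop, 1, fun x => (Complex.norm_exp_ofReal_mul_I _).le⟩

lemma norm_magTranslation_apply (γ : ℝ) (ξ : Plane) (ψ : L2Plane) :
    ‖magTranslation γ ξ ψ‖ = ‖ψ‖ := by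
  rw [← Lp.norm_compMeasurePreserving ψ (measurePreserving_sub_right volume ξ)]
  refine le_antisymm (Lp.norm_le_norm_of_ae_le ?_) (Lp.norm_le_norm_of_ae_le ?_)
  all_goals
    filter_upwards [magTranslation_coeFn γ ξ ψ,
      Lp.coeFn_compMeasurePreserving ψ (measurePreserving_sub_right volume ξ)] with x h1 h2
    rw [h1, h2, norm_mul, Complex.norm_exp_ofReal_mul_I, one_mul]
    rfl

lemma star_magTranslation_mul (γ : ℝ) (ξ : Plane) :
    star (magTranslation γ ξ) * magTranslation γ ξ = 1 :=
  (norm_map_iff_adjoint_comp_self _).mp (norm_magTranslation_apply γ ξ)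

lemma magTranslation_mul_star (γ : ℝ) (ξ : Plane) :
    magTranslation γ ξ * star (magTranslation γ ξ) = 1 := by
  -- the inverse undoes the phase, then the translation
  set W' : L2Plane →L[ℂ] L2Plane :=
    (Lp.compMeasurePreservingₗᵢ ℂ (fun x : Plane => x + ξ)
      (measurePreserving_add_right volume ξ)).toContinuousLinearMap ∘L
    mulOp fun x => starRingEnd ℂ
      (Complex.exp (((-(γ * ξ 1 * (x 0 - ξ 0)) : ℝ) : ℂ) * Complex.I)) with hW'
  have h : magTranslation γ ξ * W' = 1 := by
    ext1 ψ
    refine Lp.ext ?_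
    have h2 := Lp.coeFn_compMeasurePreserving (mulOp (fun x => starRingEnd ℂ
      (Complex.exp (((-(γ * ξ 1 * (x 0 - ξ 0)) : ℝ) : ℂ) * Complex.I))) ψ)
        (measurePreserving_add_right volume ξ)
    have h2' := (measurePreserving_sub_right volume ξ).quasiMeasurePreserving.ae_eq_comp h2
    filter_upwards [magTranslation_coeFn γ ξ (W' ψ), h2',
      (isBddMeas_phase γ ξ).conj.mulOp_ae ψ] with x h1 h2 h3
    change magTranslation γ ξ (W' ψ) x = ψ x
    have h4 : W' ψ (x - ξ) = mulOp (fun x => starRingEnd ℂ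
      (Complex.exp (((-(γ * ξ 1 * (x 0 - ξ 0)) : ℝ) : ℂ) * Complex.I))) ψ x := by
      refine h2.trans ?_
      simp
    rw [h1, h4, h3, ← mul_assoc, Complex.mul_conj, Complex.normSq_eq_norm_sq,
      Complex.norm_exp_ofReal_mul_I]
    simp
  have h' : W' = star (magTranslation γ ξ) := by
    rw [← one_mul W', ← star_magTranslation_mul γ ξ, mul_assoc, h, mul_one]
  rw [← h', h]

lemma mulOp_mul_magTranslation (γ : ℝ) (ξ : Plane) {a : Plane → ℂ} (ha : IsBddMeas a) :
    mulOp a * magTranslation γ ξ = magTranslation γ ξ * mulOp fun x => a (x + ξ) := by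
  ext1 ψ
  refine Lp.ext ?_
  have ha' : IsBddMeas fun x => a (x + ξ) := ha.comp (by fun_prop)
  have h3' := (measurePreserving_sub_right volume ξ).quasiMeasurePreserving.ae (ha'.mulOp_ae ψ)
  filter_upwards [ha.mulOp_ae (magTranslation γ ξ ψ), magTranslation_coeFn γ ξ ψ,
    magTranslation_coeFn γ ξ (mulOp (fun x => a (x + ξ)) ψ), h3'] with x h1 h2 h3 h4
  change mulOp a (magTranslation γ ξ ψ) x = magTranslation γ ξ (mulOp (fun x => a (x + ξ)) ψ) x
  rw [h1, h2, h3, h4, sub_add_cancel]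
  ring

lemma star_magTranslation_mul_mulOp (γ : ℝ) (ξ : Plane) {a : Plane → ℂ} (ha : IsBddMeas a) :
    star (magTranslation γ ξ) * mulOp a =
      mulOp (fun x => a (x + ξ)) * star (magTranslation γ ξ) := by
  calc _ = star (magTranslation γ ξ) * (mulOp a * magTranslation γ ξ) *
        star (magTranslation γ ξ) := by
        rw [mul_assoc, mul_assoc, magTranslation_mul_star, mul_one]
    _ = _ := by
        rw [mulOp_mul_magTranslation γ ξ ha, ← mul_assoc, star_magTranslation_mul, one_mul]

/-- Conjugation with a magnetic translation moves the weights of a localized Hilbert–Schmidt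
norm. -/
lemma hsSq_mulOp_magTranslation (γ : ℝ) (ξ : Plane) {a b : Plane → ℂ} (ha : IsBddMeas a)
    (hb : IsBddMeas b) (T : L2Plane →L[ℂ] L2Plane) :
    hsSq (mulOp a * (magTranslation γ ξ * T * star (magTranslation γ ξ)) * mulOp b) =
      hsSq (mulOp (fun x => a (x + ξ)) * T * mulOp fun x => b (x + ξ)) := by
  set W := magTranslation γ ξ
  set T' := mulOp (fun x => a (x + ξ)) * T * mulOp fun x => b (x + ξ)
  have h1 : mulOp a * (W * T * star W) * mulOp b = W * (T' * star W) := by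
    calc _ = (mulOp a * W) * T * (star W * mulOp b) := by simp only [mul_assoc]
      _ = _ := by
        rw [mulOp_mul_magTranslation γ ξ ha, star_magTranslation_mul_mulOp γ ξ hb]
        simp only [T', W, mul_assoc]
  rw [h1, hsSq_congr_norm (S := T' * star W) fun x => norm_magTranslation_apply γ ξ _,
    ← hsSq_star, star_mul, star_star,
    hsSq_congr_norm (S := star T') fun x => norm_magTranslation_apply γ ξ _, hsSq_star]

end Covariance

/-! ### Local finiteness from finite translates -/

section Translates

/-- If almost all translates of a nontrivial bounded density with compact support have finite
integral, then bounded intervals have finite measure: over a set of shifts that has almost full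
measure, the integrals of the translates are uniformly bounded. -/
lemma measure_Icc_lt_top_of_translates (ν : Measure ℝ) [SFinite ν] {ρ : ℝ → ℝ≥0∞}
    (hρ : Measurable ρ) {C : ℝ≥0∞} (hC : C ≠ ∞) (hρC : ∀ t, ρ t ≤ C) {M : ℝ}
    (hM : ∀ t, M < |t| → ρ t = 0) (hpos : ∫⁻ t, ρ t ≠ 0)
    (hfin : ∀ᵐ r, ∫⁻ x, ρ (x + r) ∂ν < ∞) (R : ℝ) : ν (Set.Icc (-R) R) < ∞ := by
  set f : ℝ → ℝ≥0∞ := fun r => ∫⁻ x, ρ (x + r) ∂ν with hf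
  have hfm : Measurable f :=
    Measurable.lintegral_prod_left' (f := fun p : ℝ × ℝ => ρ (p.1 + p.2))
      (hρ.comp (measurable_fst.add measurable_snd))
  set c := ∫⁻ t, ρ t with hc
  have hctop : c ≠ ∞ := by
    have h1 : c ≤ ∫⁻ t in Set.Icc (-M) M, C := by
      rw [← lintegral_indicator measurableSet_Icc]
      refine lintegral_mono fun t => ?_
      by_cases h : t ∈ Set.Icc (-M) M
      · simpa [h] using hρC t
      · have : M < |t| := by
          by_contra h'
          exact h (abs_le.mp (not_lt.mp h'))
        simp [hM t this]
    refine ne_top_of_le_ne_top ?_ h1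
    simp [ENNReal.mul_eq_top, hC]
  -- only shifts in `[-L, L]` matter for points of `[-R, R]`; those in `B n` are discarded
  set L := R + M
  set B : ℕ → Set ℝ := fun n => Set.Icc (-L) L ∩ {r | (n : ℝ≥0∞) < f r} with hB
  have hBm (n : ℕ) : MeasurableSet (B n) :=
    measurableSet_Icc.inter (measurableSet_lt measurable_const hfm)
  have hlim : Tendsto (fun n => C * volume (B n)) atTop (nhds 0) := by
    have h1 := tendsto_measure_iInter_atTop (μ := volume) (s := B)
      (fun n => (hBm n).nullMeasurableSet) (fun m n hmn r hr => ⟨hr.1, by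
        have h : (n : ℝ≥0∞) < f r := hr.2
        exact lt_of_le_of_lt (by exact_mod_cast hmn) h⟩)
      ⟨0, ((measure_mono Set.inter_subset_left).trans_lt (measure_Icc_lt_top)).ne⟩
    have h2 : volume (⋂ n, B n) = 0 := by
      refine measure_mono_null (t := {r | ¬ ∫⁻ x, ρ (x + r) ∂ν < ∞}) (fun r hr hr' => ?_) hfin
      obtain ⟨n, hn⟩ := ENNReal.exists_nat_gt (ne_of_lt hr')
      exact absurd (Set.mem_iInter.mp hr n).2 (not_lt.mpr hn.le)
    rw [h2] at h1
    simpa using ENNReal.Tendsto.const_mul h1 (Or.inr hC)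
  obtain ⟨n, hn⟩ := (hlim.eventually (gt_mem_nhds (ENNReal.half_pos hpos))).exists
  set A := Set.Icc (-L) L \ B n
  have hAm : MeasurableSet A := measurableSet_Icc.diff (hBm n)
  have hfA : ∫⁻ r in A, f r < ∞ := by
    calc ∫⁻ r in A, f r ≤ ∫⁻ r in A, (n : ℝ≥0∞) := by
          refine setLIntegral_mono' hAm fun r hr => ?_
          by_contra h
          exact hr.2 ⟨hr.1, not_le.mp h⟩
      _ ≤ n * volume (Set.Icc (-L) L) := by
          rw [setLIntegral_const]
          gcongr
          exact Set.sdiff_subset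
      _ < ∞ := ENNReal.mul_lt_top (by simp) measure_Icc_lt_top
  have hlow (x : ℝ) (hx : x ∈ Set.Icc (-R) R) : c / 2 ≤ ∫⁻ r in A, ρ (x + r) := by
    have h1 : c = ∫⁻ r in Set.Icc (-L) L, ρ (x + r) := by
      rw [hc, ← lintegral_add_left_eq_self ρ x, ← lintegral_indicator measurableSet_Icc]
      refine lintegral_congr fun r => ?_
      by_cases h : r ∈ Set.Icc (-L) L
      · simp [h]
      · rw [Set.indicator_of_notMem h]
        refine hM _ ?_
        by_contra h'
        refine h ?_
        have := abs_le.mp (not_lt.mp h')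
        exact ⟨by linarith [hx.2], by linarith [hx.1]⟩
    have h2 : c ≤ (∫⁻ r in A, ρ (x + r)) + C * volume (B n) := by
      calc c = ∫⁻ r in A ∪ B n, ρ (x + r) := by
            rw [h1]; congr 2
            exact (Set.sdiff_union_of_subset Set.inter_subset_left).symm
        _ ≤ (∫⁻ r in A, ρ (x + r)) + ∫⁻ r in B n, ρ (x + r) := lintegral_union_le _ _ _
        _ ≤ _ := by
            gcongr
            rw [← setLIntegral_const]
            exact lintegral_mono fun r => hρC _
    have h3 : c / 2 + c / 2 ≤ (∫⁻ r in A, ρ (x + r)) + c / 2 := by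
      rw [ENNReal.add_halves]
      exact h2.trans (by gcongr)
    exact (ENNReal.add_le_add_iff_right (ENNReal.div_ne_top hctop two_ne_zero)).mp h3
  have hint : c / 2 * ν (Set.Icc (-R) R) ≤ ∫⁻ r in A, f r := by
    calc c / 2 * ν (Set.Icc (-R) R) = ∫⁻ x in Set.Icc (-R) R, c / 2 ∂ν := by
          rw [setLIntegral_const]
      _ ≤ ∫⁻ x in Set.Icc (-R) R, ∫⁻ r in A, ρ (x + r) ∂volume ∂ν :=
          setLIntegral_mono' measurableSet_Icc hlow
      _ ≤ ∫⁻ x, ∫⁻ r in A, ρ (x + r) ∂volume ∂ν := setLIntegral_le_lintegral _ _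
      _ = _ := by
          rw [lintegral_lintegral_swap]
          exact (hρ.comp (measurable_fst.add measurable_snd)).aemeasurable
  by_contra h
  rw [not_lt, top_le_iff] at h
  rw [h, ENNReal.mul_top (ENNReal.half_pos hpos).ne', top_le_iff] at hint
  exact hfA.ne hint

end Translates

/-! ### Compressions to the half-plane -/

section Compression

open ContinuousLinearMap

section Abstract

variable {H K : Type*} [NormedAddCommGroup H] [InnerProductSpace ℂ H] [CompleteSpace H]
  [NormedAddCommGroup K] [InnerProductSpace ℂ K] [CompleteSpace K]

lemma adjoint_compression (R : H →L[ℂ] K) (U : H →L[ℂ] H) :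
    (R ∘L U ∘L R.adjoint).adjoint = R ∘L star U ∘L R.adjoint := by
  rw [adjoint_comp, adjoint_comp, adjoint_adjoint, comp_assoc]
  rfl

lemma adjoint_compression_comp {R : H →L[ℂ] K} {P Q U : H →L[ℂ] H} (hR : R ∘L R.adjoint = 1)
    (hP : R.adjoint ∘L R = P) (hPQ : P + Q = 1) (hQ : Q * Q = Q) (hQ' : star Q = Q)
    (hU : star U * U = 1) :
    (R ∘L U ∘L R.adjoint).adjoint ∘L (R ∘L U ∘L R.adjoint) =
      1 - ((Q * U) ∘L R.adjoint).adjoint ∘L ((Q * U) ∘L R.adjoint) := by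
  rw [eq_sub_iff_add_eq, adjoint_comp (Q * U), ← star_eq_adjoint (Q * U), star_mul,
    hQ', adjoint_adjoint, adjoint_compression]
  have h1 : (R ∘L star U ∘L R.adjoint) ∘L (R ∘L U ∘L R.adjoint) =
      R ∘L (star U * P * U) ∘L R.adjoint := by
    rw [← hP]; rfl
  have h2 : (R ∘L (star U * Q)) ∘L (Q * U) ∘L R.adjoint =
      R ∘L (star U * (Q * Q) * U) ∘L R.adjoint := rfl
  rw [h1, h2, hQ, ← comp_add, ← add_comp, ← add_mul, ← mul_add, hPQ, mul_one, hU, ← hR]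
  rfl

end Abstract

lemma measurableSet_halfPlane : MeasurableSet halfPlane :=
  measurableSet_lt measurable_const (by fun_prop)

/-- The projection of `L²(ℝ²)` onto the functions supported in the half-plane. -/
def halfOp : L2Plane →L[ℂ] L2Plane := mulOp (halfPlane.indicator 1)

/-- The projection of `L²(ℝ²)` onto the functions supported outside the half-plane. -/
def halfOpCompl : L2Plane →L[ℂ] L2Plane := mulOp (halfPlaneᶜ.indicator 1)

lemma isBddMeas_half : IsBddMeas (halfPlane.indicator 1) :=
  IsBddMeas.indicator measurableSet_halfPlane

lemma isBddMeas_halfCompl : IsBddMeas (halfPlaneᶜ.indicator 1) :=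
  IsBddMeas.indicator measurableSet_halfPlane.compl

lemma star_halfOp : star halfOp = halfOp := star_mulOp_indicator measurableSet_halfPlane

lemma star_halfOpCompl : star halfOpCompl = halfOpCompl :=
  star_mulOp_indicator measurableSet_halfPlane.compl

lemma halfOp_mul_self : halfOp * halfOp = halfOp := by
  rw [halfOp, mulOp_mul isBddMeas_half isBddMeas_half]
  congr 1; ext x
  by_cases h : x ∈ halfPlane <;> simp [h]

lemma halfOpCompl_mul_self : halfOpCompl * halfOpCompl = halfOpCompl := by
  rw [halfOpCompl, mulOp_mul isBddMeas_halfCompl isBddMeas_halfCompl]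
  congr 1; ext x
  by_cases h : x ∈ halfPlane <;> simp [h]

lemma halfOp_add_halfOpCompl : halfOp + halfOpCompl = 1 := by
  rw [halfOp, halfOpCompl, mulOp_add isBddMeas_half isBddMeas_halfCompl, ← mulOp_one]
  congr 1; ext x
  by_cases h : x ∈ halfPlane <;> simp [h]

lemma halfOpCompl_mul_halfOp : halfOpCompl * halfOp = 0 := by
  rw [eq_sub_iff_add_eq'.mpr halfOp_add_halfOpCompl, sub_mul, one_mul, halfOp_mul_self, sub_self]

/-- The restriction `L²(ℝ²) → L²(ℝ₊ × ℝ)`. -/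
abbrev restrictHalf : L2Plane →L[ℂ] L2Half := LpToLpRestrictCLM Plane ℂ ℂ volume 2 halfPlane

lemma adjoint_restrictHalf_comp : restrictHalf.adjoint ∘L restrictHalf = halfOp := by
  refine ContinuousLinearMap.ext fun ψ => ext_inner_left ℂ fun φ => ?_
  rw [comp_apply, adjoint_inner_right, L2.inner_def, L2.inner_def,
    ← integral_indicator measurableSet_halfPlane]
  have e1 : (∫ x in halfPlane, ⟪restrictHalf φ x, restrictHalf ψ x⟫_ℂ) =
      ∫ x in halfPlane, ⟪φ x, ψ x⟫_ℂ := by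
    refine integral_congr_ae ?_
    filter_upwards [LpToLpRestrictCLM_coeFn ℂ halfPlane φ,
      LpToLpRestrictCLM_coeFn ℂ halfPlane ψ] with x h1 h2
    rw [h1, h2]
  rw [integral_indicator measurableSet_halfPlane, e1, ← integral_indicator measurableSet_halfPlane]
  refine integral_congr_ae ?_
  filter_upwards [isBddMeas_half.mulOp_ae ψ] with x h1
  rw [halfOp, h1]
  by_cases h : x ∈ halfPlane <;> simp [h]

lemma restrictHalf_comp_adjoint : restrictHalf ∘L restrictHalf.adjoint = 1 := by
  ext1 f
  -- the extension of `f` by zero restricts to `f`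
  have hf : MemLp (halfPlane.indicator f) 2 (volume : Measure Plane) :=
    (memLp_indicator_iff_restrict measurableSet_halfPlane).mpr (Lp.memLp f)
  have hR (ψ : L2Plane) : restrictHalf (halfOp ψ) = restrictHalf ψ := by
    refine Lp.ext ?_
    filter_upwards [LpToLpRestrictCLM_coeFn ℂ halfPlane ψ,
      LpToLpRestrictCLM_coeFn ℂ halfPlane (halfOp ψ),
      ae_restrict_of_ae (isBddMeas_half.mulOp_ae ψ),
      ae_restrict_mem measurableSet_halfPlane] with x h1 h2 h3 h4
    rw [h1, h2, halfOp, h3, Set.indicator_of_mem h4]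
    simp
  have h1 : restrictHalf (hf.toLp _) = f := by
    refine Lp.ext ?_
    filter_upwards [LpToLpRestrictCLM_coeFn ℂ halfPlane (hf.toLp _),
      ae_restrict_of_ae hf.coeFn_toLp, ae_restrict_mem measurableSet_halfPlane] with x h1 h2 h3
    rw [h1, h2, Set.indicator_of_mem h3]
  rw [← h1]
  change restrictHalf ((restrictHalf.adjoint ∘L restrictHalf) _) = restrictHalf _
  rw [adjoint_restrictHalf_comp, hR]

lemma halfOp_comp_adjoint : halfOp ∘L restrictHalf.adjoint = restrictHalf.adjoint := by
  rw [← adjoint_restrictHalf_comp, comp_assoc, restrictHalf_comp_adjoint]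
  rfl

lemma norm_restrictHalf_halfOp (ψ : L2Plane) : ‖restrictHalf (halfOp ψ)‖ = ‖halfOp ψ‖ := by
  have h := congr(RCLike.re ⟪halfOp ψ, $adjoint_restrictHalf_comp (halfOp ψ)⟫_ℂ)
  rw [comp_apply, adjoint_inner_right, inner_self_eq_norm_sq] at h
  change _ = RCLike.re ⟪halfOp ψ, (halfOp * halfOp) ψ⟫_ℂ at h
  rw [halfOp_mul_self, inner_self_eq_norm_sq] at h
  exact (sq_eq_sq₀ (norm_nonneg _) (norm_nonneg _)).mp h

lemma hsSq_comp_adjoint_restrictHalf (A : L2Plane →L[ℂ] L2Plane) :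
    hsSq (A ∘L restrictHalf.adjoint) = hsSq (A * halfOp) := by
  rw [← halfOp_comp_adjoint, ← comp_assoc]
  change hsSq ((A * halfOp) ∘L restrictHalf.adjoint) = _
  rw [← hsSq_adjoint, adjoint_comp, adjoint_adjoint, ← hsSq_star (A * halfOp)]
  refine hsSq_congr_norm fun x => ?_
  rw [star_mul, star_halfOp]
  have : ((A * halfOp).adjoint) = halfOp * star A := by
    rw [← star_eq_adjoint, star_mul, star_halfOp]
  rw [comp_apply, this]
  exact norm_restrictHalf_halfOp _

variable {U : L2Plane →L[ℂ] L2Plane}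

lemma halfOpCompl_mul_mul_halfOp :
    halfOpCompl * U * halfOp = halfOpCompl * (U - 1) * halfOp := by
  rw [mul_sub, sub_mul, mul_one, halfOpCompl_mul_halfOp, sub_zero]

lemma adjoint_halfCompression :
    (halfCompression U).adjoint = halfCompression (star U) :=
  adjoint_compression restrictHalf U

/-- The defect of isometry of the compression of an isometry `U` comes from the part of `U` that
leaves the half-plane. -/
lemma adjoint_halfCompression_comp (hU : star U * U = 1) :
    (halfCompression U).adjoint ∘L halfCompression U =
      1 - ((halfOpCompl * U) ∘L restrictHalf.adjoint).adjoint ∘L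
        ((halfOpCompl * U) ∘L restrictHalf.adjoint) :=
  adjoint_compression_comp restrictHalf_comp_adjoint adjoint_restrictHalf_comp
    halfOp_add_halfOpCompl halfOpCompl_mul_self star_halfOpCompl hU

lemma halfOpCompl_mul_comp_adjoint_restrictHalf :
    (halfOpCompl * U) ∘L restrictHalf.adjoint =
      (halfOpCompl * (U - 1) * halfOp) ∘L restrictHalf.adjoint := by
  rw [← halfOpCompl_mul_mul_halfOp]
  conv_lhs => rw [← halfOp_comp_adjoint]
  rfl

lemma isFredholm_halfCompression (hU : U ∈ unitary (L2Plane →L[ℂ] L2Plane))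
    (h1 : IsCompactOperator ⇑(halfOp * (U - 1) * halfOpCompl))
    (h2 : IsCompactOperator ⇑(halfOpCompl * (U - 1) * halfOp)) :
    (halfCompression U).IsFredholm := by
  obtain ⟨hU1, hU2⟩ := Unitary.mem_iff.mp hU
  refine isFredholm_of_isCompactOperator ?_ ?_
  · rw [adjoint_halfCompression_comp hU1, sub_sub_cancel,
      halfOpCompl_mul_comp_adjoint_restrictHalf]
    have h3 : IsCompactOperator ⇑((halfOpCompl * (U - 1) * halfOp) ∘L restrictHalf.adjoint) :=
      h2.comp_clm restrictHalf.adjoint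
    exact h3.clm_comp (((halfOpCompl * (U - 1) * halfOp) ∘L restrictHalf.adjoint).adjoint)
  · have h3 := adjoint_halfCompression_comp (U := star U) (by rw [star_star]; exact hU2)
    rw [← adjoint_halfCompression, adjoint_adjoint] at h3
    rw [h3, sub_sub_cancel, halfOpCompl_mul_comp_adjoint_restrictHalf, adjoint_comp]
    have h4 : (halfOpCompl * (star U - 1) * halfOp).adjoint = halfOp * (U - 1) * halfOpCompl := by
      rw [← star_eq_adjoint]
      simp only [star_mul, star_sub, star_star, star_one, star_halfOp, star_halfOpCompl, mul_assoc]
    rw [h4]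
    have h5 : IsCompactOperator ⇑(restrictHalf.adjoint.adjoint ∘L
        (halfOp * (U - 1) * halfOpCompl)) := h1.clm_comp restrictHalf.adjoint.adjoint
    exact h5.comp_clm ((halfOpCompl * (star U - 1) * halfOp) ∘L restrictHalf.adjoint)

/-- Fedosov's formula for the compression of a unitary: the index is the difference of the flows out
of the half-plane and into it. -/
lemma fredholmIndex_halfCompression (hU : U ∈ unitary (L2Plane →L[ℂ] L2Plane))
    (hT : (halfCompression U).IsFredholm) (h2 : hsSq (halfOpCompl * (U - 1) * halfOp) < ∞) :
    (fredholmIndex (halfCompression U) : ℝ) = (hsSq (halfOpCompl * (U - 1) * halfOp)).toReal -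
      (hsSq (halfOp * (U - 1) * halfOpCompl)).toReal := by
  obtain ⟨hU1, hU2⟩ := Unitary.mem_iff.mp hU
  have h3 := adjoint_halfCompression_comp (U := star U) (by rw [star_star]; exact hU2)
  rw [← adjoint_halfCompression, adjoint_adjoint] at h3
  have e (W : L2Plane →L[ℂ] L2Plane) : hsSq ((halfOpCompl * W) ∘L restrictHalf.adjoint) =
      hsSq (halfOpCompl * (W - 1) * halfOp) := by
    rw [hsSq_comp_adjoint_restrictHalf, halfOpCompl_mul_mul_halfOp]
  have h4 := fredholmIndex_eq_hsSq_sub hT (adjoint_halfCompression_comp hU1) h3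
    (by rw [e]; exact h2)
  rw [h4, e, e, ← hsSq_star (halfOpCompl * (star U - 1) * halfOp)]
  simp only [star_mul, star_sub, star_star, star_one, star_halfOp, star_halfOpCompl, mul_assoc]

end Compression

/-! ### Compactness of the commutator with the half-plane projection -/

section Compact

open ContinuousLinearMap

/-- A norm limit of compact operators is compact. -/
lemma isCompactOperator_of_forall_norm_sub_le {T : L2Plane →L[ℂ] L2Plane} {C : ℝ}
    (h : ∀ R : ℝ, 0 < R → ∃ K : L2Plane →L[ℂ] L2Plane, IsCompactOperator K ∧ ‖T - K‖ ≤ C / R) :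
    IsCompactOperator T := by
  refine isClosed_setOfPred_isCompactOperator.closure_subset
    (Metric.mem_closure_iff.mpr fun ε hε => ?_)
  obtain ⟨R, hR0, hR⟩ : ∃ R : ℝ, 0 < R ∧ C / R < ε :=
    ((eventually_gt_atTop 0).and ((tendsto_const_nhds.div_atTop tendsto_id).eventually
      (gt_mem_nhds hε))).exists
  obtain ⟨K, hK, hTK⟩ := h R hR0
  exact ⟨K, hK, by rw [dist_eq_norm]; exact hTK.trans_lt hR⟩

/-- If `1_{|x₁| ≤ R} V` is Hilbert–Schmidt for all `R`, then the parts of `V` that connect opposite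
sides of the line `x₁ = 0` are compact: up to a Hilbert–Schmidt operator they connect half-planes at
distance `2 R`, and `norm_offDiagonal_le` applies. -/
lemma isCompactOperator_offDiagonal {U G : L2Plane →L[ℂ] L2Plane} {k : Plane → Plane → ℂ}
    (hU : U ∈ unitary (L2Plane →L[ℂ] L2Plane)) (hV : IsLocalKernel (U - 1) k)
    (hG : IsLocalKernel G fun x y => ((|x 0 - y 0| : ℝ) : ℂ) * k x y)
    (hfin : ∀ R : ℝ, hsSq (mulOp ({x : Plane | |x 0| ≤ R}.indicator 1) * (U - 1)) < ∞)
    {σ : ℝ} (hσ : |σ| = 1) {E F : Set Plane} (hEm : MeasurableSet E) (hFm : MeasurableSet F)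
    (hE : ∀ x ∈ E, 0 ≤ σ * x 0) (hF : ∀ x ∈ F, σ * x 0 ≤ 0) :
    IsCompactOperator ⇑(mulOp (E.indicator 1) * (U - 1) * mulOp (F.indicator 1)) := by
  obtain ⟨hU1, hU2⟩ := Unitary.mem_iff.mp hU
  refine isCompactOperator_of_forall_norm_sub_le (C := ‖G‖ / 2) fun R hR => ?_
  set V := U - 1
  set A := mulOp (E.indicator 1)
  set B := mulOp (F.indicator 1)
  set I := mulOp ({x : Plane | |x 0| ≤ R}.indicator 1)
  set a := mulOp ({x : Plane | R < σ * x 0}.indicator 1)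
  set b := mulOp ({x : Plane | σ * x 0 < -R}.indicator 1)
  have hIm : MeasurableSet {x : Plane | |x 0| ≤ R} := measurableSet_le (by fun_prop) (by fun_prop)
  have ham : MeasurableSet {x : Plane | R < σ * x 0} := measurableSet_lt (by fun_prop) (by fun_prop)
  have hbm : MeasurableSet {x : Plane | σ * x 0 < -R} :=
    measurableSet_lt (by fun_prop) (by fun_prop)
  have habs (x : Plane) : |x 0| = |σ * x 0| := by rw [abs_mul, hσ, one_mul]
  have hA : A = A * a + A * I := by
    have e1 := IsBddMeas.indicator hEm
    have e2 := IsBddMeas.indicator ham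
    have e3 := IsBddMeas.indicator hIm
    simp only [A, a, I]
    rw [mulOp_mul e1 e2, mulOp_mul e1 e3, mulOp_add (e1.mul e2) (e1.mul e3)]
    congr 1; ext x
    by_cases h : x ∈ E
    · have := hE x h
      by_cases h' : R < σ * x 0
      · have m1 : x ∈ {x : Plane | R < σ * x 0} := h'
        have m2 : x ∉ {x : Plane | |x 0| ≤ R} := by
          change ¬ |x 0| ≤ R
          rw [habs, abs_of_nonneg this]
          linarith
        rw [Set.indicator_of_mem h, Set.indicator_of_mem m1, Set.indicator_of_notMem m2]
        simp
      · have m1 : x ∉ {x : Plane | R < σ * x 0} := h'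
        have m2 : x ∈ {x : Plane | |x 0| ≤ R} := by
          change |x 0| ≤ R
          rw [habs, abs_of_nonneg this]
          linarith
        rw [Set.indicator_of_mem h, Set.indicator_of_notMem m1, Set.indicator_of_mem m2]
        simp
    · simp [h]
  have hB : B = b * B + I * B := by
    have e1 := IsBddMeas.indicator hFm
    have e2 := IsBddMeas.indicator hbm
    have e3 := IsBddMeas.indicator hIm
    simp only [B, b, I]
    rw [mulOp_mul e2 e1, mulOp_mul e3 e1, mulOp_add (e2.mul e1) (e3.mul e1)]
    congr 1; ext x
    by_cases h : x ∈ F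
    · have := hF x h
      by_cases h' : σ * x 0 < -R
      · have m1 : x ∈ {x : Plane | σ * x 0 < -R} := h'
        have m2 : x ∉ {x : Plane | |x 0| ≤ R} := by
          change ¬ |x 0| ≤ R
          rw [habs, abs_of_nonpos this]
          linarith
        rw [Set.indicator_of_mem h, Set.indicator_of_mem m1, Set.indicator_of_notMem m2]
        simp
      · have m1 : x ∉ {x : Plane | σ * x 0 < -R} := h'
        have m2 : x ∈ {x : Plane | |x 0| ≤ R} := by
          change |x 0| ≤ R
          rw [habs, abs_of_nonpos this]
          linarith
        rw [Set.indicator_of_mem h, Set.indicator_of_notMem m1, Set.indicator_of_mem m2]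
        simp
    · simp [h]
  -- `V 1_I` is Hilbert–Schmidt as well, as `V = - U V*`
  have hVI : hsSq (V * I) < ∞ := by
    have e1 : V * I = (-U) * star (I * V) := by
      rw [star_mul, show star I = I from star_mulOp_indicator hIm, ← mul_assoc]
      congr 1
      have e2 : -U * star V = V := by
        rw [star_sub, star_one, mul_sub, neg_mul, hU2, mul_one]
        exact neg_sub_neg _ _
      rw [e2]
    rw [e1]
    refine (hsSq_comp_le_left _ _).trans_lt ?_
    rw [hsSq_star]
    exact ENNReal.mul_lt_top (by simp) (hfin R)
  refine ⟨A * (I * V) * B + A * a * (V * I) * B, ?_, ?_⟩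
  · have c1 : IsCompactOperator ⇑(I * V) := isCompactOperator_of_hsSq_lt_top (hfin R)
    have c2 : IsCompactOperator ⇑(V * I) := isCompactOperator_of_hsSq_lt_top hVI
    have c3 : IsCompactOperator ⇑(A * (I * V)) := c1.clm_comp A
    have c4 : IsCompactOperator ⇑(A * a * (V * I)) := c2.clm_comp (A * a)
    exact (c3.comp_clm B).add (c4.comp_clm B)
  · have e1 : A * V * B - (A * (I * V) * B + A * a * (V * I) * B) = A * (a * V * b) * B := by
      have e2 : A * V * B = A * a * V * (b * B + I * B) + A * I * V * B := by
        rw [← hB]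
        conv_lhs => rw [hA]
        noncomm_ring
      rw [e2]
      noncomm_ring
    have h1 := norm_offDiagonal_le hV hG hσ hR
    have nA : ‖A‖ ≤ 1 := norm_mulOp_le (IsBddMeas.indicator hEm) (norm_indicator_one_le _)
    have nB : ‖B‖ ≤ 1 := norm_mulOp_le (IsBddMeas.indicator hFm) (norm_indicator_one_le _)
    rw [e1]
    calc ‖A * (a * V * b) * B‖ ≤ ‖A‖ * ‖a * V * b‖ * ‖B‖ :=
          (norm_mul_le _ _).trans (by gcongr; exact norm_mul_le _ _)
      _ ≤ 1 * (‖G‖ / (2 * R)) * 1 := by gcongr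
      _ = _ := by field_simp

lemma isCompactOperator_halfOp {U G : L2Plane →L[ℂ] L2Plane} {k : Plane → Plane → ℂ}
    (hU : U ∈ unitary (L2Plane →L[ℂ] L2Plane)) (hV : IsLocalKernel (U - 1) k)
    (hG : IsLocalKernel G fun x y => ((|x 0 - y 0| : ℝ) : ℂ) * k x y)
    (hfin : ∀ R : ℝ, hsSq (mulOp ({x : Plane | |x 0| ≤ R}.indicator 1) * (U - 1)) < ∞) :
    IsCompactOperator ⇑(halfOp * (U - 1) * halfOpCompl) ∧
      IsCompactOperator ⇑(halfOpCompl * (U - 1) * halfOp) := by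
  constructor
  · refine isCompactOperator_offDiagonal hU hV hG hfin (σ := 1) (by simp) measurableSet_halfPlane
      measurableSet_halfPlane.compl (fun x hx => ?_) fun x hx => ?_
    · rw [one_mul]; exact le_of_lt hx
    · rw [one_mul]; exact not_lt.mp hx
  · refine isCompactOperator_offDiagonal hU hV hG hfin (σ := -1) (by simp)
      measurableSet_halfPlane.compl measurableSet_halfPlane (fun x hx => ?_) fun x hx => ?_
    · have : x 0 ≤ 0 := not_lt.mp hx
      linarith
    · have : 0 < x 0 := hx
      linarith

end Compact

/-! ### Finiteness in strips -/

section LocallyFinite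

open ContinuousLinearMap

lemma IsLocalKernel.hsSq_mulOp_mul {V : L2Plane →L[ℂ] L2Plane} {k : Plane → Plane → ℂ}
    (hV : IsLocalKernel V k) {a b : Plane → ℂ} (ha : IsBddMeas a) (hb : IsBddMeas b) :
    hsSq (mulOp a * V * mulOp b) =
      ∫⁻ z : Plane × Plane, ‖a z.1‖ₑ ^ 2 * ‖b z.2‖ₑ ^ 2 * ‖k z.1 z.2‖ₑ ^ 2
        ∂(volume.prod volume) := by
  have hm := hV.meas.enorm.pow_const 2
  have ha' : Measurable fun z : Plane × Plane => ‖a z.1‖ₑ ^ 2 :=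
    (ha.meas.comp measurable_fst).enorm.pow_const 2
  have hb' : Measurable fun z : Plane × Plane => ‖b z.2‖ₑ ^ 2 :=
    (hb.meas.comp measurable_snd).enorm.pow_const 2
  rw [(hV.mulOp_mul ha hb).hsSq_eq, lintegral_prod (fun z : Plane × Plane =>
    ‖a z.1‖ₑ ^ 2 * ‖b z.2‖ₑ ^ 2 * ‖k z.1 z.2‖ₑ ^ 2) ((ha'.mul hb').mul hm).aemeasurable]
  refine lintegral_congr fun x => lintegral_congr fun y => ?_
  simp only [enorm_mul, mul_pow]
  ring

/-- If almost all translates of the cutoff make `V` Hilbert–Schmidt, then so does the restriction to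
any strip. -/
lemma IsLocalKernel.hsSq_strip_lt_top {V : L2Plane →L[ℂ] L2Plane} {k : Plane → Plane → ℂ}
    (hV : IsLocalKernel V k) {χ : ℝ → ℝ} (hχ_meas : Measurable χ) {C : ℝ} (hC : ∀ t, |χ t| ≤ C)
    (hχ_supp : HasCompactSupport χ) (hχ_int : ∫ t, χ t = 1)
    (h : ∀ᵐ r, hsSq (mulOp (fun x => ((χ (x 0 + r) : ℝ) : ℂ)) * V) < ∞) (R : ℝ) :
    hsSq (mulOp ({x : Plane | |x 0| ≤ R}.indicator 1) * V) < ∞ := by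
  -- `ν` is the distribution of `x₁` under the density `|k(x, y)|²`
  set ν : Measure ℝ := ((volume.prod volume).withDensity
    fun z : Plane × Plane => ‖k z.1 z.2‖ₑ ^ 2).map fun z => z.1 0 with hν
  have hm : Measurable fun z : Plane × Plane => ‖k z.1 z.2‖ₑ ^ 2 := hV.meas.enorm.pow_const 2
  have hproj : Measurable fun z : Plane × Plane => z.1 0 := by fun_prop
  have key (α : ℝ → ℝ≥0∞) (hα : Measurable α) (a : Plane → ℂ) (ha : IsBddMeas a)
      (haα : ∀ x, ‖a x‖ₑ ^ 2 = α (x 0)) : hsSq (mulOp a * V) = ∫⁻ t, α t ∂ν := by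
    have e1 : mulOp a * V = mulOp a * V * mulOp fun _ => 1 := by rw [mulOp_one, mul_one]
    rw [e1, hV.hsSq_mulOp_mul ha (IsBddMeas.const 1), hν, lintegral_map hα hproj,
      lintegral_withDensity_eq_lintegral_mul _ hm (g := fun z => α (z.1 0))
        (hα.comp hproj)]
    refine lintegral_congr fun z => ?_
    simp only [Pi.mul_apply, haα, enorm_one, one_pow, mul_one]
    exact mul_comm _ _
  have hχr (r : ℝ) : IsBddMeas fun x : Plane => ((χ (x 0 + r) : ℝ) : ℂ) :=
    IsBddMeas.ofReal (a := fun t => χ (t + r)) (by fun_prop) fun t => hC _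
  obtain ⟨M, hM⟩ := hχ_supp.isCompact.isBounded.subset_closedBall 0
  have hIm : MeasurableSet {x : Plane | |x 0| ≤ R} := measurableSet_le (by fun_prop) (by fun_prop)
  have h1 : ν (Set.Icc (-R) R) < ∞ := by
    refine measure_Icc_lt_top_of_translates ν (ρ := fun t => ‖χ t‖ₑ ^ 2)
      (hχ_meas.enorm.pow_const 2) (C := ‖C‖ₑ ^ 2) (by simp) (fun t => ?_) (M := M)
      (fun t ht => ?_) (fun h0 => ?_) (h.mono fun r hr => ?_) R
    · gcongr
      rw [← ofReal_norm, ← ofReal_norm]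
      exact ENNReal.ofReal_le_ofReal ((hC t).trans (le_abs_self C))
    · have : t ∉ tsupport χ := fun h => by
        have := hM h
        rw [mem_closedBall_zero_iff, Real.norm_eq_abs] at this
        linarith
      simp [image_eq_zero_of_notMem_tsupport this]
    · rw [lintegral_eq_zero_iff (hχ_meas.enorm.pow_const 2)] at h0
      have h2 : ∫ t, χ t = ∫ _ : ℝ, 0 := integral_congr_ae (by
        filter_upwards [h0] with t ht
        simpa using ht)
      rw [hχ_int, integral_zero] at h2
      exact one_ne_zero h2
    · rwa [key (fun t => ‖χ (t + r)‖ₑ ^ 2) (by fun_prop) _ (hχr r) fun x => ?_] at hr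
      rw [← ofReal_norm, ← ofReal_norm, Complex.norm_real]
  rw [key ((Set.Icc (-R) R).indicator 1) (measurable_one.indicator measurableSet_Icc) _
    (IsBddMeas.indicator hIm) fun x => ?_, lintegral_indicator_one measurableSet_Icc]
  · exact h1
  · by_cases hx : |x 0| ≤ R
    · have h2 : x 0 ∈ Set.Icc (-R) R := abs_le.mp hx
      have h3 : x ∈ {x : Plane | |x 0| ≤ R} := hx
      rw [Set.indicator_of_mem h2, Set.indicator_of_mem h3]
      simp
    · have h2 : x 0 ∉ Set.Icc (-R) R := fun h => hx (abs_le.mpr h)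
      have h3 : x ∉ {x : Plane | |x 0| ≤ R} := hx
      rw [Set.indicator_of_notMem h2, Set.indicator_of_notMem h3]
      simp

end LocallyFinite

/-! ### Weakly measurable families of operators -/

section WeaklyMeasurable

open ContinuousLinearMap

variable {Y : Type*} [MeasurableSpace Y] {H : Type*} [NormedAddCommGroup H]
  [InnerProductSpace ℂ H] [CompleteSpace H] [Countable (someBasisIndex H)]

/-- A family of operators with measurable matrix elements. -/
def WeaklyMeasurable (A : Y → H →L[ℂ] H) : Prop :=
  ∀ φ ψ : H, Measurable fun y => ⟪φ, A y ψ⟫_ℂ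

namespace WeaklyMeasurable

variable {A B : Y → H →L[ℂ] H}

lemma mul (hA : WeaklyMeasurable A) (hB : WeaklyMeasurable B) :
    WeaklyMeasurable fun y => A y * B y := by
  intro φ ψ
  set b := someBasis H
  have h (y) : ⟪φ, (A y * B y) ψ⟫_ℂ = ∑' i, ⟪φ, A y (b i)⟫_ℂ * ⟪b i, B y ψ⟫_ℂ := by
    have h1 := (b.hasSum_inner_mul_inner ((A y).adjoint φ) (B y ψ)).tsum_eq
    simp only [adjoint_inner_left] at h1
    exact h1.symm
  simp_rw [h]
  exact Measurable.tsum fun i => (hA _ _).mul (hB _ _)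

omit [Countable (someBasisIndex H)] [CompleteSpace H] in
lemma const (T : H →L[ℂ] H) : WeaklyMeasurable fun _ : Y => T :=
  fun _ _ => measurable_const

omit [Countable (someBasisIndex H)] in
lemma star (hA : WeaklyMeasurable A) : WeaklyMeasurable fun y => star (A y) := by
  intro φ ψ
  simp only [star_eq_adjoint, adjoint_inner_right]
  simp only [← inner_conj_symm _ ψ]
  exact Complex.continuous_conj.measurable.comp (hA ψ φ)

lemma hsSq (hA : WeaklyMeasurable A) : Measurable fun y => hsSq (A y) := by
  have h (y) : _root_.hsSq (A y) =
      ∑' i, ∑' j, ‖⟪someBasis H j, A y (someBasis H i)⟫_ℂ‖ₑ ^ 2 := by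
    simp_rw [(someBasis H).tsum_enorm_inner_sq]
    rfl
  simp_rw [h]
  exact Measurable.tsum fun i => Measurable.tsum fun j => (hA _ _).enorm.pow_const 2

lemma opTrace (hA : WeaklyMeasurable A) : Measurable fun y => opTrace (A y) :=
  Measurable.tsum fun _ => hA _ _

lemma pow (hA : WeaklyMeasurable A) (n : ℕ) : WeaklyMeasurable fun y => A y ^ n := by
  induction n with
  | zero => simpa using WeaklyMeasurable.const 1
  | succ n ih => simpa only [pow_succ] using ih.mul hA

/-- The square root of `T* T` is a uniform limit of polynomials in `T* T`. -/
lemma abs (hA : WeaklyMeasurable A) {C : ℝ} (hC : ∀ y, ‖A y‖ ≤ C) :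
    WeaklyMeasurable fun y => CFC.abs (A y) := by
  intro φ ψ
  choose p hp using fun n : ℕ => exists_polynomial_near_of_continuousOn 0 (C * C) Real.sqrt
    Real.continuous_sqrt.continuousOn (1 / (n + 1)) (by positivity)
  have hpoly (n : ℕ) : Measurable fun y =>
      ⟪φ, Polynomial.aeval (Star.star (A y) * A y) (p n) ψ⟫_ℂ := by
    simp_rw [Polynomial.aeval_eq_sum_range, sum_apply, inner_sum]
    refine Finset.measurable_fun_sum _ fun i _ => ?_
    have e (y) : ((p n).coeff i • (Star.star (A y) * A y) ^ i) ψ =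
        (((p n).coeff i : ℝ) : ℂ) • ((Star.star (A y) * A y) ^ i) ψ := by
      simp
    simp_rw [e, inner_smul_right]
    exact (((hA.star.mul hA).pow i) φ ψ).const_mul _
  refine measurable_of_tendsto_metrizable hpoly (tendsto_pi_nhds.mpr fun y => ?_)
  have hsp (x : ℝ) (hx : x ∈ spectrum ℝ (Star.star (A y) * A y)) : x ∈ Set.Icc 0 (C * C) := by
    refine ⟨spectrum_nonneg_of_nonneg (star_mul_self_nonneg (A y)) hx, ?_⟩
    have h1 : ‖x‖ ≤ ‖Star.star (A y) * A y‖ * ‖(1 : H →L[ℂ] H)‖ := by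
      simpa using spectrum.subset_closedBall_norm_mul (𝕜 := ℝ) (Star.star (A y) * A y) hx
    have h2 : ‖(1 : H →L[ℂ] H)‖ ≤ 1 := norm_id_le
    calc x ≤ ‖x‖ := le_abs_self x
      _ ≤ ‖Star.star (A y) * A y‖ * ‖(1 : H →L[ℂ] H)‖ := h1
      _ ≤ ‖Star.star (A y) * A y‖ * 1 := by gcongr
      _ = ‖A y‖ * ‖A y‖ := by rw [mul_one, CStarRing.norm_star_mul_self]
      _ ≤ C * C := mul_le_mul (hC y) (hC y) (norm_nonneg _) ((norm_nonneg _).trans (hC y))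
  have hsa : IsSelfAdjoint (Star.star (A y) * A y) := .star_mul_self _
  have habs : CFC.abs (A y) = cfc Real.sqrt (Star.star (A y) * A y) := by
    rw [CFC.abs, CFC.sqrt_eq_real_sqrt _ (star_mul_self_nonneg _),
      cfcₙ_eq_cfc (Real.continuous_sqrt.continuousOn) (by simp)]
  have hnorm (n : ℕ) : ‖Polynomial.aeval (Star.star (A y) * A y) (p n) - CFC.abs (A y)‖ ≤
      1 / (n + 1) := by
    rw [habs, ← cfc_polynomial (p n) (Star.star (A y) * A y) hsa,
      ← cfc_sub _ _ _ (by fun_prop) Real.continuous_sqrt.continuousOn]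
    exact norm_cfc_le (by positivity) fun x hx => (hp n x (hsp x hx)).le
  have hlim : Tendsto (fun n => Polynomial.aeval (Star.star (A y) * A y) (p n)) atTop
      (nhds (CFC.abs (A y))) :=
    tendsto_iff_norm_sub_tendsto_zero.mpr (squeeze_zero (fun n => norm_nonneg _) hnorm
      tendsto_one_div_add_atTop_nhds_zero_nat)
  exact tendsto_const_nhds.inner
    (((ContinuousLinearMap.apply ℂ H ψ).continuous.tendsto _).comp hlim)

lemma traceNorm (hA : WeaklyMeasurable A) {C : ℝ} (hC : ∀ y, ‖A y‖ ≤ C) :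
    Measurable fun y => traceNorm (A y) :=
  Measurable.tsum fun _ => (Complex.measurable_re.comp ((hA.abs hC) _ _)).ennreal_ofReal

lemma mulOp {a : Y → Plane → ℂ} (ha : Measurable (Function.uncurry a))
    (ha' : ∀ y, IsBddMeas (a y)) : WeaklyMeasurable fun y => mulOp (a y) := by
  intro φ ψ
  have h (y) : ⟪φ, _root_.mulOp (a y) ψ⟫_ℂ = ∫ x, starRingEnd ℂ (φ x) * (a y x * ψ x) := by
    rw [L2.inner_def]
    refine integral_congr_ae ?_
    filter_upwards [(ha' y).mulOp_ae ψ] with x hx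
    rw [hx, RCLike.inner_apply, mul_comm]
  simp_rw [h]
  have hφ := (Lp.stronglyMeasurable φ).measurable
  have hψ := (Lp.stronglyMeasurable ψ).measurable
  have : Measurable fun p : Y × Plane => starRingEnd ℂ (φ p.2) * (a p.1 p.2 * ψ p.2) :=
    (Complex.continuous_conj.measurable.comp (hφ.comp measurable_snd)).mul
      (ha.mul (hψ.comp measurable_snd))
  exact this.stronglyMeasurable.integral_prod_right.measurable

end WeaklyMeasurable

end WeaklyMeasurable

/-! ### Traces as integrals over kernels -/

section TraceFormula

open ContinuousLinearMap

/-- Polarization. -/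
lemma four_mul_opTrace_star_mul {X Z : L2Plane →L[ℂ] L2Plane} (hX : hsSq X < ∞) (hZ : hsSq Z < ∞) :
    4 * opTrace (star X * Z) = (hsSq (X + Z)).toReal - (hsSq (X + (-1 : ℂ) • Z)).toReal +
      ((hsSq (X + (-Complex.I) • Z)).toReal - (hsSq (X + Complex.I • Z)).toReal) * Complex.I := by
  have hfin (c : ℂ) : hsSq (X + c • Z) < ∞ := by
    refine (hsSq_add_le _ _).trans_lt ?_
    rw [hsSq_smul]
    exact ENNReal.mul_lt_top (by simp) (ENNReal.add_lt_top.mpr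
      ⟨hX, ENNReal.mul_lt_top (by simp) hZ⟩)
  have hsum (c : ℂ) : HasSum (fun i => ((‖(X + c • Z) (someBasis L2Plane i)‖ ^ 2 : ℝ) : ℂ))
      ((hsSq (X + c • Z)).toReal : ℂ) := by
    rw [Complex.hasSum_ofReal]
    have h1 : HasSum (fun i => (‖(X + c • Z) (someBasis L2Plane i)‖ₑ ^ 2).toReal)
        (hsSq (X + c • Z)).toReal := by
      rw [hsSq, ENNReal.tsum_toReal_eq (ENNReal.ne_top_of_tsum_ne_top (hfin c).ne)]
      exact (ENNReal.summable_toReal (hfin c).ne).hasSum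
    simpa only [ENNReal.toReal_pow, toReal_enorm] using h1
  have h := ((((hsum 1).sub (hsum (-1))).add (((hsum (-Complex.I)).sub (hsum Complex.I)).mul_right
    Complex.I))).tsum_eq
  rw [one_smul] at h
  rw [← h, opTrace, ← tsum_mul_left]
  refine tsum_congr fun i => ?_
  rw [show (star X * Z) (someBasis L2Plane i) = X.adjoint (Z (someBasis L2Plane i)) from rfl,
    adjoint_inner_right, inner_eq_sum_norm_sq_div_four]
  have e (c : ℂ) (x : L2Plane) : (X + c • Z) x = X x + c • Z x := rfl
  rw [e, e, e, neg_one_smul, neg_smul, ← sub_eq_add_neg, ← sub_eq_add_neg,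
    show (X + Z) (someBasis L2Plane i) = X (someBasis L2Plane i) + Z (someBasis L2Plane i) from rfl]
  push_cast
  simp only [RCLike.I_to_complex, Complex.coe_algebraMap]
  ring

lemma IsLocalKernel.hsSq_diskOp_lt_top {T : L2Plane →L[ℂ] L2Plane} {κ : Plane → Plane → ℂ}
    (hT : IsLocalKernel T κ) (n : ℕ) : hsSq (diskOp n * T * diskOp n) < ∞ := by
  obtain ⟨C, hC⟩ := hT.bdd n
  set B := Metric.closedBall (0 : Plane) n
  have hB : MeasurableSet B := measurableSet_closedBall
  have h1 : hsSq (diskOp n * T * diskOp n) ≤ ∫⁻ z : Plane × Plane,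
      (B ×ˢ B).indicator (fun _ => ‖C‖ₑ ^ 2) z ∂(volume.prod volume) := by
    rw [diskOp, hT.hsSq_mulOp_mul (isBddMeas_disk n) (isBddMeas_disk n)]
    refine lintegral_mono fun z => ?_
    by_cases h1 : z.1 ∈ B
    · by_cases h2 : z.2 ∈ B
      · have h3 : z ∈ B ×ˢ B := ⟨h1, h2⟩
        have h4 : ‖κ z.1 z.2‖ₑ ≤ ‖C‖ₑ := by
          rw [← ofReal_norm, ← ofReal_norm]
          exact ENNReal.ofReal_le_ofReal ((hC _ h1 _ h2).trans (le_abs_self C))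
        simp only [B] at h1 h2 h3 ⊢
        rw [Set.indicator_of_mem h1, Set.indicator_of_mem h2, Set.indicator_of_mem h3]
        simp only [Pi.one_apply, enorm_one, one_pow, one_mul]
        gcongr
      · simp [B, Set.indicator_of_notMem h2]
    · simp [B, Set.indicator_of_notMem h1]
  refine h1.trans_lt ?_
  rw [lintegral_indicator_const (hB.prod hB), Measure.prod_prod]
  exact ENNReal.mul_lt_top (by simp) (ENNReal.mul_lt_top measure_closedBall_lt_top
    measure_closedBall_lt_top)

/-- The trace of `a V* Z`, when `V` has the kernel `k` and `Z` the kernel `w k` with `w ≥ 0`. On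
disks this is the polarization identity for the Hilbert–Schmidt norms of operators with kernels
`(a(y) + c w(x, y)) k(x, y)`; the integral over the plane is a monotone limit, which the trace norm
bounds. -/
lemma opTrace_mulOp_star_mul {V Z : L2Plane →L[ℂ] L2Plane} {k : Plane → Plane → ℂ}
    {w : Plane → Plane → ℝ} (hV : IsLocalKernel V k)
    (hZ : IsLocalKernel Z fun x y => (w x y : ℂ) * k x y) (hw : ∀ x y, 0 ≤ w x y)
    (hwm : Measurable fun z : Plane × Plane => w z.1 z.2) {a : Plane → ℝ} (ha0 : ∀ x, 0 ≤ a x)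
    (ha : IsBddMeas fun x => (a x : ℂ))
    (hT : traceNorm (mulOp (fun x => (a x : ℂ)) * star V) < ∞) :
    ∫⁻ z : Plane × Plane, ENNReal.ofReal (a z.2 * w z.1 z.2) * ‖k z.1 z.2‖ₑ ^ 2
        ∂(volume.prod volume) ≤ (1 + ‖Z‖ₑ ^ 2) * traceNorm (mulOp (fun x => (a x : ℂ)) * star V) ∧
      opTrace (mulOp (fun x => (a x : ℂ)) * star V * Z) =
        ((∫⁻ z : Plane × Plane, ENNReal.ofReal (a z.2 * w z.1 z.2) * ‖k z.1 z.2‖ₑ ^ 2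
          ∂(volume.prod volume)).toReal : ℂ) := by
  set T := mulOp (fun x => (a x : ℂ)) * star V with hTdef
  set f : Plane × Plane → ℝ≥0∞ := fun z => ENNReal.ofReal (a z.2 * w z.1 z.2) * ‖k z.1 z.2‖ₑ ^ 2
    with hf
  have ham : Measurable a := by
    have := Complex.measurable_re.comp ha.meas
    simpa [Function.comp_def] using this
  have hfm : Measurable f :=
    ((ham.comp measurable_snd).mul hwm).ennreal_ofReal.mul (hV.meas.enorm.pow_const 2)
  set B : ℕ → Set Plane := fun n => Metric.closedBall (0 : Plane) n with hB
  set m : ℕ → ℝ≥0∞ := fun n => ∫⁻ z in B n ×ˢ B n, f z ∂(volume.prod volume) with hm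
  have hBm (n) : MeasurableSet (B n) := measurableSet_closedBall
  have hPs (n) : star (diskOp n) = diskOp n := star_mulOp_indicator (hBm n)
  have haa : star (mulOp fun x => (a x : ℂ)) = mulOp fun x => (a x : ℂ) := by
    rw [star_mulOp ha]; simp
  -- the trace over a disk
  have htr (n : ℕ) : opTrace (diskOp n * T * diskOp n * Z * diskOp n) = ((m n).toReal : ℂ) ∧
      m n < ∞ := by
    set X := diskOp n * V * (mulOp (fun x => (a x : ℂ)) * diskOp n) with hX
    set Y := diskOp n * Z * diskOp n with hY
    have hXk : IsLocalKernel X fun x y => (B n).indicator 1 x * k x y *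
        (a y * (B n).indicator 1 y) := by
      rw [hX, diskOp, mulOp_mul ha (isBddMeas_disk n)]
      exact hV.mulOp_mul (isBddMeas_disk n) (ha.mul (isBddMeas_disk n))
    have hYk : IsLocalKernel Y fun x y => (B n).indicator 1 x * ((w x y : ℂ) * k x y) *
        (B n).indicator 1 y := hZ.mulOp_mul (isBddMeas_disk n) (isBddMeas_disk n)
    have hYf : hsSq Y < ∞ := hZ.hsSq_diskOp_lt_top n
    have hXf : hsSq X < ∞ := by
      have : X = (diskOp n * V * diskOp n) ∘L mulOp (fun x => (a x : ℂ)) := by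
        rw [hX, diskOp, mulOp_mul ha (isBddMeas_disk n)]
        change _ = mulOp _ * V * mulOp _ * mulOp _
        rw [mul_assoc _ _ (mulOp fun x => (a x : ℂ)), mulOp_mul (isBddMeas_disk n) ha]
        congr 2
        ext x
        ring
      rw [this]
      exact (hsSq_comp_le_right _ _).trans_lt
        (ENNReal.mul_lt_top (by simp) (hV.hsSq_diskOp_lt_top n))
    have hprod : diskOp n * T * diskOp n * Z * diskOp n = star X * Y := by
      have e1 : diskOp n * diskOp n = diskOp n := by
        rw [diskOp, mulOp_mul (isBddMeas_disk n) (isBddMeas_disk n)]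
        congr 1; ext x
        by_cases h : x ∈ Metric.closedBall (0 : Plane) n <;> simp [h]
      rw [hX, hY]
      simp only [star_mul, hPs, haa, hTdef, mul_assoc]
      rw [← mul_assoc (diskOp n) (diskOp n), e1]
    have hcomb (c : ℂ) : hsSq (X + c • Y) = ∫⁻ z in B n ×ˢ B n,
        ‖(a z.2 : ℂ) + c * w z.1 z.2‖ₑ ^ 2 * ‖k z.1 z.2‖ₑ ^ 2 ∂(volume.prod volume) := by
      have h1 := hXk.add (hYk.smul c)
      rw [h1.hsSq_eq, ← lintegral_indicator ((hBm n).prod (hBm n)), lintegral_prod]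
      · refine lintegral_congr fun x => lintegral_congr fun y => ?_
        by_cases hx : x ∈ B n
        · by_cases hy : y ∈ B n
          · have hxy : (x, y) ∈ B n ×ˢ B n := ⟨hx, hy⟩
            rw [Set.indicator_of_mem hxy, Set.indicator_of_mem hx, Set.indicator_of_mem hy,
              ← mul_pow, ← enorm_mul]
            congr 2
            simp only [Pi.one_apply]
            ring
          · have hxy : (x, y) ∉ B n ×ˢ B n := fun h => hy h.2
            rw [Set.indicator_of_notMem hxy, Set.indicator_of_notMem hy]
            simp
        · have hxy : (x, y) ∉ B n ×ˢ B n := fun h => hx h.1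
          rw [Set.indicator_of_notMem hxy, Set.indicator_of_notMem hx]
          simp
      · refine (Measurable.indicator ?_ ((hBm n).prod (hBm n))).aemeasurable
        have h2 : Measurable fun z : Plane × Plane => ((a z.2 : ℂ) + c * w z.1 z.2) :=
          (Complex.measurable_ofReal.comp (ham.comp measurable_snd)).add
            ((Complex.measurable_ofReal.comp hwm).const_mul c)
        exact (h2.enorm.pow_const 2).mul (hV.meas.enorm.pow_const 2)
    have h1 : hsSq (X + Y) = hsSq (X + (-1 : ℂ) • Y) + 4 * m n := by
      have h0 := hcomb 1
      rw [one_smul] at h0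
      rw [h0, hcomb, hm, ← lintegral_const_mul _ hfm, ← lintegral_add_right _ (hfm.const_mul 4)]
      refine lintegral_congr fun z => ?_
      simp only [hf]
      rw [← mul_assoc, ← add_mul]
      congr 1
      have e1 (r : ℝ) : ‖(r : ℂ)‖ₑ ^ 2 = ENNReal.ofReal (r ^ 2) := by
        rw [← ofReal_norm, Complex.norm_real, ← ENNReal.ofReal_pow (norm_nonneg _),
          Real.norm_eq_abs, sq_abs]
      have e2 : (a z.2 : ℂ) + 1 * w z.1 z.2 = ((a z.2 + w z.1 z.2 : ℝ) : ℂ) := by push_cast; ring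
      have e3 : (a z.2 : ℂ) + -1 * w z.1 z.2 = ((a z.2 - w z.1 z.2 : ℝ) : ℂ) := by push_cast; ring
      rw [e2, e3, e1, e1, show (4 : ℝ≥0∞) = ENNReal.ofReal 4 by simp,
        ← ENNReal.ofReal_mul (by norm_num), ← ENNReal.ofReal_add (by positivity)
          (mul_nonneg (by norm_num) (mul_nonneg (ha0 _) (hw _ _)))]
      congr 1
      ring
    have h2 : hsSq (X + (-Complex.I) • Y) = hsSq (X + Complex.I • Y) := by
      rw [hcomb, hcomb]
      refine lintegral_congr fun z => ?_
      congr 2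
      rw [← ofReal_norm, ← ofReal_norm, ← RCLike.norm_conj]
      simp
    have hfin : hsSq (X + Y) < ∞ := (hsSq_add_le _ _).trans_lt
      (ENNReal.mul_lt_top (by simp) (ENNReal.add_lt_top.mpr ⟨hXf, hYf⟩))
    have hmf : 4 * m n < ∞ := lt_of_le_of_lt (by rw [h1]; exact le_add_self) hfin
    have hmf' : m n < ∞ := by
      refine lt_of_le_of_lt ?_ hmf
      calc m n = 1 * m n := (one_mul _).symm
        _ ≤ 4 * m n := by gcongr; norm_num
    refine ⟨?_, hmf'⟩
    have h3 := four_mul_opTrace_star_mul hXf hYf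
    have h4 : hsSq (X + (-1 : ℂ) • Y) < ∞ := lt_of_le_of_lt (by rw [h1]; exact le_self_add) hfin
    rw [h2, sub_self, zero_mul, add_zero, h1, ENNReal.toReal_add h4.ne hmf.ne,
      ENNReal.toReal_mul] at h3
    rw [hprod]
    push_cast at h3
    have h5 : (4 : ℂ) * opTrace (star X * Y) = 4 * ((m n).toReal : ℂ) := by
      rw [h3]; simp
    exact mul_left_cancel₀ (by norm_num) h5
  -- it is bounded by the trace norm, uniformly in the radius
  have hbound (n : ℕ) : m n ≤ (1 + ‖Z‖ₑ ^ 2) * traceNorm T := by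
    have nP : ‖diskOp n‖ₑ ≤ 1 := by
      rw [← ofReal_norm]
      simpa using ENNReal.ofReal_le_ofReal (norm_diskOp_le n)
    have h1 : m n = ‖opTrace (diskOp n * T * diskOp n * Z * diskOp n)‖ₑ := by
      rw [(htr n).1, ← ofReal_norm, Complex.norm_real, Real.norm_of_nonneg ENNReal.toReal_nonneg,
        ENNReal.ofReal_toReal (htr n).2.ne]
    have h2 : opTrace (diskOp n * T * diskOp n * Z * diskOp n) =
        ∑' i, ⟪diskOp n (someBasis L2Plane i),
          T ((diskOp n * Z * diskOp n) (someBasis L2Plane i))⟫_ℂ := by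
      refine tsum_congr fun i => ?_
      conv_rhs => rw [← hPs n, star_eq_adjoint, adjoint_inner_left, ← star_eq_adjoint, hPs n]
      rfl
    have h3 : ‖diskOp n * Z * diskOp n‖ₑ ≤ ‖Z‖ₑ := by
      rw [← ofReal_norm, ← ofReal_norm]
      refine ENNReal.ofReal_le_ofReal ?_
      calc ‖diskOp n * Z * diskOp n‖ ≤ ‖diskOp n‖ * ‖Z‖ * ‖diskOp n‖ :=
            (norm_mul_le _ _).trans (by gcongr; exact norm_mul_le _ _)
        _ ≤ 1 * ‖Z‖ * 1 := by gcongr <;> exact norm_diskOp_le n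
        _ = ‖Z‖ := by simp
    rw [h1, h2]
    refine enorm_tsum_le_tsum_enorm.trans ((tsum_enorm_inner_le _ _ _).trans ?_)
    gcongr
    calc ‖diskOp n‖ₑ ^ 2 ≤ 1 ^ 2 := by gcongr
      _ = 1 := one_pow 2
  have hmono : Monotone fun n => B n ×ˢ B n := fun i j hij => by
    have : B i ⊆ B j := Metric.closedBall_subset_closedBall (by exact_mod_cast hij)
    exact Set.prod_mono this this
  have hUn : ⋃ n, B n ×ˢ B n = Set.univ := by
    refine Set.eq_univ_of_forall fun z => Set.mem_iUnion.mpr ?_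
    obtain ⟨n, hn⟩ := exists_nat_ge (max ‖z.1‖ ‖z.2‖)
    exact ⟨n, by simpa [hB] using (le_max_left _ _).trans hn,
      by simpa [hB] using (le_max_right _ _).trans hn⟩
  have hsup : ∫⁻ z, f z ∂(volume.prod volume) = ⨆ n, m n := by
    rw [← setLIntegral_univ, ← hUn, setLIntegral_iUnion_of_directed _ hmono.directed_le]
  have hle : ∫⁻ z, f z ∂(volume.prod volume) ≤ (1 + ‖Z‖ₑ ^ 2) * traceNorm T := by
    rw [hsup]
    exact iSup_le hbound
  refine ⟨hle, ?_⟩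
  have hlt : ∫⁻ z, f z ∂(volume.prod volume) < ∞ :=
    hle.trans_lt (ENNReal.mul_lt_top (by simp) hT)
  have hlim1 : Tendsto m atTop (nhds (∫⁻ z, f z ∂(volume.prod volume))) := by
    rw [hsup]
    exact tendsto_atTop_iSup fun i j hij => lintegral_mono_set (hmono hij)
  have hlim2 := (Complex.continuous_ofReal.tendsto _).comp
    ((ENNReal.tendsto_toReal hlt.ne).comp hlim1)
  have hlim3 := tendsto_opTrace_compress hT (P := diskOp) norm_diskOp_le tendsto_diskOp (Z := Z)
  exact tendsto_nhds_unique hlim3 (hlim2.congr fun n => ((htr n).1).symm)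

end TraceFormula

/-! ### Families over the hull -/

section Families

open ContinuousLinearMap

variable {Ω : Type*} [TopologicalSpace Ω] [MeasurableSpace Ω]

omit [MeasurableSpace Ω] in
/-- A weakly continuous family over a compact space is bounded, by the uniform boundedness
principle applied twice. -/
lemma exists_forall_norm_le_of_continuous_inner [CompactSpace Ω] {A : Ω → L2Plane →L[ℂ] L2Plane}
    (hA : ∀ φ ψ : L2Plane, Continuous fun ω => ⟪φ, A ω ψ⟫_ℂ) : ∃ C, ∀ ω, ‖A ω‖ ≤ C := by
  refine banach_steinhaus fun ψ => ?_
  obtain ⟨C, hC⟩ := banach_steinhaus (g := fun ω => innerSL ℂ (A ω ψ)) fun φ => by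
    obtain ⟨C, hC⟩ := (isCompact_univ (X := Ω)).exists_bound_of_continuousOn (hA φ ψ).continuousOn
    refine ⟨C, fun ω => ?_⟩
    rw [innerSL_apply_apply, ← inner_conj_symm, RCLike.norm_conj]
    exact hC ω trivial
  exact ⟨C, fun ω => by simpa using hC ω⟩

omit [TopologicalSpace Ω] [MeasurableSpace Ω] in
/-- The kernel of `∇₁ U` is `i (x₁ - y₁) k(x, y)`, if `k` is the kernel of `U - 1`. -/
lemma IsNablaOne.isLocalKernel {U D : Hull Ω → L2Plane →L[ℂ] L2Plane} (hD : IsNablaOne U D)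
    {k : Hull Ω → Plane → Plane → ℂ} (hk : ∀ p, IsLocalKernel (U p - 1) (k p)) (p : Hull Ω) :
    IsLocalKernel (D p) fun x y => Complex.I * ((x 0 - y 0 : ℝ) : ℂ) * k p x y where
  meas := by
    have h1 : Measurable fun z : Plane × Plane => Complex.I * ((z.1 0 - z.2 0 : ℝ) : ℂ) := by
      fun_prop
    exact h1.mul (hk p).meas
  bdd n := by
    obtain ⟨C, hC⟩ := (hk p).bdd n
    refine ⟨(n + n) * C, fun x hx y hy => ?_⟩
    have h1 (z : Plane) (hz : z ∈ Metric.closedBall (0 : Plane) n) : |z 0| ≤ n :=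
      (PiLp.norm_apply_le z 0).trans (mem_closedBall_zero_iff.mp hz)
    rw [norm_mul, norm_mul, Complex.norm_I, one_mul, Complex.norm_real, Real.norm_eq_abs]
    have h2 : |x 0 - y 0| ≤ n + n := (abs_sub _ _).trans (add_le_add (h1 x hx) (h1 y hy))
    gcongr
    exact hC x hx y hy
  apply n ψ hψ := by
    -- the function `X₁ ψ`
    have hc : IsBddMeas fun x : Plane =>
        (x 0 : ℂ) * (Metric.closedBall (0 : Plane) n).indicator 1 x := by
      refine ⟨Measurable.mul (by fun_prop) (isBddMeas_disk n).meas, n, fun x => ?_⟩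
      by_cases hx : x ∈ Metric.closedBall (0 : Plane) n
      · have : |x 0| ≤ n := (PiLp.norm_apply_le x 0).trans (mem_closedBall_zero_iff.mp hx)
        simpa [hx] using this
      · simp [hx]
    set φ := mulOp (fun x : Plane =>
      (x 0 : ℂ) * (Metric.closedBall (0 : Plane) n).indicator 1 x) ψ with hφ
    have hφψ : ∀ᵐ x, φ x = (x 0 : ℂ) * ψ x := by
      filter_upwards [hc.mulOp_ae ψ, hψ] with x h1 h2
      rw [hφ, h1]
      by_cases hx : x ∈ Metric.closedBall (0 : Plane) n
      · simp [hx]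
      · simp [h2 hx]
    have hφ0 : ∀ᵐ x, x ∉ Metric.closedBall (0 : Plane) n → φ x = 0 := by
      filter_upwards [hφψ, hψ] with x h1 h2 h3
      rw [h1, h2 h3, mul_zero]
    have hU (η : L2Plane) : ∀ᵐ x, U p η x = (U p - 1) η x + η x := by
      have : U p η = (U p - 1) η + η := by simp
      rw [this]
      exact Lp.coeFn_add _ _
    filter_upwards [hD p ψ φ hφψ, hU ψ, hU φ, (hk p).apply n ψ hψ, (hk p).apply n φ hφ0, hφψ]
      with x h1 h2 h3 h4 h5 h6
    rw [h1, h2, h3, h4, h5, h6]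
    have h7 := (hk p).integrable x hψ
    have h8 := (hk p).integrable x hφ0
    calc _ = Complex.I * ((x 0 : ℂ) * (∫ y, k p x y * ψ y) - ∫ y, k p x y * φ y) := by ring
      _ = ∫ y, Complex.I * ((x 0 : ℂ) * (k p x y * ψ y) - k p x y * φ y) := by
          rw [integral_const_mul, integral_sub (h7.const_mul _) h8, integral_const_mul]
      _ = _ := by
          refine integral_congr_ae ?_
          filter_upwards [hφψ] with y hy
          rw [hy]
          push_cast
          ring

end Families

/-! ### The flow densities -/

section IndexDensity

open ContinuousLinearMap

variable {U D G : L2Plane →L[ℂ] L2Plane} {k : Plane → Plane → ℂ} {χ : ℝ → ℝ}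

/-- The density `∫∫ χ(y₁) (x₁ - y₁)₊ |k(x, y)|² dx dy` (for `σ = 1`) of the flow across a line to
the right, and of the flow to the left (for `σ = -1`). -/
def flowDensity (χ : ℝ → ℝ) (k : Plane → Plane → ℂ) (σ : ℝ) : ℝ≥0∞ :=
  ∫⁻ z : Plane × Plane, ENNReal.ofReal (χ (z.2 0) * max (σ * (z.1 0 - z.2 0)) 0) *
    ‖k z.1 z.2‖ₑ ^ 2 ∂(volume.prod volume)

lemma cutoffOp_mul_star (hU : U ∈ unitary (L2Plane →L[ℂ] L2Plane)) :
    cutoffOp χ * star (U - 1) = cutoffOp χ * (U - 1) * (-star U) := by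
  obtain ⟨-, hU2⟩ := Unitary.mem_iff.mp hU
  rw [mul_assoc, mul_neg, sub_mul, hU2, one_mul, neg_sub, star_sub, star_one]

lemma enorm_le_one_of_unitary (hU : U ∈ unitary (L2Plane →L[ℂ] L2Plane)) : ‖U‖ₑ ≤ 1 := by
  rw [← ofReal_norm]
  have h : ‖U‖ ≤ 1 := by
    rw [← one_mul U, CStarRing.norm_mul_mem_unitary 1 hU]
    exact norm_id_le
  simpa using ENNReal.ofReal_le_ofReal h

/-- Because `V* = - V U*` for `V = U - 1`, the cutoff of `V*` is traceclass along with that of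
`V`. -/
lemma traceNorm_cutoffOp_mul_star_le (hU : U ∈ unitary (L2Plane →L[ℂ] L2Plane)) :
    traceNorm (cutoffOp χ * star (U - 1)) ≤ 2 * traceNorm (cutoffOp χ * (U - 1)) := by
  rw [cutoffOp_mul_star hU]
  refine (traceNorm_mul_le _ _).trans ?_
  have h : ‖-star U‖ₑ ≤ 1 := by
    rw [enorm_neg]; exact enorm_le_one_of_unitary (Unitary.star_mem hU)
  gcongr
  calc 1 + ‖-star U‖ₑ ^ 2 ≤ 1 + 1 ^ 2 := by gcongr
    _ = 2 := by norm_num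

/-- With `G_σ = (|∇₁| U - i σ ∇₁ U) / 2`, whose kernel is `(σ (x₁ - y₁))₊ k(x, y)`, the trace of
`χ (U - 1)* G_σ` is the density `flowDensity χ k σ`. -/
lemma flowDensity_le (hU : U ∈ unitary (L2Plane →L[ℂ] L2Plane)) (hV : IsLocalKernel (U - 1) k)
    (hD : IsLocalKernel D fun x y => Complex.I * ((x 0 - y 0 : ℝ) : ℂ) * k x y)
    (hG : IsLocalKernel G fun x y => ((|x 0 - y 0| : ℝ) : ℂ) * k x y)
    (hχ : IsBddMeas fun x : Plane => ((χ (x 0) : ℝ) : ℂ)) (hχ0 : ∀ t, 0 ≤ χ t) {σ : ℝ}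
    (hσ : σ = 1 ∨ σ = -1) (hT : traceNorm (cutoffOp χ * (U - 1)) < ∞) :
    flowDensity χ k σ ≤ (1 + ‖(1 / 2 : ℂ) • G + (-(σ * Complex.I) / 2) • D‖ₑ ^ 2) *
        (2 * traceNorm (cutoffOp χ * (U - 1))) ∧
      opTrace (cutoffOp χ * star (U - 1) * ((1 / 2 : ℂ) • G + (-(σ * Complex.I) / 2) • D)) =
        ((flowDensity χ k σ).toReal : ℂ) := by
  have hT' := traceNorm_cutoffOp_mul_star_le (χ := χ) hU
  have hZ : IsLocalKernel ((1 / 2 : ℂ) • G + (-(σ * Complex.I) / 2) • D)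
      fun x y => ((max (σ * (x 0 - y 0)) 0 : ℝ) : ℂ) * k x y := by
    convert (hG.smul (1 / 2)).add (hD.smul (-(σ * Complex.I) / 2)) using 3 with x y
    have e : max (σ * (x 0 - y 0)) 0 = (|x 0 - y 0| + σ * (x 0 - y 0)) / 2 := by
      have : |x 0 - y 0| = |σ * (x 0 - y 0)| := by
        rcases hσ with rfl | rfl <;> simp [abs_sub_comm]
      rw [this]
      rcases le_total 0 (σ * (x 0 - y 0)) with h | h
      · rw [max_eq_left h, abs_of_nonneg h]; ring
      · rw [max_eq_right h, abs_of_nonpos h]; ring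
    rw [e]
    push_cast
    linear_combination ((σ * (x 0 - y 0) * k x y) / 2 : ℂ) * Complex.I_mul_I
  have h := opTrace_mulOp_star_mul hV hZ (fun x y => le_max_right _ _)
    (by fun_prop) (a := fun x => χ (x 0)) (fun x => hχ0 _) hχ
    (hT'.trans_lt (ENNReal.mul_lt_top (by simp) hT))
  refine ⟨h.1.trans ?_, h.2⟩
  gcongr
  exact hT'

/-- The index density is the difference of the flows to the left and to the right, as
`i ∇₁ U = G₋ - G₊` for the operators `G_σ` of `flowDensity_le`. -/
lemma I_mul_opTrace_eq (hU : U ∈ unitary (L2Plane →L[ℂ] L2Plane)) (hV : IsLocalKernel (U - 1) k)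
    (hD : IsLocalKernel D fun x y => Complex.I * ((x 0 - y 0 : ℝ) : ℂ) * k x y)
    (hG : IsLocalKernel G fun x y => ((|x 0 - y 0| : ℝ) : ℂ) * k x y)
    (hχ : IsBddMeas fun x : Plane => ((χ (x 0) : ℝ) : ℂ)) (hχ0 : ∀ t, 0 ≤ χ t)
    (hT : traceNorm (cutoffOp χ * (U - 1)) < ∞) :
    Complex.I * opTrace (cutoffOp χ * ((star U - 1) * D)) =
      ((flowDensity χ k (-1)).toReal : ℂ) - ((flowDensity χ k 1).toReal : ℂ) := by
  set T := cutoffOp χ * star (U - 1) with hTdef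
  have hT' : traceNorm T < ∞ := (traceNorm_cutoffOp_mul_star_le (χ := χ) hU).trans_lt
    (ENNReal.mul_lt_top (by simp) hT)
  rw [← (flowDensity_le hU hV hD hG hχ hχ0 (σ := -1) (Or.inr rfl) hT).2,
    ← (flowDensity_le hU hV hD hG hχ hχ0 (σ := 1) (Or.inl rfl) hT).2]
  have hsum (Z : L2Plane →L[ℂ] L2Plane) :
      Summable fun i => ⟪someBasis L2Plane i, (T * Z) (someBasis L2Plane i)⟫_ℂ := by
    refine Summable.of_enorm ?_
    have h1 := tsum_enorm_inner_le 1 T Z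
    exact (h1.trans_lt (ENNReal.mul_lt_top (by simp) hT')).ne
  have e : Complex.I • (T * D) = T * ((1 / 2 : ℂ) • G + (-((-1 : ℝ) * Complex.I) / 2) • D) -
      T * ((1 / 2 : ℂ) • G + (-((1 : ℝ) * Complex.I) / 2) • D) := by
    rw [← mul_sub, add_sub_add_left_eq_sub, ← sub_smul, mul_smul_comm]
    congr 1
    push_cast
    ring
  have e2 : cutoffOp χ * ((star U - 1) * D) = T * D := by
    rw [hTdef, star_sub, star_one, mul_assoc]
  rw [e2]
  unfold opTrace
  rw [← (hsum _).tsum_sub (hsum _), ← tsum_mul_left]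
  refine tsum_congr fun i => ?_
  have h3 := congr(⟪someBasis L2Plane i, $e (someBasis L2Plane i)⟫_ℂ)
  rw [smul_apply, inner_smul_right, sub_apply, inner_sub_right] at h3
  exact h3

end IndexDensity

/-! ### Averages over the hull -/

section Crossing

open ContinuousLinearMap

/-- The weight `1_F(y₁) χ(y₁ - r)^(1/2)`; these weights, squared and integrated over `r`, give
`1_F`. -/
def sliceWeight (χ : ℝ → ℝ) (F : Set ℝ) (r : ℝ) (x : Plane) : ℂ :=
  F.indicator 1 (x 0) * ((√(χ (x 0 - r)) : ℝ) : ℂ)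

variable {χ : ℝ → ℝ} {E F : Set ℝ}

lemma measurable_sliceWeight (hχ : Measurable χ) (hF : MeasurableSet F) :
    Measurable (Function.uncurry (sliceWeight χ F)) := by
  have h1 : Measurable fun p : ℝ × Plane => F.indicator (1 : ℝ → ℂ) (p.2 0) :=
    (measurable_one.indicator hF).comp (by fun_prop)
  have h2 : Measurable fun p : ℝ × Plane => ((√(χ (p.2 0 - p.1)) : ℝ) : ℂ) := by fun_prop
  exact h1.mul h2

lemma isBddMeas_indicator_fst (hE : MeasurableSet E) :
    IsBddMeas fun x : Plane => E.indicator (1 : ℝ → ℂ) (x 0) := by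
  refine ⟨(measurable_one.indicator hE).comp (by fun_prop), 1, fun x => ?_⟩
  by_cases h : x 0 ∈ E <;> simp [h]

lemma isBddMeas_sliceWeight (hχ : Measurable χ) (hF : MeasurableSet F) {C : ℝ}
    (hC : ∀ t, χ t ≤ C) (r : ℝ) : IsBddMeas (sliceWeight χ F r) := by
  refine (isBddMeas_indicator_fst hF).mul (IsBddMeas.ofReal (a := fun t => √(χ (t - r)))
    (by fun_prop) (C := √C) fun t => ?_)
  rw [abs_of_nonneg (Real.sqrt_nonneg _)]
  exact Real.sqrt_le_sqrt (hC _)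

lemma enorm_sliceWeight_sq (hχ0 : ∀ t, 0 ≤ χ t) (r : ℝ) (x : Plane) :
    ‖sliceWeight χ F r x‖ₑ ^ 2 = F.indicator 1 (x 0) * ENNReal.ofReal (χ (x 0 - r)) := by
  rw [sliceWeight, enorm_mul, mul_pow]
  congr 1
  · by_cases h : x 0 ∈ F <;> simp [h]
  · rw [← ofReal_norm, Complex.norm_real, Real.norm_of_nonneg (Real.sqrt_nonneg _),
      ← ENNReal.ofReal_pow (Real.sqrt_nonneg _), Real.sq_sqrt (hχ0 _)]

lemma enorm_indicator_fst_sq (t : ℝ) :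
    ‖E.indicator (1 : ℝ → ℂ) t‖ₑ ^ 2 = E.indicator 1 t := by
  by_cases h : t ∈ E <;> simp [h]

lemma lintegral_ofReal_cutoff_sub (hχ0 : ∀ t, 0 ≤ χ t) (hχ_int : ∫ t, χ t = 1) (t : ℝ) :
    ∫⁻ r, ENNReal.ofReal (χ (t - r)) = 1 := by
  have hi : Integrable χ := by
    by_contra h
    rw [integral_undef h] at hχ_int
    exact zero_ne_one hχ_int
  rw [lintegral_sub_left_eq_self (fun s => ENNReal.ofReal (χ s)) t,
    ← ofReal_integral_eq_lintegral_ofReal hi (ae_of_all _ hχ0), hχ_int, ENNReal.ofReal_one]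

namespace IsLocalKernel

variable {V : L2Plane →L[ℂ] L2Plane} {k : Plane → Plane → ℂ}

/-- The transport from `F` to `E`, decomposed by the position of the starting point. -/
lemma hsSq_eq_lintegral_slice (hV : IsLocalKernel V k) (hχ : Measurable χ) (hχ0 : ∀ t, 0 ≤ χ t)
    {C : ℝ} (hC : ∀ t, χ t ≤ C) (hχ_int : ∫ t, χ t = 1) (hE : MeasurableSet E)
    (hF : MeasurableSet F) :
    hsSq (mulOp (fun x => E.indicator 1 (x 0)) * V * mulOp fun x => F.indicator 1 (x 0)) =
      ∫⁻ r, hsSq (mulOp (fun x => E.indicator 1 (x 0)) * V * mulOp (sliceWeight χ F r)) := by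
  have hE' := isBddMeas_indicator_fst hE
  have hF' := isBddMeas_indicator_fst hF
  simp_rw [fun r => hV.hsSq_mulOp_mul hE' (isBddMeas_sliceWeight hχ hF hC r),
    enorm_sliceWeight_sq hχ0, enorm_indicator_fst_sq]
  rw [hV.hsSq_mulOp_mul hE' hF', lintegral_lintegral_swap]
  · refine lintegral_congr fun z => ?_
    simp_rw [enorm_indicator_fst_sq]
    have e (r : ℝ) : E.indicator 1 (z.1 0) * (F.indicator 1 (z.2 0) *
        ENNReal.ofReal (χ (z.2 0 - r))) * ‖k z.1 z.2‖ₑ ^ 2 =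
        E.indicator 1 (z.1 0) * F.indicator 1 (z.2 0) * ‖k z.1 z.2‖ₑ ^ 2 *
          ENNReal.ofReal (χ (z.2 0 - r)) := by ring
    simp_rw [e]
    rw [lintegral_const_mul _ (by fun_prop), lintegral_ofReal_cutoff_sub hχ0 hχ_int, mul_one]
  · have h1 : Measurable fun t : ℝ => E.indicator (1 : ℝ → ℝ≥0∞) t := measurable_one.indicator hE
    have h2 : Measurable fun t : ℝ => F.indicator (1 : ℝ → ℝ≥0∞) t := measurable_one.indicator hF
    have h3 : Measurable fun z : Plane × Plane => ‖k z.1 z.2‖ₑ ^ 2 := hV.meas.enorm.pow_const 2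
    refine Measurable.aemeasurable ?_
    refine Measurable.mul (Measurable.mul ?_ (Measurable.mul ?_ ?_)) ?_
    · exact h1.comp (by fun_prop)
    · exact h2.comp (by fun_prop)
    · fun_prop
    · exact h3.comp measurable_snd

/-- When `E` and `F` are shifted together with the slice, the slice comes to rest at the origin, and
the integral over `r` counts the translates of `E` and `F` that contain the two given points. -/
lemma lintegral_hsSq_shifted_slice (hV : IsLocalKernel V k) (hχ : Measurable χ)
    (hχ0 : ∀ t, 0 ≤ χ t) {C : ℝ} (hC : ∀ t, χ t ≤ C) (hE : MeasurableSet E)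
    (hF : MeasurableSet F) :
    ∫⁻ r, hsSq (mulOp (fun x => E.indicator 1 ((x + !₂[r, 0]) 0)) * V *
        mulOp fun x => sliceWeight χ F r (x + !₂[r, 0])) =
      ∫⁻ z : Plane × Plane, ENNReal.ofReal (χ (z.2 0)) *
        volume {r : ℝ | z.1 0 + r ∈ E ∧ z.2 0 + r ∈ F} * ‖k z.1 z.2‖ₑ ^ 2
          ∂(volume.prod volume) := by
  have hE' (r : ℝ) := (isBddMeas_indicator_fst hE).comp (T := fun x => x + !₂[r, 0]) (by fun_prop)
  have hF' (r : ℝ) := (isBddMeas_sliceWeight hχ hF hC r).comp (T := fun x => x + !₂[r, 0])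
    (by fun_prop)
  have h1 : Measurable fun t : ℝ => E.indicator (1 : ℝ → ℝ≥0∞) t := measurable_one.indicator hE
  have h2 : Measurable fun t : ℝ => F.indicator (1 : ℝ → ℝ≥0∞) t := measurable_one.indicator hF
  have h3 : Measurable fun z : Plane × Plane => ‖k z.1 z.2‖ₑ ^ 2 := hV.meas.enorm.pow_const 2
  have hc (x : Plane) (r : ℝ) : (x + !₂[r, 0]) 0 = x 0 + r := by simp
  simp_rw [fun r => hV.hsSq_mulOp_mul (hE' r) (hF' r), enorm_sliceWeight_sq hχ0,
    enorm_indicator_fst_sq, hc, add_sub_cancel_right]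
  rw [lintegral_lintegral_swap]
  · refine lintegral_congr fun z => ?_
    have e (r : ℝ) : E.indicator 1 (z.1 0 + r) * (F.indicator 1 (z.2 0 + r) *
        ENNReal.ofReal (χ (z.2 0))) * ‖k z.1 z.2‖ₑ ^ 2 =
        ENNReal.ofReal (χ (z.2 0)) * ‖k z.1 z.2‖ₑ ^ 2 *
          {r : ℝ | z.1 0 + r ∈ E ∧ z.2 0 + r ∈ F}.indicator 1 r := by
      by_cases hx : z.1 0 + r ∈ E
      · by_cases hy : z.2 0 + r ∈ F
        · have : r ∈ {r : ℝ | z.1 0 + r ∈ E ∧ z.2 0 + r ∈ F} := ⟨hx, hy⟩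
          simp only [Set.indicator_of_mem hx, Set.indicator_of_mem hy, Set.indicator_of_mem this,
            Pi.one_apply, one_mul, mul_one]
        · have : r ∉ {r : ℝ | z.1 0 + r ∈ E ∧ z.2 0 + r ∈ F} := fun h => hy h.2
          simp [Set.indicator_of_notMem hy, Set.indicator_of_notMem this]
      · have : r ∉ {r : ℝ | z.1 0 + r ∈ E ∧ z.2 0 + r ∈ F} := fun h => hx h.1
        simp [Set.indicator_of_notMem hx, Set.indicator_of_notMem this]
    have hm : MeasurableSet {r : ℝ | z.1 0 + r ∈ E ∧ z.2 0 + r ∈ F} :=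
      (hE.preimage (measurable_const_add _)).inter (hF.preimage (measurable_const_add _))
    simp_rw [e]
    rw [lintegral_const_mul _ (measurable_one.indicator hm), lintegral_indicator_one hm]
    ring
  · refine Measurable.aemeasurable ?_
    refine Measurable.mul (Measurable.mul ?_ (Measurable.mul ?_ ?_)) ?_
    · exact h1.comp (by fun_prop)
    · exact h2.comp (by fun_prop)
    · fun_prop
    · exact h3.comp measurable_snd

end IsLocalKernel

variable {Ω : Type*} [TopologicalSpace Ω] [MeasurableSpace Ω] [BorelSpace Ω]
    [AddAction Plane Ω] [ContinuousConstVAdd Plane Ω] {P : Measure Ω} [SFinite P]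
    [VAddInvariantMeasure Plane Ω P] {V : Ω → L2Plane →L[ℂ] L2Plane} {k : Ω → Plane → Plane → ℂ}
    {γ : ℝ}

omit [TopologicalSpace Ω] [BorelSpace Ω] [AddAction Plane Ω] [ContinuousConstVAdd Plane Ω] in
lemma WeaklyMeasurable.comp_fst {Y : Type*} [MeasurableSpace Y] (hV : WeaklyMeasurable V) :
    WeaklyMeasurable fun p : Ω × Y => V p.1 :=
  fun φ ψ => (hV φ ψ).comp measurable_fst

omit [TopologicalSpace Ω] [BorelSpace Ω] [AddAction Plane Ω] [ContinuousConstVAdd Plane Ω] in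
lemma measurable_hsSq_shifted_slice (hVm : WeaklyMeasurable V) (hχ : Measurable χ) {C : ℝ}
    (hC : ∀ t, χ t ≤ C) (hE : MeasurableSet E) (hF : MeasurableSet F) :
    Measurable fun p : Ω × ℝ => hsSq (mulOp (fun x => E.indicator 1 ((x + !₂[p.2, 0]) 0)) *
      V p.1 * mulOp fun x => sliceWeight χ F p.2 (x + !₂[p.2, 0])) := by
  refine ((WeaklyMeasurable.mul (WeaklyMeasurable.mulOp ?_ fun p =>
    (isBddMeas_indicator_fst hE).comp (by fun_prop)) hVm.comp_fst).mul
    (WeaklyMeasurable.mulOp ?_ fun p =>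
      (isBddMeas_sliceWeight hχ hF hC _).comp (by fun_prop))).hsSq
  · refine (measurable_one.indicator hE).comp ?_
    simp only [PiLp.add_apply]
    simp
    fun_prop
  · refine (measurable_sliceWeight hχ hF).comp (f := fun q : (Ω × ℝ) × Plane =>
      (q.1.2, q.2 + !₂[q.1.2, 0])) ?_
    have h : Continuous fun r : ℝ => (!₂[r, 0] : Plane) :=
      (PiLp.continuous_toLp 2 _).comp (by fun_prop)
    exact Measurable.prodMk (by fun_prop)
      (measurable_snd.add (h.measurable.comp (measurable_snd.comp measurable_fst)))

/-- The mean transport from `F` to `E`, per unit length. It is computed from the flow through all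
translates of `E` and `F`, because the mean is invariant under translations. -/
lemma lintegral_hsSq_crossing (hVm : WeaklyMeasurable V)
    (hcov : ∀ (ξ : Plane) (ω), ξ 1 = 0 →
      magTranslation γ ξ * V ω * star (magTranslation γ ξ) = V (ξ +ᵥ ω))
    (hV : ∀ ω, IsLocalKernel (V ω) (k ω)) (hχ : Measurable χ) (hχ0 : ∀ t, 0 ≤ χ t)
    {C : ℝ} (hC : ∀ t, χ t ≤ C) (hχ_int : ∫ t, χ t = 1) (hE : MeasurableSet E)
    (hF : MeasurableSet F) :
    ∫⁻ ω, hsSq (mulOp (fun x => E.indicator 1 (x 0)) * V ω * mulOp fun x => F.indicator 1 (x 0)) ∂P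
      = ∫⁻ ω, ∫⁻ z : Plane × Plane, ENNReal.ofReal (χ (z.2 0)) *
        volume {r : ℝ | z.1 0 + r ∈ E ∧ z.2 0 + r ∈ F} * ‖k ω z.1 z.2‖ₑ ^ 2
          ∂(volume.prod volume) ∂P := by
  have hE' := isBddMeas_indicator_fst hE
  have hm : WeaklyMeasurable fun p : Ω × ℝ => mulOp (fun x => E.indicator 1 (x 0)) * V p.1 *
      mulOp (sliceWeight χ F p.2) := by
    refine ((WeaklyMeasurable.const _).mul hVm.comp_fst).mul
      (WeaklyMeasurable.mulOp ?_ fun p => isBddMeas_sliceWeight hχ hF hC _)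
    exact (measurable_sliceWeight hχ hF).comp (f := fun q : (Ω × ℝ) × Plane => (q.1.2, q.2))
      (by fun_prop)
  simp_rw [fun ω => (hV ω).hsSq_eq_lintegral_slice hχ hχ0 hC hχ_int hE hF,
    ← fun ω => (hV ω).lintegral_hsSq_shifted_slice hχ hχ0 hC hE hF]
  rw [lintegral_lintegral_swap hm.hsSq.aemeasurable,
    lintegral_lintegral_swap (f := fun (ω : Ω) (r : ℝ) =>
      hsSq (mulOp (fun x => E.indicator 1 ((x + !₂[r, 0]) 0)) * V ω *
        mulOp fun x => sliceWeight χ F r (x + !₂[r, 0])))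
      (measurable_hsSq_shifted_slice hVm hχ hC hE hF).aemeasurable]
  refine lintegral_congr fun r => ?_
  have hm' : Measurable fun ω => hsSq (mulOp (fun x => E.indicator 1 (x 0)) * V ω *
      mulOp (sliceWeight χ F r)) := (((WeaklyMeasurable.const _).mul hVm).mul (.const _)).hsSq
  rw [← (measurePreserving_vadd (!₂[r, 0] : Plane) P).lintegral_comp hm']
  refine lintegral_congr fun ω => ?_
  rw [← hcov _ _ (by simp), hsSq_mulOp_magTranslation γ _ hE' (isBddMeas_sliceWeight hχ hF hC r)]

lemma halfOp_eq : halfOp = mulOp fun x => (Set.Ioi (0 : ℝ)).indicator 1 (x 0) := rfl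

lemma halfOpCompl_eq : halfOpCompl = mulOp fun x => (Set.Iic (0 : ℝ)).indicator 1 (x 0) := by
  rw [halfOpCompl]
  congr 1
  ext x
  by_cases h : 0 < x 0
  · have h1 : x ∉ halfPlaneᶜ := fun h' => h' h
    have h2 : x 0 ∉ Set.Iic (0 : ℝ) := not_le.mpr h
    rw [Set.indicator_of_notMem h1, Set.indicator_of_notMem h2]
  · have h1 : x ∈ halfPlaneᶜ := h
    have h2 : x 0 ∈ Set.Iic (0 : ℝ) := not_lt.mp h
    rw [Set.indicator_of_mem h1, Set.indicator_of_mem h2]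
    rfl

lemma ofReal_mul_volume (hχ0 : ∀ t, 0 ≤ χ t) (s t : ℝ) :
    ENNReal.ofReal (χ t) * volume {r : ℝ | s + r ∈ Set.Ioi 0 ∧ t + r ∈ Set.Iic 0} =
        ENNReal.ofReal (χ t * max (1 * (s - t)) 0) ∧
      ENNReal.ofReal (χ t) * volume {r : ℝ | s + r ∈ Set.Iic 0 ∧ t + r ∈ Set.Ioi 0} =
        ENNReal.ofReal (χ t * max (-1 * (s - t)) 0) := by
  have h1 : {r : ℝ | s + r ∈ Set.Ioi 0 ∧ t + r ∈ Set.Iic 0} = Set.Ioc (-s) (-t) := by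
    ext r
    simp only [Set.mem_ofPred_eq, Set.mem_Ioi, Set.mem_Iic, Set.mem_Ioc]
    constructor <;> rintro ⟨h1, h2⟩ <;> constructor <;> linarith
  have h2 : {r : ℝ | s + r ∈ Set.Iic 0 ∧ t + r ∈ Set.Ioi 0} = Set.Ioc (-t) (-s) := by
    ext r
    simp only [Set.mem_ofPred_eq, Set.mem_Ioi, Set.mem_Iic, Set.mem_Ioc]
    constructor <;> rintro ⟨h1, h2⟩ <;> constructor <;> linarith
  have h3 (a : ℝ) : ENNReal.ofReal (max a 0) = ENNReal.ofReal a := by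
    rcases le_total a 0 with h | h
    · rw [max_eq_right h, ENNReal.ofReal_zero, ENNReal.ofReal_of_nonpos h]
    · rw [max_eq_left h]
  rw [h1, h2, Real.volume_Ioc, Real.volume_Ioc, ENNReal.ofReal_mul (hχ0 t),
    ENNReal.ofReal_mul (hχ0 t), h3, h3]
  constructor <;> congr 2 <;> ring

lemma lintegral_volume_eq_flowDensity (hχ0 : ∀ t, 0 ≤ χ t) (k : Plane → Plane → ℂ) :
    ∫⁻ z : Plane × Plane, ENNReal.ofReal (χ (z.2 0)) *
        volume {r : ℝ | z.1 0 + r ∈ Set.Ioi 0 ∧ z.2 0 + r ∈ Set.Iic 0} * ‖k z.1 z.2‖ₑ ^ 2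
          ∂(volume.prod volume) = flowDensity χ k 1 ∧
      ∫⁻ z : Plane × Plane, ENNReal.ofReal (χ (z.2 0)) *
        volume {r : ℝ | z.1 0 + r ∈ Set.Iic 0 ∧ z.2 0 + r ∈ Set.Ioi 0} * ‖k z.1 z.2‖ₑ ^ 2
          ∂(volume.prod volume) = flowDensity χ k (-1) := by
  constructor <;> refine lintegral_congr fun z => ?_
  · rw [(ofReal_mul_volume hχ0 _ _).1]
  · rw [(ofReal_mul_volume hχ0 _ _).2]

omit [TopologicalSpace Ω] [BorelSpace Ω] [AddAction Plane Ω] [ContinuousConstVAdd Plane Ω] in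
lemma measurable_flowDensity (hχ : Measurable χ) (hχ0 : ∀ t, 0 ≤ χ t) {C : ℝ}
    (hC : ∀ t, χ t ≤ C) (hV : ∀ ω, IsLocalKernel (V ω) (k ω)) (hVm : WeaklyMeasurable V) :
    Measurable (fun ω => flowDensity χ (k ω) 1) ∧
      Measurable fun ω => flowDensity χ (k ω) (-1) := by
  rw [funext fun ω => (((hV ω).lintegral_hsSq_shifted_slice hχ hχ0 hC measurableSet_Ioi
      measurableSet_Iic).trans (lintegral_volume_eq_flowDensity hχ0 (k ω)).1).symm,
    funext fun ω => (((hV ω).lintegral_hsSq_shifted_slice hχ hχ0 hC measurableSet_Iic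
      measurableSet_Ioi).trans (lintegral_volume_eq_flowDensity hχ0 (k ω)).2).symm]
  exact ⟨(measurable_hsSq_shifted_slice hVm hχ hC measurableSet_Ioi
    measurableSet_Iic).lintegral_prod_right', (measurable_hsSq_shifted_slice hVm hχ hC
      measurableSet_Iic measurableSet_Ioi).lintegral_prod_right'⟩

/-- The mean flows into and out of the half-plane are the mean flow densities. -/
lemma lintegral_hsSq_halfOp (hVm : WeaklyMeasurable V)
    (hcov : ∀ (ξ : Plane) (ω), ξ 1 = 0 →
      magTranslation γ ξ * V ω * star (magTranslation γ ξ) = V (ξ +ᵥ ω))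
    (hV : ∀ ω, IsLocalKernel (V ω) (k ω)) (hχ : Measurable χ) (hχ0 : ∀ t, 0 ≤ χ t)
    {C : ℝ} (hC : ∀ t, χ t ≤ C) (hχ_int : ∫ t, χ t = 1) :
    ∫⁻ ω, hsSq (halfOp * V ω * halfOpCompl) ∂P = ∫⁻ ω, flowDensity χ (k ω) 1 ∂P ∧
      ∫⁻ ω, hsSq (halfOpCompl * V ω * halfOp) ∂P = ∫⁻ ω, flowDensity χ (k ω) (-1) ∂P := by
  simp_rw [← fun ω => (lintegral_volume_eq_flowDensity hχ0 (k ω)).1,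
    ← fun ω => (lintegral_volume_eq_flowDensity hχ0 (k ω)).2, halfOp_eq, halfOpCompl_eq]
  exact ⟨lintegral_hsSq_crossing hVm hcov hV hχ hχ0 hC hχ_int measurableSet_Ioi measurableSet_Iic,
    lintegral_hsSq_crossing hVm hcov hV hχ hχ0 hC hχ_int measurableSet_Iic measurableSet_Ioi⟩

end Crossing

/-! ### Operators along an orbit -/

section Orbits

open ContinuousLinearMap

variable {Ω : Type*} [TopologicalSpace Ω] [MeasurableSpace Ω] [BorelSpace Ω]
    [AddAction Plane Ω] [ContinuousConstVAdd Plane Ω] {P : Measure Ω}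
    {γ : ℝ} {χ : ℝ → ℝ}

lemma isBddMeas_cutoff (hχ : Measurable χ) (hχ0 : ∀ t, 0 ≤ χ t) {C : ℝ} (hC : ∀ t, χ t ≤ C)
    (r : ℝ) : IsBddMeas fun x : Plane => ((χ (x 0 + r) : ℝ) : ℂ) :=
  IsBddMeas.ofReal (a := fun t => χ (t + r)) (by fun_prop) fun t => by
    rw [abs_of_nonneg (hχ0 _)]; exact hC _

lemma cutoffOp_eq : cutoffOp χ = mulOp fun x => ((χ (x 0 + 0) : ℝ) : ℂ) := by
  simp only [add_zero]; rfl

section Family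

variable {V : Ω → L2Plane →L[ℂ] L2Plane} {k : Ω → Plane → Plane → ℂ}

omit [TopologicalSpace Ω] [MeasurableSpace Ω] [BorelSpace Ω] [ContinuousConstVAdd Plane Ω] in
lemma hsSq_shifted_cutoff (hcov : ∀ (ξ : Plane) (ω), ξ 1 = 0 →
      magTranslation γ ξ * V ω * star (magTranslation γ ξ) = V (ξ +ᵥ ω))
    (hχ : Measurable χ) (hχ0 : ∀ t, 0 ≤ χ t) {C : ℝ} (hC : ∀ t, χ t ≤ C) (r : ℝ) (ω : Ω) :
    hsSq (mulOp (fun x => ((χ (x 0 + r) : ℝ) : ℂ)) * V ω) =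
      hsSq (cutoffOp χ * V ((!₂[r, 0] : Plane) +ᵥ ω)) := by
  have h := hsSq_mulOp_magTranslation γ !₂[r, 0] (isBddMeas_cutoff hχ hχ0 hC 0)
    (IsBddMeas.const 1) (V ω)
  rw [mulOp_one, mul_one, mul_one, hcov _ _ (by simp), ← cutoffOp_eq] at h
  rw [h]
  congr 3
  ext x
  simp

omit [TopologicalSpace Ω] [MeasurableSpace Ω] [BorelSpace Ω] [ContinuousConstVAdd Plane Ω] in
/-- A traceclass cutoff along the whole orbit makes every strip Hilbert–Schmidt. -/
lemma hsSq_strip_lt_top_of_forall (hcov : ∀ (ξ : Plane) (ω), ξ 1 = 0 →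
      magTranslation γ ξ * V ω * star (magTranslation γ ξ) = V (ξ +ᵥ ω))
    (hV : ∀ ω, IsLocalKernel (V ω) (k ω)) (hχ : Measurable χ) (hχ0 : ∀ t, 0 ≤ χ t)
    {C : ℝ} (hC : ∀ t, χ t ≤ C) (hχ_supp : HasCompactSupport χ) (hχ_int : ∫ t, χ t = 1) {ω : Ω}
    (h : ∀ ξ : Plane, traceNorm (cutoffOp χ * V (ξ +ᵥ ω)) < ∞) (R : ℝ) :
    hsSq (mulOp ({x : Plane | |x 0| ≤ R}.indicator 1) * V ω) < ∞ := by
  refine (hV ω).hsSq_strip_lt_top hχ (C := C) (fun t => ?_) hχ_supp hχ_int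
    (ae_of_all _ fun r => ?_) R
  · rw [abs_of_nonneg (hχ0 t)]; exact hC t
  · rw [hsSq_shifted_cutoff hcov hχ hχ0 hC]
    exact hsSq_lt_top_of_traceNorm_lt_top (h _)

/-- Almost surely, by Fubini, almost all translates of the cutoff are traceclass, which suffices. -/
lemma ae_hsSq_strip_lt_top [SFinite P] [VAddInvariantMeasure Plane Ω P] (hVm : WeaklyMeasurable V)
    (hcov : ∀ (ξ : Plane) (ω), ξ 1 = 0 →
      magTranslation γ ξ * V ω * star (magTranslation γ ξ) = V (ξ +ᵥ ω))
    (hV : ∀ ω, IsLocalKernel (V ω) (k ω)) (hχ : Measurable χ) (hχ0 : ∀ t, 0 ≤ χ t)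
    {C : ℝ} (hC : ∀ t, χ t ≤ C) (hχ_supp : HasCompactSupport χ) (hχ_int : ∫ t, χ t = 1)
    (h : ∀ᵐ ω ∂P, traceNorm (cutoffOp χ * V ω) < ∞) :
    ∀ᵐ ω ∂P, ∀ R : ℝ, hsSq (mulOp ({x : Plane | |x 0| ≤ R}.indicator 1) * V ω) < ∞ := by
  have hm : Measurable fun p : Ω × ℝ =>
      hsSq (mulOp (fun x => ((χ (x 0 + p.2) : ℝ) : ℂ)) * V p.1) := by
    refine ((WeaklyMeasurable.mulOp ?_ fun p => isBddMeas_cutoff hχ hχ0 hC _).mul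
      hVm.comp_fst).hsSq
    have : Measurable fun q : (Ω × ℝ) × Plane => χ (q.2 0 + q.1.2) := hχ.comp (by fun_prop)
    exact Complex.measurable_ofReal.comp this
  have h1 : ∀ᵐ ω ∂P, ∀ᵐ r : ℝ, hsSq (mulOp (fun x => ((χ (x 0 + r) : ℝ) : ℂ)) * V ω) < ∞ := by
    refine (Measure.ae_ae_comm (p := fun ω r =>
      hsSq (mulOp (fun x => ((χ (x 0 + r) : ℝ) : ℂ)) * V ω) < ∞)
      (measurableSet_lt hm measurable_const)).mpr (ae_of_all _ fun r => ?_)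
    filter_upwards [(measurePreserving_vadd (!₂[r, 0] : Plane) P).quasiMeasurePreserving.ae h]
      with ω hω
    rw [hsSq_shifted_cutoff hcov hχ hχ0 hC]
    exact hsSq_lt_top_of_traceNorm_lt_top hω
  filter_upwards [h1] with ω hω R
  refine (hV ω).hsSq_strip_lt_top hχ (C := C) (fun t => ?_) hχ_supp hχ_int hω R
  · rw [abs_of_nonneg (hχ0 t)]; exact hC t

end Family

section Boundary

variable {U : L2Plane →L[ℂ] L2Plane}

/-- Magnetic translations along the boundary of the half-plane act unitarily on `L²(ℝ₊ × ℝ)`. -/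
lemma isFredholm_halfCompression_conj {ξ : Plane} (hξ : ξ 0 = 0)
    (hT : (halfCompression U).IsFredholm) :
    (halfCompression (magTranslation γ ξ * U * star (magTranslation γ ξ))).IsFredholm ∧
      fredholmIndex (halfCompression (magTranslation γ ξ * U * star (magTranslation γ ξ))) =
        fredholmIndex (halfCompression U) := by
  set W := magTranslation γ ξ
  have hcomm : halfOp * W = W * halfOp := by
    rw [halfOp, mulOp_mul_magTranslation γ ξ isBddMeas_half]
    congr 2
    ext x
    have : (x + ξ) 0 = x 0 := by simp [hξ]
    simp only [Set.indicator, halfPlane, Set.mem_ofPred_eq, this]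
    rfl
  have hcomm' : star W * halfOp = halfOp * star W := by
    have := congr(star $hcomm)
    rwa [star_mul, star_mul, star_halfOp] at this
  set w : L2Half →L[ℂ] L2Half := halfCompression W
  set v : L2Half →L[ℂ] L2Half := halfCompression (star W)
  -- compression is multiplicative for operators that commute with the projection
  have hmul (A B : L2Plane →L[ℂ] L2Plane) :
      halfCompression A * halfCompression B = halfCompression (A * halfOp * B) := by
    rw [← adjoint_restrictHalf_comp]; rfl
  have hright (A : L2Plane →L[ℂ] L2Plane) : halfCompression (A * halfOp) = halfCompression A := by
    change restrictHalf ∘L A ∘L (halfOp ∘L restrictHalf.adjoint) = _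
    rw [halfOp_comp_adjoint]; rfl
  have h1 : halfCompression 1 = 1 := restrictHalf_comp_adjoint
  have hwv : w * v = 1 := by
    rw [hmul, mul_assoc, ← hcomm', ← mul_assoc, magTranslation_mul_star, one_mul,
      ← one_mul halfOp, hright, h1]
  have hvw : v * w = 1 := by
    rw [hmul, mul_assoc, hcomm, ← mul_assoc, star_magTranslation_mul, one_mul,
      ← one_mul halfOp, hright, h1]
  have hconj : halfCompression (W * U * star W) = w * halfCompression U * v := by
    have e : W * halfOp * U * halfOp * star W = halfOp * (W * U * star W) * halfOp := by
      rw [← hcomm, mul_assoc _ halfOp (star W), ← hcomm']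
      simp only [mul_assoc]
    have hleft (A : L2Plane →L[ℂ] L2Plane) : halfCompression (halfOp * A) = halfCompression A := by
      have := congr(adjoint $(hright (star A)))
      rw [adjoint_halfCompression, adjoint_halfCompression] at this
      rwa [star_mul, star_star, star_halfOp] at this
    rw [hmul, hmul, e, hright, hleft]
  rw [hconj]
  exact isFredholm_conj hwv hvw hT

lemma continuous_halfCompression : Continuous halfCompression := by
  unfold halfCompression
  fun_prop

/-- The index is constant along a norm-continuous family of Fredholm operators. -/
lemma fredholmIndex_eq_of_continuous {X : Type*} [TopologicalSpace X] [PreconnectedSpace X]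
    {A : X → L2Plane →L[ℂ] L2Plane} (hA : Continuous A)
    (hF : ∀ x, (halfCompression (A x)).IsFredholm) (x y : X) :
    fredholmIndex (halfCompression (A x)) = fredholmIndex (halfCompression (A y)) := by
  have h : IsLocallyConstant fun x => fredholmIndex (halfCompression (A x)) := by
    refine (IsLocallyConstant.iff_eventually_eq _).mpr fun x => ?_
    filter_upwards [((continuous_halfCompression.comp hA).tendsto x).eventually
      (eventually_fredholmIndex_eq (hF x))] with y hy
    exact hy (hF y)
  exact h.apply_eq_of_preconnectedSpace x y

end Boundary

end Orbits

/-! ### The index theorem -/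

section Main

open ContinuousLinearMap

variable {Ω : Type*} [TopologicalSpace Ω] [MeasurableSpace Ω] [BorelSpace Ω]
    [AddAction Plane Ω] [ContinuousConstVAdd Plane Ω] {P : Measure Ω}
    {γ : ℝ} {χ : ℝ → ℝ}

namespace IsCovariantFamily

variable {A : Hull Ω → L2Plane →L[ℂ] L2Plane}

omit [BorelSpace Ω] [ContinuousConstVAdd Plane Ω] in
lemma continuous_inner (hA : IsCovariantFamily γ P A) (s : ℝ) (φ ψ : L2Plane) :
    Continuous fun ω => ⟪φ, A (ω, (s : WithTop ℝ)) ψ⟫_ℂ :=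
  (hA.weaklyContinuous φ ψ).comp (Continuous.prodMk_left _)

omit [ContinuousConstVAdd Plane Ω] in
lemma weaklyMeasurable (hA : IsCovariantFamily γ P A) (s : ℝ) :
    WeaklyMeasurable fun ω => A (ω, (s : WithTop ℝ)) :=
  fun φ ψ => (hA.continuous_inner s φ ψ).measurable

omit [BorelSpace Ω] [ContinuousConstVAdd Plane Ω] in
lemma covariant_horizontal (hA : IsCovariantFamily γ P A) (s : ℝ) (ξ : Plane) (ω : Ω)
    (hξ : ξ 1 = 0) :
    magTranslation γ ξ * A (ω, (s : WithTop ℝ)) * star (magTranslation γ ξ) =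
      A (ξ +ᵥ ω, (s : WithTop ℝ)) := by
  rw [hA.covariant, hullShift, hξ]
  simp

end IsCovariantFamily

lemma enorm_opTrace_mul_le (T Z : L2Plane →L[ℂ] L2Plane) :
    ‖opTrace (T * Z)‖ₑ ≤ (1 + ‖Z‖ₑ ^ 2) * traceNorm T := by
  refine enorm_tsum_le_tsum_enorm.trans ((tsum_enorm_inner_le 1 T Z).trans ?_)
  gcongr
  have h : ‖(1 : L2Plane →L[ℂ] L2Plane)‖ₑ ≤ 1 := enorm_le_one_of_unitary (one_mem _)
  calc ‖(1 : L2Plane →L[ℂ] L2Plane)‖ₑ ^ 2 ≤ 1 ^ 2 := by gcongr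
    _ = 1 := one_pow 2

lemma enorm_le_of_norm_le {T : L2Plane →L[ℂ] L2Plane} {C : ℝ} (h : ‖T‖ ≤ C) : ‖T‖ₑ ≤ ‖C‖ₑ := by
  rw [← ofReal_norm, ← ofReal_norm]
  exact ENNReal.ofReal_le_ofReal (h.trans (le_abs_self C))

end Main

theorem mainTheorem2 {Ω : Type*} [TopologicalSpace Ω] [CompactSpace Ω]
    [MeasurableSpace Ω] [BorelSpace Ω] [AddAction Plane Ω] [ContinuousConstVAdd Plane Ω]
    (P : Measure Ω) [IsProbabilityMeasure P] [ErgodicVAdd Plane Ω P]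
    (γ : ℝ)
    -- the cutoff function that defines the trace
    (χ : ℝ → ℝ) (hχ_meas : Measurable χ) (hχ_nonneg : ∀ t, 0 ≤ χ t)
    (hχ_bdd : ∃ C, ∀ t, χ t ≤ C) (hχ_supp : HasCompactSupport χ) (hχ_int : ∫ t, χ t = 1)
    -- the unitary family `U`, with `U - 1` in the algebra and `k` the kernel of `U - 1`
    (U : Hull Ω → L2Plane →L[ℂ] L2Plane) (hU : ∀ p, U p ∈ unitary (L2Plane →L[ℂ] L2Plane))
    (hU_cov : IsCovariantFamily γ P fun p => U p - 1)
    (hU_tr : IsTHatTraceClass P χ fun p => U p - 1)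
    (k : Hull Ω → Plane → Plane → ℂ) (hk : ∀ p, HasKernel (U p - 1) (k p))
    (hk_cont : ∀ p, Continuous fun z : Plane × Plane => k p z.1 z.2)
    -- `D` is `∇₁U`, and it belongs to the algebra
    (D : Hull Ω → L2Plane →L[ℂ] L2Plane) (hD : IsNablaOne U D)
    (hD_cov : IsCovariantFamily γ P D)
    -- `G` is `|∇₁|U`, and it belongs to the algebra
    (G : Hull Ω → L2Plane →L[ℂ] L2Plane)
    (hG : ∀ p, HasKernel (G p) fun x y => ((|x 0 - y 0| : ℝ) : ℂ) * k p x y)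
    (hG_cov : IsCovariantFamily γ P G) :
    -- Fredholm property, almost surely and on every orbit where all operators are traceclass
    (∀ s : ℝ, ∀ᵐ ω ∂P, (halfCompression (U (ω, (s : WithTop ℝ)))).IsFredholm) ∧
    (∀ (s : ℝ) (ω : Ω),
      (∀ ξ : Plane, traceNorm (cutoffOp χ * (U (ξ +ᵥ ω, (s : WithTop ℝ)) - 1)) < ∞) →
        (halfCompression (U (ω, (s : WithTop ℝ)))).IsFredholm) ∧
    -- the family on the right of the index formula is traceclass, with integrable trace
    (IsTHatTraceClass P χ fun p => (star (U p) - 1) * D p) ∧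
    (∀ s : ℝ, Integrable
      (fun ω => opTrace (cutoffOp χ *
        ((star (U (ω, (s : WithTop ℝ))) - 1) * D (ω, (s : WithTop ℝ))))) P) ∧
    -- the index
    ((∀ (s : ℝ) (ω : Ω), Continuous fun ξ : Plane => U (ξ +ᵥ ω, (s : WithTop ℝ))) →
      (∀ ω : Ω,
        (∀ (s : ℝ) (ξ : Plane),
          traceNorm (cutoffOp χ * (U (ξ +ᵥ ω, (s : WithTop ℝ)) - 1)) < ∞) →
        ∀ s s' : ℝ, fredholmIndex (halfCompression (U (ω, (s : WithTop ℝ)))) =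
          fredholmIndex (halfCompression (U (ω, (s' : WithTop ℝ))))) ∧
      ∃ n : ℤ,
        (∀ᵐ ω ∂P, ∀ s : ℝ, (halfCompression (U (ω, (s : WithTop ℝ)))).IsFredholm ∧
          fredholmIndex (halfCompression (U (ω, (s : WithTop ℝ)))) = n) ∧
        ∀ s : ℝ, (n : ℂ) = Complex.I * tHat P χ (fun p => (star (U p) - 1) * D p) s) := by
  obtain ⟨C, hC⟩ := hχ_bdd
  have hχb : IsBddMeas fun x : Plane => ((χ (x 0) : ℝ) : ℂ) := by
    simpa using isBddMeas_cutoff hχ_meas hχ_nonneg hC 0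
  -- the kernels
  have hVk (p) : IsLocalKernel (U p - 1) (k p) := .of_hasKernel (hk p) (hk_cont p)
  have hGk (p) : IsLocalKernel (G p) fun x y => ((|x 0 - y 0| : ℝ) : ℂ) * k p x y :=
    .of_hasKernel (hG p) (by have := hk_cont p; fun_prop)
  have hDk (p) := hD.isLocalKernel hVk p
  -- the families over `Ω × {s}`
  have hVm (s : ℝ) := hU_cov.weaklyMeasurable s
  have hcov (s : ℝ) := hU_cov.covariant_horizontal s
  have hTm (s : ℝ) : Measurable fun ω => traceNorm (cutoffOp χ * (U (ω, (s : WithTop ℝ)) - 1)) := by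
    obtain ⟨B, hB⟩ := exists_forall_norm_le_of_continuous_inner (hU_cov.continuous_inner s)
    refine ((WeaklyMeasurable.const (cutoffOp χ)).mul (hVm s)).traceNorm
      (C := ‖cutoffOp χ‖ * B) fun ω => (norm_mul_le _ _).trans ?_
    gcongr
    exact hB ω
  have hTfin (s : ℝ) : ∀ᵐ ω ∂P, traceNorm (cutoffOp χ * (U (ω, (s : WithTop ℝ)) - 1)) < ∞ :=
    ae_lt_top (hTm s) (hU_tr s).ne
  have hstrip (s : ℝ) := ae_hsSq_strip_lt_top (hVm s) (hcov s) (fun ω => hVk _) hχ_meas hχ_nonneg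
    hC hχ_supp hχ_int (hTfin s)
  have hstrip' (s : ℝ) (ω : Ω)
      (h : ∀ ξ : Plane, traceNorm (cutoffOp χ * (U (ξ +ᵥ ω, (s : WithTop ℝ)) - 1)) < ∞) :=
    hsSq_strip_lt_top_of_forall (hcov s) (fun ω => hVk _) hχ_meas hχ_nonneg hC hχ_supp hχ_int h
  have hFred (s : ℝ) (ω : Ω)
      (h : ∀ ξ : Plane, traceNorm (cutoffOp χ * (U (ξ +ᵥ ω, (s : WithTop ℝ)) - 1)) < ∞) :
      (halfCompression (U (ω, (s : WithTop ℝ)))).IsFredholm := by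
    obtain ⟨h1, h2⟩ := isCompactOperator_halfOp (hU _) (hVk _) (hGk _) (hstrip' s ω h)
    exact isFredholm_halfCompression (hU _) h1 h2
  -- the trace of `χ (U* - 1) ∇₁ U`
  have htrace (p) : cutoffOp χ * ((star (U p) - 1) * D p) =
      cutoffOp χ * star (U p - 1) * D p := by rw [star_sub, star_one, mul_assoc]
  obtain hDb := fun s : ℝ => exists_forall_norm_le_of_continuous_inner (hD_cov.continuous_inner s)
  obtain hGb := fun s : ℝ => exists_forall_norm_le_of_continuous_inner (hG_cov.continuous_inner s)
  have hint (s : ℝ) : Integrable (fun ω => opTrace (cutoffOp χ *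
      ((star (U (ω, (s : WithTop ℝ))) - 1) * D (ω, (s : WithTop ℝ))))) P := by
    obtain ⟨B, hB⟩ := hDb s
    simp_rw [htrace]
    refine ⟨((((WeaklyMeasurable.const (cutoffOp χ)).mul (hVm s).star).mul
      (hD_cov.weaklyMeasurable s)).opTrace).aestronglyMeasurable, ?_⟩
    refine (lintegral_mono (g := fun ω => (1 + ‖B‖ₑ ^ 2) * (2 *
      traceNorm (cutoffOp χ * (U (ω, (s : WithTop ℝ)) - 1)))) fun ω => ?_).trans_lt ?_
    · refine (enorm_opTrace_mul_le _ _).trans ?_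
      beta_reduce
      gcongr
      · exact enorm_le_of_norm_le (hB ω)
      · exact traceNorm_cutoffOp_mul_star_le (hU _)
    · rw [lintegral_const_mul' _ _ (by simp), lintegral_const_mul' _ _ (by simp)]
      exact ENNReal.mul_lt_top (by simp) (ENNReal.mul_lt_top (by simp) (hU_tr s))
  -- the flow densities
  have hflow (s : ℝ) (σ : ℝ) (hσ : σ = 1 ∨ σ = -1) :
      ∫⁻ ω, flowDensity χ (k (ω, (s : WithTop ℝ))) σ ∂P < ∞ := by
    obtain ⟨B, hB⟩ := hDb s
    obtain ⟨B', hB'⟩ := hGb s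
    set c := ‖(1 / 2 : ℂ)‖ * B' + ‖-(σ * Complex.I) / 2‖ * B
    refine (lintegral_mono_ae (g := fun ω => (1 + ‖c‖ₑ ^ 2) * (2 *
      traceNorm (cutoffOp χ * (U (ω, (s : WithTop ℝ)) - 1)))) ?_).trans_lt ?_
    · filter_upwards [hTfin s] with ω hω
      refine (flowDensity_le (hU _) (hVk _) (hDk _) (hGk _) hχb hχ_nonneg hσ hω).1.trans ?_
      beta_reduce
      gcongr
      refine enorm_le_of_norm_le ((norm_add_le _ _).trans ?_)
      rw [norm_smul, norm_smul]
      exact add_le_add (mul_le_mul_of_nonneg_left (hB' ω) (norm_nonneg _))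
        (mul_le_mul_of_nonneg_left (hB ω) (norm_nonneg _))
    · rw [lintegral_const_mul' _ _ (by simp), lintegral_const_mul' _ _ (by simp)]
      exact ENNReal.mul_lt_top (by simp) (ENNReal.mul_lt_top (by simp) (hU_tr s))
  -- translation along the boundary relates the boundary parameter `s` to the parameter `0`
  have hshift (s : ℝ) (ω : Ω) (h : (halfCompression (U ((!₂[0, -s] : Plane) +ᵥ ω,
      ((0 : ℝ) : WithTop ℝ)))).IsFredholm) :
      (halfCompression (U (ω, (s : WithTop ℝ)))).IsFredholm ∧
        fredholmIndex (halfCompression (U (ω, (s : WithTop ℝ)))) = fredholmIndex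
          (halfCompression (U ((!₂[0, -s] : Plane) +ᵥ ω, ((0 : ℝ) : WithTop ℝ)))) := by
    have h1 := hU_cov.covariant !₂[0, s] ((!₂[0, -s] : Plane) +ᵥ ω, ((0 : ℝ) : WithTop ℝ))
    have h2 : hullShift !₂[0, s] ((!₂[0, -s] : Plane) +ᵥ ω, ((0 : ℝ) : WithTop ℝ)) =
        (ω, (s : WithTop ℝ)) := by
      have h3 : (!₂[0, s] : Plane) + !₂[0, -s] = 0 := by
        ext i; fin_cases i <;> simp
      simp [hullShift, vadd_vadd, h3]
    simp only [h2, mul_sub, sub_mul, mul_one, magTranslation_mul_star, sub_left_inj] at h1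
    rw [← h1]
    exact isFredholm_halfCompression_conj (by simp) h
  have hconst (hcont : ∀ (s : ℝ) (ω : Ω), Continuous fun ξ : Plane => U (ξ +ᵥ ω, (s : WithTop ℝ)))
      (ω : Ω) (h : ∀ ξ : Plane,
        (halfCompression (U (ξ +ᵥ ω, ((0 : ℝ) : WithTop ℝ)))).IsFredholm) (s : ℝ) :
      fredholmIndex (halfCompression (U (ω, (s : WithTop ℝ)))) =
        fredholmIndex (halfCompression (U (ω, ((0 : ℝ) : WithTop ℝ)))) := by
    rw [(hshift s ω (h _)).2, fredholmIndex_eq_of_continuous (hcont 0 ω) h _ 0, zero_vadd]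
  refine ⟨fun s => ?_, hFred, fun s => ?_, hint, fun hcont => ⟨fun ω h => ?_, ?_⟩⟩
  · filter_upwards [hstrip s] with ω hω
    obtain ⟨h1, h2⟩ := isCompactOperator_halfOp (hU _) (hVk _) (hGk _) hω
    exact isFredholm_halfCompression (hU _) h1 h2
  · obtain ⟨B, hB⟩ := hDb s
    refine (lintegral_mono (g := fun ω => (1 + ‖B‖ₑ ^ 2) * (2 *
      traceNorm (cutoffOp χ * (U (ω, (s : WithTop ℝ)) - 1)))) fun ω => ?_).trans_lt ?_
    · simp only [htrace]
      refine (traceNorm_mul_le _ _).trans ?_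
      gcongr
      · exact enorm_le_of_norm_le (hB ω)
      · exact traceNorm_cutoffOp_mul_star_le (hU _)
    · rw [lintegral_const_mul' _ _ (by simp), lintegral_const_mul' _ _ (by simp)]
      exact ENNReal.mul_lt_top (by simp) (ENNReal.mul_lt_top (by simp) (hU_tr s))
  · intro s s'
    rw [hconst hcont ω (fun ξ => hFred 0 _ fun η => by rw [vadd_vadd]; exact h 0 _) s,
      hconst hcont ω (fun ξ => hFred 0 _ fun η => by rw [vadd_vadd]; exact h 0 _) s']
  · -- Fredholm operators along almost every orbit
    have hF : ∀ᵐ ω ∂P, ∀ ξ : Plane,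
        (halfCompression (U (ξ +ᵥ ω, ((0 : ℝ) : WithTop ℝ)))).IsFredholm := by
      obtain ⟨S, hS, hSd⟩ := TopologicalSpace.exists_countable_dense Plane
      have h1 : ∀ᵐ ω ∂P, ∀ ξ ∈ S, ∀ R : ℝ, hsSq (mulOp ({x : Plane | |x 0| ≤ R}.indicator 1) *
          (U (ξ +ᵥ ω, ((0 : ℝ) : WithTop ℝ)) - 1)) < ∞ :=
        (ae_ball_iff hS).mpr fun ξ _ =>
          (measurePreserving_vadd ξ P).quasiMeasurePreserving.ae (hstrip 0)
      filter_upwards [h1] with ω hω ξ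
      -- compactness passes from a dense set of `ξ` to all `ξ`
      have hall (A B : L2Plane →L[ℂ] L2Plane)
          (h : ∀ ξ ∈ S, IsCompactOperator ⇑(A * (U (ξ +ᵥ ω, ((0 : ℝ) : WithTop ℝ)) - 1) * B)) :
          IsCompactOperator ⇑(A * (U (ξ +ᵥ ω, ((0 : ℝ) : WithTop ℝ)) - 1) * B) := by
        have hc : Continuous fun ξ : Plane =>
            A * (U (ξ +ᵥ ω, ((0 : ℝ) : WithTop ℝ)) - 1) * B :=
          (continuous_const.mul ((hcont 0 ω).sub continuous_const)).mul continuous_const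
        have hcl : IsClosed {ξ : Plane |
            IsCompactOperator ⇑(A * (U (ξ +ᵥ ω, ((0 : ℝ) : WithTop ℝ)) - 1) * B)} :=
          isClosed_setOfPred_isCompactOperator.preimage hc
        exact hcl.closure_subset_iff.mpr h (hSd.closure_eq ▸ Set.mem_univ ξ)
      exact isFredholm_halfCompression (hU _)
        (hall _ _ fun ξ hξ => (isCompactOperator_halfOp (hU _) (hVk _) (hGk _) (hω ξ hξ)).1)
        (hall _ _ fun ξ hξ => (isCompactOperator_halfOp (hU _) (hVk _) (hGk _) (hω ξ hξ)).2)
    -- the index is almost surely given by the Fedosov formula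
    have hmeas (s : ℝ) (A B : L2Plane →L[ℂ] L2Plane) :
        Measurable fun ω => hsSq (A * (U (ω, (s : WithTop ℝ)) - 1) * B) :=
      (((WeaklyMeasurable.const A).mul (hVm s)).mul (.const B)).hsSq
    have hmean (s : ℝ) := lintegral_hsSq_halfOp (P := P) (hVm s) (hcov s)
      (fun ω => hVk (ω, (s : WithTop ℝ))) hχ_meas hχ_nonneg hC hχ_int
    have hfin1 (s : ℝ) :
        ∫⁻ ω, hsSq (halfOp * (U (ω, (s : WithTop ℝ)) - 1) * halfOpCompl) ∂P < ∞ := by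
      rw [(hmean s).1]; exact hflow s 1 (Or.inl rfl)
    have hfin2 (s : ℝ) :
        ∫⁻ ω, hsSq (halfOpCompl * (U (ω, (s : WithTop ℝ)) - 1) * halfOp) ∂P < ∞ := by
      rw [(hmean s).2]; exact hflow s (-1) (Or.inr rfl)
    set f : ℝ → Ω → ℝ := fun s ω =>
      (hsSq (halfOpCompl * (U (ω, (s : WithTop ℝ)) - 1) * halfOp)).toReal -
        (hsSq (halfOp * (U (ω, (s : WithTop ℝ)) - 1) * halfOpCompl)).toReal with hf
    have hindex (s : ℝ) : ∀ᵐ ω ∂P,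
        (fredholmIndex (halfCompression (U (ω, (s : WithTop ℝ)))) : ℝ) = f s ω := by
      filter_upwards [hstrip s, ae_lt_top (hmeas s _ _) (hfin2 s).ne] with ω h1 h2
      obtain ⟨h3, h4⟩ := isCompactOperator_halfOp (hU _) (hVk _) (hGk _) h1
      exact fredholmIndex_halfCompression (hU _) (isFredholm_halfCompression (hU _) h3 h4) h2
    -- the index is almost surely constant
    obtain ⟨n, hn⟩ : ∃ n : ℤ, ∀ᵐ ω ∂P,
        fredholmIndex (halfCompression (U (ω, ((0 : ℝ) : WithTop ℝ)))) = n := by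
      have hS (m : ℤ) : EventuallyConst
          {ω | fredholmIndex (halfCompression (U (ω, ((0 : ℝ) : WithTop ℝ)))) = m} (ae P) := by
        refine aeconst_of_forall_preimage_vadd_ae_eq Plane ?_ fun ξ => ?_
        · have hfm : Measurable (f 0) :=
            (hmeas 0 _ _).ennreal_toReal.sub (hmeas 0 _ _).ennreal_toReal
          refine NullMeasurableSet.congr
            (hfm (measurableSet_singleton (m : ℝ))).nullMeasurableSet ?_
          filter_upwards [hindex 0] with ω hω
          refine propext ?_
          change f 0 ω = m ↔ fredholmIndex (halfCompression (U (ω, ((0 : ℝ) : WithTop ℝ)))) = m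
          rw [← hω]
          norm_cast
        · filter_upwards [hF] with ω hω
          refine propext ?_
          change fredholmIndex (halfCompression (U (ξ +ᵥ ω, ((0 : ℝ) : WithTop ℝ)))) = m ↔
            fredholmIndex (halfCompression (U (ω, ((0 : ℝ) : WithTop ℝ)))) = m
          have h1 := fredholmIndex_eq_of_continuous (hcont 0 ω) hω ξ 0
          rw [zero_vadd] at h1
          rw [h1]
      by_contra hne
      have hnull (m : ℤ) : ∀ᵐ ω ∂P,
          fredholmIndex (halfCompression (U (ω, ((0 : ℝ) : WithTop ℝ)))) ≠ m :=
        (eventuallyConst_set.mp (hS m)).resolve_left fun h => hne ⟨m, h⟩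
      obtain ⟨ω, hω⟩ := (ae_all_iff.mpr hnull).exists
      exact hω _ rfl
    refine ⟨n, ?_, fun s => ?_⟩
    · filter_upwards [hF, hn] with ω h1 h2 s
      exact ⟨(hshift s ω (h1 _)).1, (hconst hcont ω h1 s).trans h2⟩
    · -- the mean of the index
      have h1 : ∀ᵐ ω ∂P, f s ω = n := by
        filter_upwards [hF, hn, hindex s] with ω h1 h2 h3
        rw [← h3, hconst hcont ω h1 s, h2]
      have hflowm := measurable_flowDensity hχ_meas hχ_nonneg hC
        (fun ω => hVk (ω, (s : WithTop ℝ))) (hVm s)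
      have i1 := integrable_toReal_of_lintegral_ne_top hflowm.1.aemeasurable
        (hflow s 1 (Or.inl rfl)).ne
      have i2 := integrable_toReal_of_lintegral_ne_top hflowm.2.aemeasurable
        (hflow s (-1) (Or.inr rfl)).ne
      have h2 : (n : ℝ) = ∫ ω, ((flowDensity χ (k (ω, (s : WithTop ℝ))) (-1)).toReal -
          (flowDensity χ (k (ω, (s : WithTop ℝ))) 1).toReal) ∂P := by
        rw [integral_sub i2 i1, integral_toReal hflowm.2.aemeasurable
          (ae_lt_top hflowm.2 (hflow s (-1) (Or.inr rfl)).ne),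
          integral_toReal hflowm.1.aemeasurable
          (ae_lt_top hflowm.1 (hflow s 1 (Or.inl rfl)).ne), ← (hmean s).1, ← (hmean s).2,
          ← integral_toReal (hmeas s _ _).aemeasurable (ae_lt_top (hmeas s _ _) (hfin1 s).ne),
          ← integral_toReal (hmeas s _ _).aemeasurable (ae_lt_top (hmeas s _ _) (hfin2 s).ne),
          ← integral_sub (integrable_toReal_of_lintegral_ne_top (hmeas s _ _).aemeasurable
            (hfin2 s).ne) (integrable_toReal_of_lintegral_ne_top (hmeas s _ _).aemeasurable
            (hfin1 s).ne)]
        change _ = ∫ ω, f s ω ∂P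
        rw [integral_congr_ae h1]
        simp
      rw [tHat, ← integral_const_mul]
      have h3 : ∫ ω, Complex.I * opTrace (cutoffOp χ *
          ((star (U (ω, (s : WithTop ℝ))) - 1) * D (ω, (s : WithTop ℝ)))) ∂P =
          ∫ ω, (((flowDensity χ (k (ω, (s : WithTop ℝ))) (-1)).toReal -
          (flowDensity χ (k (ω, (s : WithTop ℝ))) 1).toReal : ℝ) : ℂ) ∂P := by
        refine integral_congr_ae ?_
        filter_upwards [hTfin s] with ω hω
        rw [I_mul_opTrace_eq (hU _) (hVk _) (hDk _) (hGk _) hχb hχ_nonneg hω]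
        push_cast
        rfl
      rw [h3, integral_complex_ofReal, ← h2]
      norm_cast

end
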